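/- Let $f:G\twoheadrightarrow H$ be a surjective homomorphism of finite groups whose kernel is a characteristic subgroup of $G$, let $f_*:\mathrm{Aut}(G)\to\mathrm{Aut}(H)$ be the homomorphism determined by $f_*(\theta)\circ f=f\circ\theta$, and let $P$ be a finitely generated projective (left) $\mathbb{Z}G$-module. Notation. For a finite group $K$, let $C(\mathbb{Z}K)$ be the projective class group, that is, the group of finitely generated projective modules modulo $M\sim N$ if $M\oplus\mathbb{Z}K^i\cong N\oplus\mathbb{Z}K^j$ for some $i,j\ge 0$. For a f.g. projective $\mathbb{Z}K$-module $M$, let $[M]$ also denote the set of isomorphism classes of nonzero f.g. projective modules $Q$ with $Q\oplus\mathbb{Z}K^i\cong M\oplus\mathbb{Z}K^j$ for some $i,j\ge0$. It is a graded tree: it is graded by rank and has an edge between $Q$ and $Q\oplus\mathbb{Z}K$ for each $Q$. (In general, a graded tree is a tree with a grading of its vertices such that edges join consecutive grades and each vertex is joined to exactly one vertex of the next grade; maps of graded trees preserve edges and grades.) For $\theta\in\mathrm{Aut}(K)$ let $M_\theta$ be $M$ with $g\in K$ acting as $\theta(g)$. For $r\in(\mathbb{Z}/|K|)^\times$, represented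 by a positive integer, let $(I_K,r)\subseteq\mathbb{Z}K$ be the two-sided ideal generated by $r$ and the augmentation ideal $I_K$. A pair $(\theta,r)$ sends a projective module $Q$ of rank one to $(I_K,r)\otimes_{\mathbb{Z}K}Q_\theta$ and, more generally, $Q\cong Q_1\oplus\mathbb{Z}K^i$ with $Q_1$ of rank one to $\big((I_K,r)\otimes_{\mathbb{Z}K}(Q_1)_\theta\big)\oplus\mathbb{Z}K^i$. Suppose that $\mathrm{Aut}(G)$ acts on $[P]$, via a homomorphism $\psi:\mathrm{Aut}(G)\to(\mathbb{Z}/|G|)^\times$ with $[P]-[P_\theta]=[(I_G,\psi(\theta))]$ in $C(\mathbb{Z}G)$ for all $\theta\in\mathrm{Aut}(G)$; here $\theta$ acts on $[P]$ by the pair $(\theta,\psi(\theta))$. Let $\bar P=f_\#(P)=\mathbb{Z}H\otimes_{\mathbb{Z}G}P$, and let $\bar\psi(\theta)\in(\mathbb{Z}/|H|)^\times$ be the reduction of $\psi(\theta)$. Then $$[\bar P]-[\bar P_{f_*(\theta)}]=[(I_H,\bar\psi(\theta))]\in C(\mathbb{Z}H)\quad\text{for all }\theta\in\mathrm{Aut}(G).$$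 Let $[\bar P]/\mathrm{Im}(f_*)$ be the set of orbits for the action induced by $f$, in which $f_*(\theta)\in\mathrm{Im}(f_*)$ acts by the pair $(f_*(\theta),\bar\psi(\theta))$, for $\theta\in\mathrm{Aut}(G)$. Then $[P]/\mathrm{Aut}(G)$ and $[\bar P]/\mathrm{Im}(f_*)$, with the induced edges and gradings, are graded trees, every $Q\in[P]$ has $f_\#(Q)\in[\bar P]$, and $Q\mapsto f_\#(Q)$ induces a well-defined surjection of graded trees $$f_\#:[P]/\mathrm{Aut}(G)\twoheadrightarrow[\bar P]/\mathrm{Im}(f_*).$$ In particular, if $\bar\psi=\varphi\circ f_*$ for a homomorphism $\varphi:\mathrm{Im}(f_*)\to(\mathbb{Z}/|H|)^\times$, then $[\bar P]-[\bar P_\alpha]=[(I_H,\varphi(\alpha))]$ for all $\alpha\in\mathrm{Im}(f_*)$, and the above holds with $[\bar P]/\mathrm{Im}(f_*)$ the set of orbits of $\mathrm{Im}(f_*)$ acting on $[\bar P]$ by the pairs $(\alpha,\varphi(\alpha))$, $\alpha\in\mathrm{Im}(f_*)$. -/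

import Mathlib

open scoped TensorProduct

universe u

noncomputable section

namespace StableTree

/-- The integral group ring `ℤG`. -/
abbrev GroupRing (G : Type u) [Group G] : Type u := MonoidAlgebra ℤ G

/-- The ring homomorphism `ℤG → ℤH` induced by a group homomorphism `G → H`. -/
abbrev ringMap {G H : Type u} [Group G] [Group H] (f : G →* H) : GroupRing G →+* GroupRing H :=
  MonoidAlgebra.mapDomainRingHom ℤ f

/-- The augmentation `ε : ℤG → ℤ`, sending every group element to `1`. -/
def augmentation (G : Type u) [Group G] : GroupRing G →+* ℤ :=
  (MonoidAlgebra.lift ℤ ℤ G (1 : G →* ℤ)).toRingHom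

/-- The ideal `(I, r)` of `ℤG`, where `I` is the augmentation ideal. It is two-sided, since `I` is
two-sided and `r` is central. -/
def swanIdeal (G : Type u) [Group G] (r : ℤ) : Ideal (GroupRing G) :=
  RingHom.ker (augmentation G) ⊔ Ideal.span {(r : GroupRing G)}

/-- The smallest positive integer representing a residue `r` modulo `n` (for `n ≥ 1` and `r` a
unit). The maximum matters only if `n = 1`, where it gives `1` and not `0`. -/
def posRep {n : ℕ} (r : (ZMod n)ˣ) : ℤ := ((max 1 (r : ZMod n).val : ℕ) : ℤ)

/-- `(I, r) ⊗_{ℤG} M` as a left `ℤG`-module: the quotient of `(I, r) ⊗_ℤ M` by the relations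
`x a ⊗ m = x ⊗ a m` for `x ∈ (I, r)`, `a ∈ ℤG`, `m ∈ M`; the ring acts on the left factor. -/
def swanTensor {G : Type u} [Group G] (r : ℤ) (M : ModuleCat.{u} (GroupRing G)) :
    ModuleCat.{u} (GroupRing G) :=
  ModuleCat.of (GroupRing G)
    ((swanIdeal G r ⊗[ℤ] M) ⧸ Submodule.span (GroupRing G)
      {t : swanIdeal G r ⊗[ℤ] M | ∃ (x y : swanIdeal G r) (a : GroupRing G) (m : M),
        (y : GroupRing G) = (x : GroupRing G) * a ∧ t = y ⊗ₜ[ℤ] m - x ⊗ₜ[ℤ] (a • m)})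

/-- Extension of scalars `f_#(M) = ℤH ⊗_{ℤG} M` as a left `ℤH`-module: the quotient of `ℤH ⊗_ℤ M`
by the relations `x f(a) ⊗ m = x ⊗ a m`; the ring `ℤH` acts on the left factor. -/
def extendScalars {G H : Type u} [Group G] [Group H] (f : G →* H)
    (M : ModuleCat.{u} (GroupRing G)) : ModuleCat.{u} (GroupRing H) :=
  ModuleCat.of (GroupRing H)
    ((GroupRing H ⊗[ℤ] M) ⧸ Submodule.span (GroupRing H)
      {t : GroupRing H ⊗[ℤ] M | ∃ (x : GroupRing H) (a : GroupRing G) (m : M),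
        t = (x * ringMap f a) ⊗ₜ[ℤ] m - x ⊗ₜ[ℤ] (a • m)})

/-- `M_θ`: the abelian group `M` on which `g ∈ G` acts as `θ(g)`. -/
def twist {G : Type u} [Group G] (θ : MulAut G) (M : ModuleCat.{u} (GroupRing G)) :
    ModuleCat.{u} (GroupRing G) :=
  (ModuleCat.restrictScalars (ringMap θ.toMonoidHom)).obj M

/-- `M ⊕ R ^ i`. -/
def addFree {R : Type u} [Ring R] (M : ModuleCat.{u} R) (i : ℕ) : ModuleCat.{u} R :=
  ModuleCat.of R (M × (Fin i → R))

/-- `M ⊕ N`. -/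
def sum {R : Type u} [Ring R] (M N : ModuleCat.{u} R) : ModuleCat.{u} R := ModuleCat.of R (M × N)

/-- Isomorphism of modules. -/
def Iso {R : Type u} [Ring R] (M N : ModuleCat.{u} R) : Prop := Nonempty (M ≃ₗ[R] N)

/-- `M ⊕ R ^ i ≅ N ⊕ R ^ j` for some `i, j ≥ 0`, that is, `[M] = [N]` in the class group `C(R)`
when `M` and `N` are finitely generated projective. -/
def StablyEquiv {R : Type u} [Ring R] (M N : ModuleCat.{u} R) : Prop :=
  ∃ i j : ℕ, Iso (addFree M i) (addFree N j)

/-- The rank of a projective `ℤG`-module, for `G` finite. -/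
def rank {G : Type u} [Group G] (M : ModuleCat.{u} (GroupRing G)) : ℕ :=
  Module.finrank ℤ M / Nat.card G

/-- `Q` belongs to the stable class `[P]`: it is a nonzero finitely generated projective module
with `Q ⊕ ℤG ^ i ≅ P ⊕ ℤG ^ j` for some `i, j`. -/
structure InStableClass {G : Type u} [Group G] (P Q : ModuleCat.{u} (GroupRing G)) : Prop where
  finite : Module.Finite (GroupRing G) Q
  projective : Module.Projective (GroupRing G) Q
  nontrivial : Nontrivial Q
  stablyEquiv : StablyEquiv Q P

/-- The modules in the stable class of `P`. -/
def Member {G : Type u} [Group G] (P : ModuleCat.{u} (GroupRing G)) : Type (u + 1) :=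
  {Q : ModuleCat.{u} (GroupRing G) // InStableClass P Q}

/-- Isomorphism of modules, as an equivalence relation on the stable class of `P`. -/
def memberSetoid {G : Type u} [Group G] (P : ModuleCat.{u} (GroupRing G)) : Setoid (Member P) where
  r Q Q' := Iso Q.1 Q'.1
  iseqv := ⟨fun _ => ⟨LinearEquiv.refl _ _⟩, fun ⟨e⟩ => ⟨e.symm⟩, fun ⟨e⟩ ⟨e'⟩ => ⟨e.trans e'⟩⟩

/-- The set `[P]` of isomorphism classes of modules in the stable class of `P`. -/
def StableClass {G : Type u} [Group G] (P : ModuleCat.{u} (GroupRing G)) : Type (u + 1) :=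
  Quotient (memberSetoid P)

/-- The isomorphism class of a module in the stable class. -/
def Member.cls {G : Type u} [Group G] {P : ModuleCat.{u} (GroupRing G)} (Q : Member P) :
    StableClass P := Quotient.mk (memberSetoid P) Q

/-- Adding one free summand preserves the stable class. -/
theorem InStableClass.addFree_one {G : Type u} [Group G] {P Q : ModuleCat.{u} (GroupRing G)}
    (h : InStableClass P Q) : InStableClass P (addFree Q 1) := by
  obtain ⟨h1, h2, h3, i, j, ⟨e⟩⟩ := h
  refine ⟨?_, ?_, ?_, i, j + 1, ⟨?_⟩⟩
  · exact inferInstanceAs (Module.Finite _ (Q × (Fin 1 → GroupRing G)))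
  · exact inferInstanceAs (Module.Projective _ (Q × (Fin 1 → GroupRing G)))
  · exact inferInstanceAs (Nontrivial (Q × (Fin 1 → GroupRing G)))
  · have e' : (Q × (Fin i → GroupRing G)) ≃ₗ[GroupRing G] (P × (Fin j → GroupRing G)) := e
    have a : ((Fin j → GroupRing G) × (Fin 1 → GroupRing G)) ≃ₗ[GroupRing G]
        (Fin (j + 1) → GroupRing G) :=
      (LinearEquiv.sumArrowLequivProdArrow (Fin j) (Fin 1) (GroupRing G) (GroupRing G)).symm.trans
        (LinearEquiv.funCongrLeft (GroupRing G) (GroupRing G) finSumFinEquiv.symm)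
    exact ((LinearEquiv.prodAssoc (GroupRing G) Q (Fin 1 → GroupRing G)
        (Fin i → GroupRing G)).trans
      (((LinearEquiv.refl (GroupRing G) Q).prodCongr (LinearEquiv.prodComm _ _ _)).trans
      ((LinearEquiv.prodAssoc (GroupRing G) Q (Fin i → GroupRing G)
        (Fin 1 → GroupRing G)).symm.trans
      ((e'.prodCongr (LinearEquiv.refl (GroupRing G) (Fin 1 → GroupRing G))).trans
      ((LinearEquiv.prodAssoc _ _ _ _).trans
        ((LinearEquiv.refl (GroupRing G) P).prodCongr a))))))

/-- `Q ⊕ ℤG` as a member of the stable class of `P`. -/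
def Member.up {G : Type u} [Group G] {P : ModuleCat.{u} (GroupRing G)} (Q : Member P) : Member P :=
  ⟨addFree Q.1 1, Q.2.addFree_one⟩

/-- The pair `(θ, r)` of an automorphism and a unit modulo `|G|` sends `Q` to `Q'`. On a module
`Q` of rank one this says `Q' ≅ (I, r) ⊗ Q_θ`. In general one splits `Q ≅ P₁ ⊕ ℤG ^ i` with `P₁`
of rank one, and `Q' ≅ ((I, r) ⊗ (P₁)_θ) ⊕ ℤG ^ i`. -/
def Sends {G : Type u} [Group G] (θ : MulAut G) (r : (ZMod (Nat.card G))ˣ)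
    (Q Q' : ModuleCat.{u} (GroupRing G)) : Prop :=
  ∃ (P₁ : ModuleCat.{u} (GroupRing G)) (i : ℕ),
    Module.Finite (GroupRing G) P₁ ∧ Module.Projective (GroupRing G) P₁ ∧ rank P₁ = 1 ∧
      Iso Q (addFree P₁ i) ∧ Iso Q' (addFree (swanTensor (posRep r) (twist θ P₁)) i)

/-- A group `Γ`, mapped to `Aut(G)` by `ρ` and to `(ℤ/|G|)ˣ` by `χ`, acts on `[P]` if
`[P] - [P_{ρ(γ)}] = [(I, χ(γ))]` in `C(ℤG)` for all `γ`. -/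
def ActsOn {G : Type u} [Group G] {Γ : Type u} [Group Γ] (P : ModuleCat.{u} (GroupRing G))
    (ρ : Γ →* MulAut G) (χ : Γ →* (ZMod (Nat.card G))ˣ) : Prop :=
  ∀ γ : Γ, StablyEquiv P
    (sum (twist (ρ γ) P) (ModuleCat.of (GroupRing G) (swanIdeal G (posRep (χ γ)))))

/-- The relation `y = γ · x` for some `γ ∈ Γ`, on `[P]`. The orbits of `Γ` are the classes of the
equivalence relation that it generates. -/
def orbitRel {G : Type u} [Group G] {Γ : Type u} [Group Γ] (P : ModuleCat.{u} (GroupRing G))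
    (ρ : Γ →* MulAut G) (χ : Γ →* (ZMod (Nat.card G))ˣ) (x y : StableClass P) : Prop :=
  ∃ (γ : Γ) (Q Q' : Member P), x = Q.cls ∧ y = Q'.cls ∧ Sends (ρ γ) (χ γ) Q.1 Q'.1

/-- A graph with a grading of its vertices. -/
structure GradedGraph where
  V : Type (u + 1)
  graph : SimpleGraph V
  grade : V → ℕ

/-- A graded tree: a tree whose edges join vertices of consecutive grades, with exactly one edge
going up from each vertex. -/
structure GradedGraph.IsGradedTree (T : GradedGraph.{u}) : Prop where
  isTree : T.graph.IsTree
  grade_adj : ∀ x y, T.graph.Adj x y → T.grade y = T.grade x + 1 ∨ T.grade x = T.grade y + 1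
  existsUnique_up : ∀ x, ∃! y, T.graph.Adj x y ∧ T.grade y = T.grade x + 1

/-- A map of graded trees: it preserves edges and grades. -/
structure GradedGraph.Hom (S T : GradedGraph.{u}) where
  toFun : S.V → T.V
  map_adj : ∀ x y, S.graph.Adj x y → T.graph.Adj (toFun x) (toFun y)
  map_grade : ∀ x, T.grade (toFun x) = S.grade x

section RankFacts

variable {G : Type u} [Group G]

theorem posRep_ne_zero {n : ℕ} (r : (ZMod n)ˣ) : posRep r ≠ 0 := by
  unfold posRep
  have : 1 ≤ max 1 (r : ZMod n).val := le_max_left _ _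
  omega

/-- If two integral maps compose to multiplication by `r ≠ 0`, ranks compare. -/
theorem rank_le_of_comp {A B : Type u} [AddCommGroup A] [AddCommGroup B] {r : ℤ} (hr : r ≠ 0)
    (a : A →ₗ[ℤ] B) (b : B →ₗ[ℤ] A) (h : ∀ x, b (a x) = r • x) :
    Module.rank ℤ A ≤ Module.rank ℤ B := by
  rw [Module.rank_def]
  refine ciSup_le' fun ⟨s, hs⟩ => ?_
  have hs' : LinearIndependent ℤ (fun x : s => a x.1) := by
    apply LinearIndependent.of_comp b
    replace hs : LinearIndependent ℤ (fun x : s => x.1) := hs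
    rw [linearIndependent_iff'] at hs ⊢
    intro t g hg i hi
    have := hs t (fun j => g j * r) (by simpa [h, mul_smul] using hg) i hi
    exact (mul_eq_zero.mp this).resolve_right hr
  exact hs'.cardinal_le_rank

/-- Multiplication `(I, r) ⊗ M → M` and `m ↦ r ⊗ m` compose to `r` both ways. -/
theorem swanTensor_maps (r : ℤ) (M : ModuleCat.{u} (GroupRing G)) :
    ∃ (a : swanTensor r M →ₗ[ℤ] M) (b : M →ₗ[ℤ] swanTensor r M),
      (∀ t, b (a t) = r • t) ∧ ∀ m, a (b m) = r • m := by
  have hmem : (r : GroupRing G) ∈ swanIdeal G r :=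
    Ideal.mem_sup_right (Ideal.subset_span rfl)
  let N : Submodule (GroupRing G) (swanIdeal G r ⊗[ℤ] M) := Submodule.span (GroupRing G)
      {t | ∃ (x y : swanIdeal G r) (a : GroupRing G) (m : M),
        (y : GroupRing G) = (x : GroupRing G) * a ∧ t = y ⊗ₜ[ℤ] m - x ⊗ₜ[ℤ] (a • m)}
  let a₀ : (swanIdeal G r ⊗[ℤ] M) →ₗ[ℤ] M := TensorProduct.lift
    (LinearMap.mk₂ ℤ (fun (x : swanIdeal G r) (m : M) => (x : GroupRing G) • m)
      (fun x y m => by simp [add_smul]) (fun c x m => by simp [mul_smul, Int.cast_smul_eq_zsmul])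
      (fun x m n => by simp) (fun c x m => by rw [smul_comm]))
  have ha₀ : ∀ (x : swanIdeal G r) (m : M), a₀ (x ⊗ₜ m) = (x : GroupRing G) • m :=
    fun x m => rfl
  have hsm : ∀ (c : GroupRing G) t, a₀ (c • t) = c • a₀ t := by
    intro c t
    induction t with
    | zero => simp
    | tmul x m => rw [TensorProduct.smul_tmul', ha₀, ha₀]; simp [mul_smul]
    | add x y hx hy => rw [smul_add, map_add, hx, hy, map_add, smul_add]
  let a₁ : (swanIdeal G r ⊗[ℤ] M) →ₗ[GroupRing G] M :=
    { toFun := a₀, map_add' := map_add a₀, map_smul' := hsm }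
  have hN : N ≤ LinearMap.ker a₁ := by
    refine Submodule.span_le.mpr ?_
    rintro t ⟨x, y, a, m, hy, rfl⟩
    change a₀ _ = 0
    rw [map_sub, ha₀, ha₀, hy, mul_smul, sub_self]
  let a : ((swanIdeal G r ⊗[ℤ] M) ⧸ N) →ₗ[ℤ] M :=
    (N.liftQ a₁ hN).toAddMonoidHom.toIntLinearMap
  let b : M →ₗ[ℤ] ((swanIdeal G r ⊗[ℤ] M) ⧸ N) :=
    (N.mkQ.toAddMonoidHom.comp
      (TensorProduct.mk ℤ (swanIdeal G r) M ⟨_, hmem⟩).toAddMonoidHom).toIntLinearMap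
  have hab : ∀ m, a (b m) = r • m := by
    intro m
    change (r : GroupRing G) • m = r • m
    exact Int.cast_smul_eq_zsmul _ r m
  have hba : ∀ t, b (a t) = r • t := by
    intro t
    obtain ⟨t, rfl⟩ := N.mkQ_surjective t
    induction t with
    | zero => simp
    | tmul x m =>
      change N.mkQ ((⟨_, hmem⟩ : swanIdeal G r) ⊗ₜ[ℤ] ((x : GroupRing G) • m)) = _
      rw [← map_zsmul, ← sub_eq_zero, ← map_sub, ← neg_eq_zero, ← map_neg, neg_sub]
      refine (Submodule.Quotient.mk_eq_zero N).mpr (Submodule.subset_span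
        ⟨⟨_, hmem⟩, r • x, x, m, ?_, ?_⟩)
      · simp
      · rw [TensorProduct.smul_tmul']
    | add x y hx hy => rw [map_add, map_add, map_add, hx, hy, smul_add]
  exact ⟨a, b, hba, hab⟩

theorem Iso.finrank_eq {R : Type u} [Ring R] {M N : ModuleCat.{u} R} (h : Iso M N) :
    Module.finrank ℤ M = Module.finrank ℤ N := by
  obtain ⟨e⟩ := h
  exact LinearEquiv.finrank_eq (e.toAddEquiv.toIntLinearEquiv)

theorem addFree_swanTensor_finrank {r : ℤ} (hr : r ≠ 0) (M : ModuleCat.{u} (GroupRing G)) (i : ℕ) :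
    Module.finrank ℤ (addFree (swanTensor r M) i) = Module.finrank ℤ (addFree M i) := by
  obtain ⟨a, b, hba, hab⟩ := swanTensor_maps r M
  let A : (swanTensor r M × (Fin i → GroupRing G)) →ₗ[ℤ] (M × (Fin i → GroupRing G)) :=
    a.prodMap LinearMap.id
  let B : (M × (Fin i → GroupRing G)) →ₗ[ℤ] (swanTensor r M × (Fin i → GroupRing G)) :=
    b.prodMap (r • LinearMap.id)
  have hBA : ∀ x, B (A x) = r • x := fun x => Prod.ext (hba x.1) rfl
  have hAB : ∀ x, A (B x) = r • x := fun x => Prod.ext (hab x.1) rfl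
  exact congrArg Cardinal.toNat
    (le_antisymm (rank_le_of_comp hr A B hBA) (rank_le_of_comp hr B A hAB))

theorem Sends.rank_eq {θ : MulAut G} {r : (ZMod (Nat.card G))ˣ}
    {Q Q' : ModuleCat.{u} (GroupRing G)} (h : Sends θ r Q Q') : rank Q = rank Q' := by
  obtain ⟨P₁, i, -, -, -, h, h'⟩ := h
  unfold rank
  rw [h.finrank_eq, h'.finrank_eq, addFree_swanTensor_finrank (posRep_ne_zero r)]
  rfl

end RankFacts

/-- The rank of an isomorphism class. -/
def StableClass.rank {G : Type u} [Group G] {P : ModuleCat.{u} (GroupRing G)}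
    (x : StableClass P) : ℕ :=
  Quotient.lift (fun Q : Member P => StableTree.rank Q.1)
    (fun _ _ h => congrArg (· / Nat.card G) (Iso.finrank_eq h)) x

/-- The graded tree `[P]/Γ`. Its vertices are the orbits of `Γ` on `[P]`, its edges join the orbit
of `Q` to the orbit of `Q ⊕ ℤG`, and its grading is the rank. -/
def orbitTree {G : Type u} [Group G] {Γ : Type u} [Group Γ] (P : ModuleCat.{u} (GroupRing G))
    (ρ : Γ →* MulAut G) (χ : Γ →* (ZMod (Nat.card G))ˣ) : GradedGraph.{u} where
  V := Quot (orbitRel P ρ χ)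
  graph := SimpleGraph.fromRel fun x y => ∃ Q : Member P,
    x = Quot.mk _ Q.cls ∧ y = Quot.mk _ Q.up.cls
  grade := Quot.lift StableClass.rank <| by
    rintro _ _ ⟨γ, Q, Q', rfl, rfl, h⟩
    exact h.rank_eq

/-- The orbit of a module, as a vertex of `[P]/Γ`. -/
def orbit {G : Type u} [Group G] {Γ : Type u} [Group Γ] {P : ModuleCat.{u} (GroupRing G)}
    (ρ : Γ →* MulAut G) (χ : Γ →* (ZMod (Nat.card G))ˣ) (Q : Member P) : (orbitTree P ρ χ).V :=
  Quot.mk _ Q.cls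

/-- `f_#` induces a surjection of graded trees `[P]/Γ ↠ [f_# P]/Δ`: if `Q` belongs to `[P]` then
`f_# Q` belongs to `[f_# P]`, and there is a surjective map of graded trees taking the orbit of `Q`
to the orbit of `f_# Q`. -/
def InducesSurjection {G H : Type u} [Group G] [Group H] {Γ Δ : Type u} [Group Γ] [Group Δ]
    (f : G →* H) (P : ModuleCat.{u} (GroupRing G))
    (ρ : Γ →* MulAut G) (χ : Γ →* (ZMod (Nat.card G))ˣ)
    (ρ' : Δ →* MulAut H) (χ' : Δ →* (ZMod (Nat.card H))ˣ) : Prop :=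
  ∃ (hf : ∀ Q : Member P, InStableClass (extendScalars f P) (extendScalars f Q.1))
    (F : GradedGraph.Hom (orbitTree P ρ χ) (orbitTree (extendScalars f P) ρ' χ')),
    Function.Surjective F.toFun ∧
      ∀ Q : Member P, F.toFun (orbit ρ χ Q) = orbit ρ' χ' ⟨extendScalars f Q.1, hf Q⟩

/-- For a surjection `f : G → H` with characteristic kernel, the homomorphism
`f_* : Aut(G) → Aut(H)` with `f_*(θ) ∘ f = f ∘ θ`. -/
def inducedAut {G H : Type u} [Group G] [Group H] (f : G →* H) (hf : Function.Surjective f)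
    (hchar : f.ker.Characteristic) : MulAut G →* MulAut H where
  toFun θ := (QuotientGroup.quotientKerEquivOfSurjective f hf).symm.trans
    ((QuotientGroup.congr f.ker f.ker θ
      (Subgroup.characteristic_iff_map_eq.mp hchar θ)).trans
      (QuotientGroup.quotientKerEquivOfSurjective f hf))
  map_one' := by
    ext h
    obtain ⟨g, rfl⟩ := hf h
    have e : (QuotientGroup.quotientKerEquivOfSurjective f hf).symm (f g) = (g : G ⧸ f.ker) :=
      (MulEquiv.symm_apply_eq _).mpr rfl
    simp [e]
    rfl
  map_mul' θ φ := by
    ext h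
    obtain ⟨g, rfl⟩ := hf h
    have e (g : G) :
        (QuotientGroup.quotientKerEquivOfSurjective f hf).symm (f g) = (g : G ⧸ f.ker) :=
      (MulEquiv.symm_apply_eq _).mpr rfl
    simp [e]
    rfl

theorem inducedAut_apply {G H : Type u} [Group G] [Group H] (f : G →* H)
    (hf : Function.Surjective f) (hchar : f.ker.Characteristic) (θ : MulAut G) (g : G) :
    inducedAut f hf hchar θ (f g) = f (θ g) := by
  have e : (QuotientGroup.quotientKerEquivOfSurjective f hf).symm (f g) = (g : G ⧸ f.ker) :=
    (MulEquiv.symm_apply_eq _).mpr rfl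
  simp only [inducedAut, MonoidHom.coe_mk, OneHom.coe_mk, MulEquiv.trans_apply, e]
  rfl

/-- Reduction `(ℤ/|G|)ˣ → (ℤ/|H|)ˣ` for a surjection `f : G → H`. -/
def reduceUnits {G H : Type u} [Group G] [Group H] (f : G →* H) (hf : Function.Surjective f) :
    (ZMod (Nat.card G))ˣ →* (ZMod (Nat.card H))ˣ :=
  ZMod.unitsMap (Subgroup.card_dvd_of_surjective f hf)

end StableTree

end

/-! Everything but surjectivity is formal. Along a surjection of rings φ, extension of scalars is M
↦ M / (ker φ) M. It commutes with direct sums, with twisting by compatible automorphisms and, since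
r is a unit modulo |G|, with (I, r) ⊗ -. Hence it carries isomorphisms, stable equivalences and the
relation `Sends` over ℤG to those over ℤH. The orbits form a graded tree because adding ℤG is a
well-defined successor map that raises the grade by one, and any two orbits have a common iterated
successor.

For surjectivity, let N ⊕ ℤH^i ≅ f_#(P ⊕ ℤG^j) with N ≠ 0. The i free summands have to be split off
over ℤG (`exists_lift_of_iso_addFree`). For one summand, let f_#(M) ≅ N ⊕ ℤH. By projectivity the
projection to ℤH lifts to α : M → ℤG, which is onto modulo I = ker(ℤG → ℤH). If α becomes onto after
adding a map into I, then its kernel is the module sought. As N ≠ 0, the rank of M is at least two,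
and then such a correction exists (`exists_surjective_add`). This is a Bass-type argument: stable
range one for ℤG modulo an integer d (`exists_add_span_eq_top`), followed by Nakayama and the
Chinese remainder theorem to treat all primes at once.

That argument needs M to map onto ℤG² modulo each d ≠ 0. This is the part of Swan's local freeness
theorem that is used, and it is obtained from a count: |Hom(P, S)|^|G| = |S|^(rank of P over ℤ) for
finite S over 𝔽_p G (`card_hom_pow`). For abelian groups the count holds because the integral group
ring has no nontrivial idempotents, so that a projective module has constant rank. For general G,
the invariants of the relatively projective representation Hom_ℤ(P, S) are counted by traces of an
idempotent lifted to ℤ/p^a, and a function on G with prescribed sums over cyclic subgroups has a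
determined total sum. With S = 𝔽₂ the same count shows that f_# preserves ranks. -/

noncomputable section

namespace StableTree

/-! ### Traces of idempotent matrices over ℤ/p^a. -/

section IdempotentMatrix

open Matrix

variable {ι : Type*} [Fintype ι] [DecidableEq ι]

/-- The reduction modulo `p` of an integer modulo `p ^ a`. -/
abbrev modRed (p a : ℕ) (ha : a ≠ 0) : ZMod (p ^ a) →+* ZMod p :=
  ZMod.castHom (dvd_pow_self p ha) (ZMod p)

theorem modRed_eq_zero_iff {p a : ℕ} [Fact p.Prime] (ha : a ≠ 0) (x : ZMod (p ^ a)) :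
    modRed p a ha x = 0 ↔ ∃ y, x = p * y := by
  constructor
  · intro h
    have : NeZero (p ^ a) := ⟨pow_ne_zero _ (Fact.out : p.Prime).ne_zero⟩
    obtain ⟨n, rfl⟩ := ZMod.natCast_zmod_surjective x
    rw [map_natCast, ZMod.natCast_eq_zero_iff] at h
    obtain ⟨m, rfl⟩ := h
    exact ⟨m, by push_cast; rfl⟩
  · rintro ⟨y, rfl⟩
    rw [map_mul, map_natCast, CharP.cast_eq_zero, zero_mul]

/-- Reduction modulo `p` has nilpotent kernel, so it reflects units, and locality is inherited from
the field ℤ/p. -/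
theorem isLocalRing_zmod_pow {p a : ℕ} [Fact p.Prime] (ha : a ≠ 0) : IsLocalRing (ZMod (p ^ a)) := by
  have : Nontrivial (ZMod (p ^ a)) := ZMod.nontrivial_iff.mpr
    (Nat.one_lt_pow ha (Fact.out : p.Prime).one_lt).ne'
  have : IsLocalHom (modRed p a ha) := by
    refine ⟨fun x hx => ?_⟩
    obtain ⟨y, hy⟩ := ZMod.ringHom_surjective (modRed p a ha) (↑hx.unit⁻¹ : ZMod p)
    have h1 : modRed p a ha (x * y - 1) = 0 := by
      rw [map_sub, map_mul, hy, map_one, sub_eq_zero]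
      exact hx.mul_val_inv
    obtain ⟨z, hz⟩ := (modRed_eq_zero_iff ha _).mp h1
    have hn : IsNilpotent (x * y - 1) := ⟨a, by
      rw [hz, mul_pow, ← Nat.cast_pow, CharP.cast_eq_zero, zero_mul]⟩
    have := hn.isUnit_add_one
    rw [sub_add_cancel] at this
    exact isUnit_of_mul_isUnit_left this
  exact RingHom.domain_isLocalRing (modRed p a ha)

/-- An idempotent matrix over a local ring factors through a free module. -/
theorem exists_factorization_of_idempotent {B : Type*} [CommRing B] [IsLocalRing B]
    (M : Matrix ι ι B) (hM : M * M = M) :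
    ∃ (f : ℕ) (X : Matrix ι (Fin f) B) (Y : Matrix (Fin f) ι B), X * Y = M ∧ Y * X = 1 := by
  set φ : (ι → B) →ₗ[B] (ι → B) := M.toLin' with hφ
  have hφφ : ∀ x, φ (φ x) = φ x := fun x => by
    rw [hφ, toLin'_apply, toLin'_apply, mulVec_mulVec, hM]
  have : Module.Projective B φ.range :=
    Module.Projective.of_split φ.range.subtype φ.rangeRestrict (by
      ext ⟨_, y, rfl⟩ : 1
      exact Subtype.ext (hφφ y))
  have : Module.Free B φ.range := Module.free_of_flat_of_isLocalRing
  let b := (Module.finBasis B φ.range).equivFun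
  refine ⟨_, LinearMap.toMatrix' (φ.range.subtype ∘ₗ b.symm.toLinearMap),
    LinearMap.toMatrix' (b.toLinearMap ∘ₗ φ.rangeRestrict), ?_, ?_⟩
  · rw [← LinearMap.toMatrix'_comp, ← LinearMap.toMatrix'_toLin' M]
    refine congrArg _ (LinearMap.ext fun x => ?_)
    change (b.symm (b (φ.rangeRestrict x)) : ι → B) = φ x
    rw [b.symm_apply_apply]
    rfl
  · rw [← LinearMap.toMatrix'_comp, ← LinearMap.toMatrix'_id]
    refine congrArg _ (LinearMap.ext fun x => ?_)
    change b (φ.rangeRestrict (b.symm x : ι → B)) = x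
    have : φ.rangeRestrict (b.symm x : ι → B) = b.symm x := by
      obtain ⟨y, hy⟩ := (b.symm x).2
      refine Subtype.ext ?_
      change φ (b.symm x : ι → B) = _
      rw [← hy, hφφ]
    rw [this, b.apply_symm_apply]

/-- The trace of an idempotent matrix over `ℤ/p^a` is the rank of its reduction modulo `p`. -/
theorem trace_eq_rank_of_idempotent {p a : ℕ} [Fact p.Prime] (ha : a ≠ 0)
    (M : Matrix ι ι (ZMod (p ^ a))) (hM : M * M = M) :
    M.trace = ((M.map (modRed p a ha)).rank : ZMod (p ^ a)) := by
  have := isLocalRing_zmod_pow (p := p) ha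
  -- Both sides equal the inner size `f`: the trace because tr(XY) = tr(YX), the rank because the
  -- factorization survives reduction.
  obtain ⟨f, X, Y, hXY, hYX⟩ := exists_factorization_of_idempotent M hM
  set r := modRed p a ha
  have hXY' : X.map r * Y.map r = M.map r := by rw [← Matrix.map_mul, hXY]
  have hYX' : Y.map r * X.map r = 1 := by
    rw [← Matrix.map_mul, hYX, Matrix.map_one _ (map_zero r) (map_one r)]
  have hrank : (M.map r).rank = f := by
    apply le_antisymm
    · rw [← hXY']
      exact (rank_mul_le_right _ _).trans ((rank_le_card_height _).trans (Fintype.card_fin f).le)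
    · have h1 : Y.map r * (M.map r) * X.map r = 1 := by
        rw [← hXY', ← Matrix.mul_assoc, hYX', Matrix.one_mul, hYX']
      have h2 := (rank_mul_le_left (Y.map r * (M.map r)) (X.map r)).trans
        (rank_mul_le_right (Y.map r) (M.map r))
      rwa [h1, rank_one, Fintype.card_fin] at h2
  rw [hrank, ← hXY, trace_mul_comm, hYX, trace_one, Fintype.card_fin]

end IdempotentMatrix

/-! ### Projection to invariants without dividing by the group order. -/

section Averaging

open Matrix

variable {G : Type*} [Group G] {B : Type*} [CommRing B] {ι : Type*} [Fintype ι] [DecidableEq ι]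

/-- If `ε` is an idempotent commuting with the action `L` of a finite group `C` and `D` is a matrix
whose `C`-conjugates sum to `1`, then `ε N D ε` is an idempotent with image the `C`-invariants of the image of `ε`;
here `N` is the norm of `C`. -/
theorem averaged_idempotent (C : Subgroup G) [Fintype C] (L : G →* Matrix ι ι B)
    (ε D N : Matrix ι ι B)
    (hε : ε * ε = ε) (hL : ∀ g, L g * ε = ε * L g) (hD : ∑ c : C, L c * D * L (c : G)⁻¹ = 1)
    (hN : N = ∑ c : C, L c) :
    (ε * N * D * ε) * (ε * N * D * ε) = ε * N * D * ε ∧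
    (∀ c ∈ C, L c * (ε * N * D * ε) = ε * N * D * ε) ∧
    ∑ c : C, (L c * ε).trace = Fintype.card C * (ε * N * D * ε).trace ∧
    ∀ v : ι → B, (∀ c ∈ C, L c *ᵥ v = v) → ε *ᵥ v = v → (ε * N * D * ε) *ᵥ v = v := by
  have hLN : ∀ c ∈ C, L c * N = N := by
    intro c hc
    rw [hN, Finset.mul_sum]
    refine Fintype.sum_equiv (Equiv.mulLeft (⟨c, hc⟩ : C)) _ _ fun x => ?_
    simp
  -- In front of an invariant, `c⁻¹` can be inserted freely, which turns `N * D` into the sum of the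
  -- conjugates of `D`. Nothing is divided by |C|, which may be a multiple of p.
  have hfix : ∀ x : Matrix ι ι B, (∀ c ∈ C, L c * x = x) → N * D * x = x := by
    intro x hx
    calc N * D * x = ∑ c : C, L c * D * (L (c : G)⁻¹ * x) := by
          rw [hN, Finset.sum_mul, Finset.sum_mul]
          refine Finset.sum_congr rfl fun c _ => ?_
          rw [hx _ (C.inv_mem c.2)]
      _ = x := by
          simp_rw [← mul_assoc]
          rw [← Finset.sum_mul, hD, one_mul]
  have hεN : N * ε = ε * N := by
    rw [hN, Finset.sum_mul, Finset.mul_sum]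
    exact Finset.sum_congr rfl fun c _ => hL c
  have hLπ : ∀ c ∈ C, L c * (ε * N * D * ε) = ε * N * D * ε := by
    intro c hc
    rw [← hεN]
    simp only [← mul_assoc]
    rw [hLN c hc]
  set π := ε * N * D * ε with hπ
  have hεπ : ε * π = π := by rw [hπ]; simp only [← mul_assoc, hε]
  have hπ' : ∀ x, (∀ c ∈ C, L c * x = x) → ε * x = x → π * x = x := by
    intro x hx hx'
    rw [hπ, mul_assoc, hx', mul_assoc ε N D, mul_assoc, hfix x hx, hx']
  have hvec : ∀ v : ι → B, (∀ c ∈ C, L c *ᵥ v = v) → ε *ᵥ v = v → π *ᵥ v = v := by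
    intro v hv hv'
    have : (N * D) *ᵥ v = v := by
      calc (N * D) *ᵥ v = ∑ c : C, (L c * D) *ᵥ (L (c : G)⁻¹ *ᵥ v) := by
            rw [hN, Finset.sum_mul, Matrix.sum_mulVec]
            refine Finset.sum_congr rfl fun c _ => ?_
            rw [hv _ (C.inv_mem c.2)]
        _ = v := by
            simp_rw [Matrix.mulVec_mulVec]
            rw [← Matrix.sum_mulVec, hD, Matrix.one_mulVec]
    rw [hπ, ← Matrix.mulVec_mulVec, hv', mul_assoc, ← Matrix.mulVec_mulVec, this, hv']
  have hεNε : ε * (N * ε) = N * ε := by rw [← mul_assoc, ← hεN, mul_assoc, hε]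
  refine ⟨hπ' π hLπ hεπ, hLπ, ?_, ?_⟩; swap
  · exact hvec
  -- `N * ε` has invariant image, so `π` fixes it; conversely `N` acts on the image of `π` as |C|.
  -- Commuting the factors under the trace compares the two.
  have h2 : π * (N * ε) = N * ε :=
    hπ' _ (fun c hc => by rw [← mul_assoc, hLN c hc]) hεNε
  have h3 : (N * ε) * π = Fintype.card C • π := by
    rw [mul_assoc, hεπ, hN, Finset.sum_mul, Finset.sum_congr rfl fun c _ => hLπ c.1 c.2]
    simp
  rw [← Matrix.trace_sum, ← Finset.sum_mul, ← hN, ← h2, Matrix.trace_mul_comm, h3, Matrix.trace_smul,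
    nsmul_eq_mul]

end Averaging

/-- A function on a finite group whose sum over each cyclic subgroup is its value at `1` has total sum
its value at `1`. -/
theorem sum_eq_of_sum_zpowers {G B : Type*} [Group G] [Fintype G] [AddCommGroup B] (χ : G → B)
    (h : ∀ g : G, ∑ c : Subgroup.zpowers g, χ (c : G) = χ 1) : ∑ g, χ g = χ 1 := by
  classical
  have : Fintype (Subgroup G) := Fintype.ofFinite _
  -- `ψ C` collects the generators of `C`. A cyclic group is partitioned by the subgroups that its
  -- elements generate, so induction on the order kills every `ψ C` with `C ≠ ⊥`.
  let ψ : Subgroup G → B := fun C => ∑ g with Subgroup.zpowers g = C, χ g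
  have hbot : ψ ⊥ = χ 1 := by
    simp [ψ, Subgroup.zpowers_eq_bot, Finset.sum_filter]
  have key : ∀ C : Subgroup G, C ≠ ⊥ → ψ C = 0 := by
    intro C
    induction hn : Nat.card C using Nat.strong_induction_on generalizing C with
    | _ n ih =>
    intro hC
    by_cases hcyc : ∃ g, Subgroup.zpowers g = C
    swap
    · exact Finset.sum_eq_zero fun g hg => (hcyc ⟨g, (Finset.mem_filter.mp hg).2⟩).elim
    obtain ⟨g, rfl⟩ := hcyc
    have h1 := h g
    have h2 : ∑ c : Subgroup.zpowers g, χ (c : G) = ∑ c with c ∈ Subgroup.zpowers g, χ c :=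
      (Finset.sum_subtype _ (by simp) χ).symm
    rw [h2, ← Finset.sum_fiberwise_of_maps_to (s := {c | c ∈ Subgroup.zpowers g})
      (t := {D : Subgroup G | D ≤ Subgroup.zpowers g}) (g := Subgroup.zpowers)
      (by simp [Subgroup.zpowers_le])] at h1
    have h3 : ∀ D ∈ ({D : Subgroup G | D ≤ Subgroup.zpowers g} : Finset (Subgroup G)),
        (∑ c ∈ ({c | c ∈ Subgroup.zpowers g} : Finset G) with Subgroup.zpowers c = D, χ c) =
          ψ D := by
      intro D hD
      refine Finset.sum_congr ?_ fun _ _ => rfl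
      ext c
      simp only [Finset.mem_filter, Finset.mem_univ, true_and, and_iff_right_iff_imp] at hD ⊢
      rintro rfl
      exact Subgroup.zpowers_le.mp hD
    rw [Finset.sum_congr rfl h3, Finset.sum_eq_add_of_mem ⊥ (Subgroup.zpowers g) (by simp)
      (by simp) (Ne.symm hC)] at h1
    · have h4 : ψ ⊥ + ψ (Subgroup.zpowers g) = χ 1 := h1
      rw [hbot] at h4
      simpa using h4
    · rintro D hD ⟨hD1, hD2⟩
      refine ih _ ?_ D rfl hD1
      rw [← hn]
      have hD' : D ≤ Subgroup.zpowers g := by simpa using hD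
      exact lt_of_le_of_ne (Nat.card_le_card_of_injective _ (Subgroup.inclusion_injective hD'))
        fun he => hD2 (Subgroup.eq_of_le_of_card_ge hD' he.ge)
  rw [← Finset.sum_fiberwise (s := Finset.univ) (g := fun g : G => Subgroup.zpowers g),
    Finset.sum_eq_single_of_mem ⊥ (Finset.mem_univ _) fun C _ hC => key C hC]
  exact hbot

/-! ### Translation-invariant matrices on G × m and lifting of idempotents. -/

section Translation

open Matrix

variable {G : Type*} [Group G] {m : Type*}

/-- Left translation on `G × m`. -/
def translate (h : G) : Equiv.Perm (G × m) := (Equiv.mulLeft h).prodCongr (Equiv.refl m)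

theorem translate_apply (h : G) (x : G × m) : translate h x = (h * x.1, x.2) := rfl

theorem translate_one (x : G × m) : translate 1 x = x := Prod.ext (one_mul _) rfl

theorem translate_mul (g h : G) (x : G × m) : translate (g * h) x = translate g (translate h x) :=
  Prod.ext (mul_assoc _ _ _) rfl

theorem translate_inv_symm (g : G) (x : G × m) : (translate g⁻¹).symm x = translate g x := by
  rw [Equiv.symm_apply_eq, ← translate_mul, inv_mul_cancel, translate_one]

variable [Fintype G] [DecidableEq G] [Fintype m] [DecidableEq m]

variable (G m) in
/-- The ring of matrices invariant under translation. -/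
def invariantMatrices (B : Type*) [CommRing B] : Subring (Matrix (G × m) (G × m) B) where
  carrier := {M | ∀ h : G, M.submatrix (translate h) (translate h) = M}
  mul_mem' {M N} hM hN h := by rw [← Matrix.submatrix_mul_equiv (e₂ := translate h), hM, hN]
  one_mem' h := Matrix.submatrix_one_equiv _
  add_mem' {M N} hM hN h := by exact congrArg₂ (· + ·) (hM h) (hN h)
  zero_mem' h := rfl
  neg_mem' {M} hM h := by exact congrArg (- ·) (hM h)

variable (G m) in
/-- The permutation matrices of translations. -/
def translationMatrix (B : Type*) [CommRing B] : G →* Matrix (G × m) (G × m) B where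
  toFun h := (1 : Matrix (G × m) (G × m) B).submatrix (translate h⁻¹) id
  map_one' := by
    ext x y
    rw [Matrix.submatrix_apply, inv_one, translate_one, id]
  map_mul' g h := by
    have := Matrix.one_submatrix_mul (translate g⁻¹ : G × m → G × m) (Equiv.refl (G × m))
      ((1 : Matrix (G × m) (G × m) B).submatrix (translate h⁻¹) id)
    rw [Equiv.coe_refl] at this
    rw [this]
    ext x y
    rw [Matrix.submatrix_apply, _root_.mul_inv_rev, translate_mul]
    rfl

theorem translationMatrix_mul {B : Type*} [CommRing B] (g : G) (M : Matrix (G × m) (G × m) B) :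
    translationMatrix G m B g * M = M.submatrix (translate g⁻¹) id :=
  Matrix.one_submatrix_mul (translate g⁻¹ : G × m → G × m) (Equiv.refl (G × m)) M

theorem translationMatrix_mulVec {B : Type*} [CommRing B] (g : G) (v : G × m → B) :
    translationMatrix G m B g *ᵥ v = v ∘ translate g⁻¹ := by
  ext x
  exact congrFun (Matrix.one_mulVec v) (translate g⁻¹ x)

theorem mul_translationMatrix {B : Type*} [CommRing B] (g : G) (M : Matrix (G × m) (G × m) B) :
    M * translationMatrix G m B g = M.submatrix id (translate g) := by
  have := Matrix.mul_submatrix_one (translate g⁻¹ : (G × m) ≃ G × m) (id : G × m → G × m) M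
  refine this.trans ?_
  ext x y
  exact congrArg (M x) (translate_inv_symm g y)

theorem translationMatrix_comm {B : Type*} [CommRing B] {M : Matrix (G × m) (G × m) B}
    (hM : M ∈ invariantMatrices G m B) (g : G) :
    translationMatrix G m B g * M = M * translationMatrix G m B g := by
  rw [translationMatrix_mul, mul_translationMatrix]
  ext ⟨x, i⟩ y
  have := congrFun (congrFun (hM g) (translate g⁻¹ (x, i))) y
  simpa [translate_apply, Matrix.submatrix] using this.symm

theorem translationMatrix_map {B B' : Type*} [CommRing B] [CommRing B'] (r : B →+* B') (g : G) :
    (translationMatrix G m B g).map r = translationMatrix G m B' g := by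
  exact congrArg (fun N : Matrix (G × m) (G × m) B' => N.submatrix (translate g⁻¹) id)
    (Matrix.map_one r (map_zero r) (map_one r))

/-- The conjugates of the projection to a right transversal sum to `1`. -/
theorem exists_diagonal_sum_eq_one (C : Subgroup G) [Fintype C] :
    ∃ R : Set G, ∀ (B : Type) [CommRing B], ∑ c : C, translationMatrix G m B c *
      diagonal (fun x : G × m => R.indicator (fun _ => (1 : B)) x.1) *
        translationMatrix G m B (c : G)⁻¹ = 1 := by
  classical
  obtain ⟨R, hR, -⟩ := C.exists_isComplement_right 1
  refine ⟨R, fun B _ => ?_⟩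
  replace hR : ∀ g, ∃! s : C, (s : G)⁻¹ * g ∈ R :=
    Subgroup.isComplement_iff_existsUnique_inv_mul_mem.mp hR
  simp only [translationMatrix_mul, mul_translationMatrix]
  ext x y
  rw [Matrix.sum_apply]
  -- Each group element is moved into `R` by exactly one `c⁻¹`, so exactly one conjugate contributes
  -- to a diagonal entry.
  by_cases hxy : x = y
  · subst hxy
    obtain ⟨c, hc, hc'⟩ := hR x.1
    rw [Finset.sum_eq_single c]
    · simp [translate_apply, Matrix.submatrix, hc]
    · intro b _ hb
      have : (b : G)⁻¹ * x.1 ∉ R := fun h => hb (hc' b h)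
      simp [translate_apply, Matrix.submatrix, this]
    · simp
  · rw [Matrix.one_apply_ne hxy]
    refine Finset.sum_eq_zero fun c _ => ?_
    simp [translate_apply, Matrix.submatrix, Matrix.diagonal_apply, Prod.ext_iff] at hxy ⊢
    tauto

/-- Idempotent translation invariant matrices lift from `ℤ/p` to `ℤ/p^a`. -/
theorem exists_lift_idempotent {p a : ℕ} [Fact p.Prime] (ha : a ≠ 0)
    (e : Matrix (G × m) (G × m) (ZMod p)) (he : e * e = e) (hinv : e ∈ invariantMatrices G m _) :
    ∃ E ∈ invariantMatrices G m (ZMod (p ^ a)), E * E = E ∧ E.map (modRed p a ha) = e := by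
  set r := modRed p a ha
  -- The lifting takes place inside the ring of invariant matrices, so the lift is again invariant.
  -- The kernel is nilpotent since its matrices are multiples of `p`.
  let φ : invariantMatrices G m (ZMod (p ^ a)) →+* invariantMatrices G m (ZMod p) :=
    (RingHom.mapMatrix r).restrict _ _ fun M hM h => by
      have := congrArg (fun N => N.map r) (hM h)
      exact this
  have hnil : ∀ x ∈ RingHom.ker φ, IsNilpotent x := by
    rintro ⟨M, hM⟩ hx
    have hx' : M.map r = 0 := congrArg Subtype.val hx
    have : ∀ i j, ∃ y, M i j = p * y := fun i j =>
      (modRed_eq_zero_iff ha _).mp (congrFun (congrFun hx' i) j)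
    choose N hN using this
    refine ⟨a, Subtype.ext ?_⟩
    have : M = (p : ZMod (p ^ a)) • Matrix.of N := by
      ext i j
      simp [hN]
    change M ^ a = 0
    rw [this, smul_pow, ← Nat.cast_pow, CharP.cast_eq_zero, zero_smul]
  have hsurj : (⟨e, hinv⟩ : invariantMatrices G m (ZMod p)) ∈ φ.range := by
    let σ := Function.surjInv (ZMod.ringHom_surjective r)
    refine ⟨⟨e.map σ, fun h => ?_⟩, Subtype.ext ?_⟩
    · exact congrArg (fun N => N.map σ) (hinv h)
    · ext i j
      exact Function.surjInv_eq (ZMod.ringHom_surjective r) _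
  obtain ⟨⟨E, hE⟩, hEE, hEe⟩ := exists_isIdempotentElem_eq_of_ker_isNilpotent φ hnil _ hsurj
    (Subtype.ext he)
  exact ⟨E, hE, congrArg Subtype.val hEE, congrArg Subtype.val hEe⟩

end Translation

/-! ### Invariants of relatively projective representations over 𝔽_p. -/

section Representation

open Matrix

variable {k G W : Type*} [CommRing k] [Group G] [AddCommGroup W] [Module k W]

/-- The vectors fixed by a subgroup. -/
def fixedBy (ρ : Representation k G W) (C : Subgroup G) : Submodule k W where
  carrier := {w | ∀ c ∈ C, ρ c w = w}
  add_mem' hv hw c hc := by rw [map_add, hv c hc, hw c hc]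
  zero_mem' c _ := map_zero _
  smul_mem' a w hw c hc := by rw [map_smul, hw c hc]

/-- The embedding `w ↦ (g ↦ t (g⁻¹ w))` into the coinduced module. -/
def toCoinduced {m : Type*} (ρ : Representation k G W) (t : W →ₗ[k] W) (e : W ≃ₗ[k] (m → k)) :
    W →ₗ[k] (G × m → k) :=
  LinearMap.pi fun x => LinearMap.proj x.2 ∘ₗ e.toLinearMap ∘ₗ t ∘ₗ ρ x.1⁻¹

theorem toCoinduced_smul {m : Type*} (ρ : Representation k G W) (t : W →ₗ[k] W)
    (e : W ≃ₗ[k] (m → k)) (h : G) (w : W) :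
    toCoinduced ρ t e (ρ h w) = toCoinduced ρ t e w ∘ translate h⁻¹ := by
  ext ⟨g, i⟩
  change e (t (ρ g⁻¹ (ρ h w))) i = e (t (ρ (h⁻¹ * g)⁻¹ w)) i
  rw [← Module.End.mul_apply (ρ g⁻¹), ← map_mul, _root_.mul_inv_rev, inv_inv]

variable [Fintype G]

/-- The map `v ↦ ∑ g v(g)` from the coinduced module. -/
def ofCoinduced {m : Type*} (ρ : Representation k G W) (e : W ≃ₗ[k] (m → k)) :
    (G × m → k) →ₗ[k] W :=
  ∑ g : G, ρ g ∘ₗ e.symm.toLinearMap ∘ₗ LinearMap.funLeft k k (fun i => (g, i))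

theorem ofCoinduced_apply {m : Type*} (ρ : Representation k G W) (e : W ≃ₗ[k] (m → k))
    (v : G × m → k) : ofCoinduced ρ e v = ∑ g, ρ g (e.symm fun i => v (g, i)) := by
  simp only [ofCoinduced, LinearMap.sum_apply]
  rfl

/-- With the equivariance of both maps, this makes `W` a direct summand of a coinduced module. -/
theorem ofCoinduced_toCoinduced {m : Type*} (ρ : Representation k G W) (t : W →ₗ[k] W)
    (e : W ≃ₗ[k] (m → k)) (ht : ∀ w, ∑ g, ρ g (t (ρ g⁻¹ w)) = w) (w : W) :
    ofCoinduced ρ e (toCoinduced ρ t e w) = w := by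
  rw [ofCoinduced_apply]
  conv_rhs => rw [← ht w]
  refine Finset.sum_congr rfl fun g _ => congrArg _ ?_
  exact e.symm_apply_apply (t (ρ g⁻¹ w))

theorem ofCoinduced_translate {m : Type*} (ρ : Representation k G W)
    (e : W ≃ₗ[k] (m → k)) (h : G) (v : G × m → k) :
    ofCoinduced ρ e (v ∘ translate h⁻¹) = ρ h (ofCoinduced ρ e v) := by
  rw [ofCoinduced_apply, ofCoinduced_apply, map_sum]
  refine Fintype.sum_equiv (Equiv.mulLeft h⁻¹) _ _ fun g => ?_
  rw [← Module.End.mul_apply, ← map_mul, Equiv.coe_mulLeft, mul_inv_cancel_left]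
  rfl

variable {p : ℕ} [Fact p.Prime] [Module (ZMod p) W] [FiniteDimensional (ZMod p) W]

/-- For a relatively projective representation `W` over `𝔽_p`, there is a function `χ` on `G` such
that `|C|` times the dimension of the invariants of a subgroup `C` is the sum of `χ` over `C`,
modulo a given power of `p`. -/
theorem exists_character (ρ : Representation (ZMod p) G W) (t : W →ₗ[ZMod p] W)
    (ht : ∀ w, ∑ g, ρ g (t (ρ g⁻¹ w)) = w) {a : ℕ} (ha : a ≠ 0) :
    ∃ χ : G → ZMod (p ^ a), ∀ (C : Subgroup G) [Fintype C],
      ∑ c : C, χ c = Fintype.card C * (Module.finrank (ZMod p) (fixedBy ρ C) : ℕ) := by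
  classical
  let e := (Module.finBasis (ZMod p) W).equivFun
  let m := Fin (Module.finrank (ZMod p) W)
  let s := toCoinduced ρ t e
  let r := ofCoinduced ρ e
  have hrs : ∀ w, r (s w) = w := ofCoinduced_toCoinduced ρ t e ht
  -- The idempotent that cuts out `W`, in matrix form so that it can be lifted to ℤ/p^a.
  let ε₀ : Matrix (G × m) (G × m) (ZMod p) := LinearMap.toMatrix' (s ∘ₗ r)
  have hε₀v : ∀ v, ε₀ *ᵥ v = s (r v) := fun v => by
    rw [← Matrix.toLin'_apply, Matrix.toLin'_toMatrix']
    rfl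
  have hε₀ : ε₀ * ε₀ = ε₀ := by
    rw [← LinearMap.toMatrix'_comp]
    exact congrArg _ (LinearMap.ext fun v => congrArg s (hrs (r v)))
  have hent : ∀ x y, ε₀ x y = s (r (Pi.single y 1)) x := fun x y => by
    rw [← hε₀v, Matrix.mulVec_single_one]
    rfl
  have hinv : ε₀ ∈ invariantMatrices G m (ZMod p) := by
    intro h
    ext x y
    have h1 : (Pi.single (translate h y) 1 : G × m → ZMod p) = Pi.single y 1 ∘ translate h⁻¹ := by
      ext z
      simp only [Pi.single_apply, Function.comp]
      refine if_congr ?_ rfl rfl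
      rw [← translate_inv_symm, Equiv.eq_symm_apply]
    rw [Matrix.submatrix_apply, hent, hent, h1, ofCoinduced_translate, toCoinduced_smul,
      Function.comp, ← translate_mul, inv_mul_cancel, translate_one]
  obtain ⟨ε, hεinv, hε, hεε₀⟩ := exists_lift_idempotent ha ε₀ hε₀ hinv
  let L := translationMatrix G m (ZMod (p ^ a))
  let L₀ := translationMatrix G m (ZMod p)
  -- The character of the lifted summand. Traces over ℤ/p would see dimensions only modulo `p`.
  refine ⟨fun g => (L g * ε).trace, fun C _ => ?_⟩
  obtain ⟨R, hR⟩ := exists_diagonal_sum_eq_one (m := m) C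
  have h1 := averaged_idempotent C L ε _ _ hε (translationMatrix_comm hεinv) (hR _) rfl
  have h2 := averaged_idempotent C L₀ ε₀ _ _ hε₀ (translationMatrix_comm hinv) (hR _) rfl
  rw [h1.2.2.1, trace_eq_rank_of_idempotent ha _ h1.1]
  congr 2
  set π₀ := ε₀ * (∑ c : C, L₀ c) *
    diagonal (fun x : G × m => R.indicator (fun _ => (1 : ZMod p)) x.1) * ε₀ with hπ₀
  have hmap : (ε * (∑ c : C, L c) *
      diagonal (fun x : G × m => R.indicator (fun _ => (1 : ZMod (p ^ a))) x.1) * ε).map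
        (modRed p a ha) = π₀ := by
    have hsum : (∑ c : C, L c).map (modRed p a ha) = ∑ c : C, L₀ c := by
      have := map_sum (RingHom.mapMatrix (m := G × m) (modRed p a ha)) (fun c : C => L c) Finset.univ
      refine this.trans (Finset.sum_congr rfl fun c _ => translationMatrix_map _ _)
    rw [Matrix.map_mul, Matrix.map_mul, Matrix.map_mul, hεε₀, hsum,
      Matrix.diagonal_map (map_zero _), hπ₀]
    congr 4
    ext x
    rw [Set.indicator_apply, Set.indicator_apply, apply_ite (modRed p a ha), map_one, map_zero]
  rw [hmap]
  -- Modulo `p` the averaged idempotent projects onto the copy of the `C`-invariants of `W`, so its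
  -- rank is their dimension.
  have hrange : LinearMap.range π₀.mulVecLin = (fixedBy ρ C).map s := by
    apply le_antisymm
    · rintro _ ⟨v, rfl⟩
      refine ⟨r (π₀ *ᵥ v), fun c hc => ?_, ?_⟩
      · rw [← ofCoinduced_translate, ← translationMatrix_mulVec, Matrix.mulVec_mulVec,
          h2.2.1 c hc]
      · rw [← hε₀v, Matrix.mulVecLin_apply, Matrix.mulVec_mulVec, hπ₀]
        simp only [← mul_assoc, hε₀]
    · rintro _ ⟨w, hw, rfl⟩
      refine ⟨s w, h2.2.2.2 (s w) (fun c hc => ?_) ?_⟩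
      · rw [translationMatrix_mulVec, ← toCoinduced_smul, hw c hc]
      · rw [hε₀v, hrs]
  rw [Matrix.rank, hrange]
  exact (Submodule.equivMapOfInjective s (Function.LeftInverse.injective hrs) _).finrank_eq.symm

/-- The dimension of the invariants of a relatively projective representation over `𝔽_p` is
determined by the cyclic subgroups. -/
theorem card_mul_finrank_fixedBy (ρ : Representation (ZMod p) G W) (t : W →ₗ[ZMod p] W)
    (ht : ∀ w, ∑ g, ρ g (t (ρ g⁻¹ w)) = w)
    (hcyc : ∀ g : G, Nat.card (Subgroup.zpowers g) *
      Module.finrank (ZMod p) (fixedBy ρ (Subgroup.zpowers g)) = Module.finrank (ZMod p) W) :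
    Nat.card G * Module.finrank (ZMod p) (fixedBy ρ ⊤) = Module.finrank (ZMod p) W := by
  classical
  set x := Nat.card G * Module.finrank (ZMod p) (fixedBy ρ ⊤)
  set w := Module.finrank (ZMod p) W
  -- With this exponent `p ^ a` exceeds both numbers to be compared, so their congruence is an
  -- equality.
  set a := x + w + 1
  have hlt : ∀ n ≤ x + w, n < p ^ a := fun n hn =>
    (Nat.lt_pow_self (Fact.out : p.Prime).one_lt).trans
      (Nat.pow_lt_pow_right (Fact.out : p.Prime).one_lt (by omega))
  obtain ⟨χ, hχ⟩ := exists_character ρ t ht (a := a) (by omega)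
  have hz : ∀ g : G, ∑ c : Subgroup.zpowers g, χ (c : G) = w := fun g => by
    rw [hχ, ← hcyc g, Nat.cast_mul, Nat.card_eq_fintype_card]
  have h1 : χ 1 = w := by
    rw [← hz 1, Finset.sum_eq_single (⟨1, one_mem _⟩ : Subgroup.zpowers (1 : G))]
    · rintro ⟨b, hb⟩ - hb'
      rw [Subgroup.zpowers_one_eq_bot, Subgroup.mem_bot] at hb
      exact (hb' (Subtype.ext hb)).elim
    · simp
  have h2 := sum_eq_of_sum_zpowers χ fun g => (hz g).trans h1.symm
  have h3 : ∑ c : (⊤ : Subgroup G), χ c = ∑ g, χ g :=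
    Fintype.sum_equiv Subgroup.topEquiv.toEquiv _ _ fun _ => rfl
  rw [hχ, h2, h1, ← Nat.card_eq_fintype_card, Nat.card_congr Subgroup.topEquiv.toEquiv,
    ← Nat.cast_mul, ZMod.natCast_eq_natCast_iff'] at h3
  rwa [Nat.mod_eq_of_lt (hlt _ (by omega)), Nat.mod_eq_of_lt (hlt _ (by omega))] at h3

end Representation

/-! ### Modules over ℤG and the averaging criterion for projectivity. -/

section GroupRingModules

variable {G : Type*} [Group G] {M N : Type*} [AddCommGroup M] [Module (MonoidAlgebra ℤ G) M]
  [AddCommGroup N] [Module (MonoidAlgebra ℤ G) N]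

/-- The group element `g` in the integral group ring. -/
abbrev gp (g : G) : MonoidAlgebra ℤ G := MonoidAlgebra.of ℤ G g

theorem gp_mul (g h : G) : gp (g * h) = gp g * gp h := map_mul _ _ _

theorem gp_one : gp (1 : G) = 1 := map_one _

theorem gp_smul_gp_inv_smul (g : G) (x : M) : gp g • gp g⁻¹ • x = x := by
  rw [← mul_smul, ← gp_mul, mul_inv_cancel, gp_one, one_smul]

theorem gp_inv_smul_gp_smul (g : G) (x : M) : gp g⁻¹ • gp g • x = x := by
  rw [← mul_smul, ← gp_mul, inv_mul_cancel, gp_one, one_smul]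

/-- An additive map commuting with group elements is linear over the group ring. -/
def linearOfGroup (φ : M →+ N) (h : ∀ (g : G) (x : M), φ (gp g • x) = gp g • φ x) :
    M →ₗ[MonoidAlgebra ℤ G] N where
  toFun := φ
  map_add' := map_add φ
  map_smul' a x := by
    change φ (a • x) = a • φ x
    induction a using MonoidAlgebra.induction_on with
    | of g => exact h g x
    | add a b ha hb => rw [add_smul, add_smul, map_add, ha, hb]
    | smul r a ha => rw [smul_assoc, smul_assoc, map_zsmul, ha]

variable (G M) in
/-- A module over the group ring, as a representation. -/
def toRepresentation : Representation ℤ G M where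
  toFun g :=
    { toFun := fun x => gp g • x
      map_add' := fun x y => smul_add _ x y
      map_smul' := fun c x => smul_comm _ c x }
  map_one' := by
    ext x
    change gp (1 : G) • x = x
    rw [gp_one, one_smul]
  map_mul' g h := by
    ext x
    change gp (g * h) • x = gp g • gp h • x
    rw [gp_mul, mul_smul]

/-- A projective module over the group ring of a finite group is relatively projective. -/
theorem exists_relative_section [Fintype G] [Module.Projective (MonoidAlgebra ℤ G) M] :
    ∃ t : M →ₗ[ℤ] M, ∀ x, ∑ g : G, gp g • t (gp g⁻¹ • x) = x := by
  obtain ⟨s, hs⟩ := Module.projective_def'.mp ‹Module.Projective (MonoidAlgebra ℤ G) M›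
  let c : MonoidAlgebra ℤ G →ₗ[ℤ] ℤ :=
    { toFun := fun a => a.coeff 1, map_add' := fun _ _ => rfl, map_smul' := fun _ _ => rfl }
  -- Taking the coefficient at 1 suffices: averaging over the group recovers a = ∑ a_g g, and the
  -- section `s` transports this from the free module to `M`.
  let t₀ : (M →₀ MonoidAlgebra ℤ G) →ₗ[ℤ] M :=
    Finsupp.linearCombination ℤ id ∘ₗ Finsupp.mapRange.linearMap c
  have ht₀ : ∀ v, ∑ g : G, gp g • t₀ (gp g⁻¹ • v) =
      Finsupp.linearCombination (MonoidAlgebra ℤ G) id v := by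
    intro v
    induction v using Finsupp.induction_linear with
    | zero => simp
    | add v w hv hw => simp only [smul_add, map_add, Finset.sum_add_distrib, hv, hw]
    | single x a =>
      simp only [t₀, Finsupp.smul_single, LinearMap.comp_apply, Finsupp.mapRange.linearMap_apply,
        Finsupp.mapRange_single, Finsupp.linearCombination_single, id]
      have h1 : ∀ g : G, c (gp g⁻¹ • a) = a.coeff g := fun g => by
        change (MonoidAlgebra.single g⁻¹ 1 * a).coeff 1 = _
        rw [MonoidAlgebra.coeff_single_mul_apply, one_mul, inv_inv, mul_one]
      have h2 : a = ∑ g : G, a.coeff g • gp g := by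
        ext h
        simp [MonoidAlgebra.of_apply]
      simp_rw [h1]
      conv_rhs => rw [h2, Finset.sum_smul]
      exact Finset.sum_congr rfl fun g _ => by rw [smul_assoc, smul_comm]
  refine ⟨t₀ ∘ₗ s.restrictScalars ℤ, fun x => ?_⟩
  have := ht₀ (s x)
  simp only [← map_smul] at this
  exact this.trans (LinearMap.congr_fun hs x)

theorem finite_int [Finite G] [Module.Finite (MonoidAlgebra ℤ G) M] : Module.Finite ℤ M :=
  Module.Finite.trans (MonoidAlgebra ℤ G) M

theorem isTorsionFree_int [Module.Projective (MonoidAlgebra ℤ G) M] :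
    Module.IsTorsionFree ℤ M := by
  obtain ⟨s, hs⟩ := Module.projective_def'.mp ‹Module.Projective (MonoidAlgebra ℤ G) M›
  have hinj : Function.Injective (s.restrictScalars ℤ) :=
    Function.LeftInverse.injective
      (g := Finsupp.linearCombination (MonoidAlgebra ℤ G) id) fun x => LinearMap.congr_fun hs x
  exact hinj.moduleIsTorsionFree _ fun c x => map_smul (s.restrictScalars ℤ) c x

theorem free_int [Finite G] [Module.Finite (MonoidAlgebra ℤ G) M]
    [Module.Projective (MonoidAlgebra ℤ G) M] : Module.Free ℤ M := by
  have := finite_int (G := G) (M := M)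
  have := isTorsionFree_int (G := G) (M := M)
  exact Module.free_of_finite_type_torsion_free'

end GroupRingModules

/-! ### Idempotents in the group ring of a finite abelian group. -/

section Abelian

variable {C : Type*} [CommGroup C] [Finite C]

/-- The integral group ring of a finite abelian group has no nontrivial idempotents. -/
theorem isIdempotentElem_groupRing {e : MonoidAlgebra ℤ C} (he : e * e = e) : e = 0 ∨ e = 1 := by
  classical
  have : Fintype C := Fintype.ofFinite C
  -- The trace of multiplication by `e` is |C| times the coefficient of `e` at 1, and also the rank
  -- of the image, which is between 0 and |C|. So the coefficient is 0 or 1, and an idempotent of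
  -- trace zero over ℤ vanishes.
  let τ : MonoidAlgebra ℤ C → ℤ := fun a => LinearMap.trace ℤ _ (LinearMap.mulLeft ℤ a)
  have hτ : ∀ a, τ a = Fintype.card C * a.coeff 1 := by
    intro a
    change LinearMap.trace ℤ _ (LinearMap.mulLeft ℤ a) = _
    rw [LinearMap.trace_eq_matrix_trace ℤ (MonoidAlgebra.basis C ℤ), Matrix.trace]
    have : ∀ i : C, Matrix.diag (LinearMap.toMatrix (MonoidAlgebra.basis C ℤ)
        (MonoidAlgebra.basis C ℤ) (LinearMap.mulLeft ℤ a)) i = a.coeff 1 := by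
      intro i
      rw [Matrix.diag_apply, LinearMap.toMatrix_apply, MonoidAlgebra.basis_apply]
      change (a * (MonoidAlgebra.single i (1 : ℤ))).coeff i = _
      simp [MonoidAlgebra.coeff_mul_single_apply]
    rw [Finset.sum_congr rfl fun i _ => this i]
    simp
  have hid : ∀ a : MonoidAlgebra ℤ C, a * a = a → IsIdempotentElem (LinearMap.mulLeft ℤ a) := by
    intro a ha
    refine LinearMap.ext fun x => ?_
    change a * (a * x) = a * x
    rw [← mul_assoc, ha]
  have hzero : ∀ a : MonoidAlgebra ℤ C, a * a = a → τ a = 0 → a = 0 := by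
    intro a ha h
    have := LinearMap.IsIdempotentElem.eq_zero_of_trace_eq_zero (hid a ha) h
    simpa using LinearMap.congr_fun this 1
  have h1 := (LinearMap.IsIdempotentElem.isProj_range _ (hid e he)).trace
  have h2 : Module.finrank ℤ (LinearMap.mulLeft ℤ e).range ≤ Fintype.card C := by
    refine (Submodule.finrank_le _).trans ?_
    rw [Module.finrank_eq_card_basis (MonoidAlgebra.basis C ℤ)]
  have h3 := (hτ e).symm.trans h1
  have hpos : (0 : ℤ) < Fintype.card C := by exact_mod_cast Fintype.card_pos
  have h4 : e.coeff 1 = 0 ∨ e.coeff 1 = 1 := by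
    have h5 : 0 ≤ e.coeff 1 := by
      by_contra! h
      nlinarith
    have h6 : e.coeff 1 ≤ 1 := by
      by_contra! h
      have : ((Module.finrank ℤ (LinearMap.mulLeft ℤ e).range : ℕ) : ℤ) ≤ Fintype.card C := by
        exact_mod_cast h2
      nlinarith
    omega
  rcases h4 with h | h
  · exact Or.inl (hzero e he (by rw [hτ, h, mul_zero]))
  · right
    have := hzero (1 - e) (by rw [mul_sub, sub_mul, sub_mul, he]; simp) (by
      rw [hτ, MonoidAlgebra.coeff_sub, Finsupp.sub_apply, h]
      simp [MonoidAlgebra.one_def])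
    exact (sub_eq_zero.mp this).symm

/-- Connectedness is what makes the rank of a projective module constant on the spectrum. -/
instance preconnectedSpace_groupRing : PreconnectedSpace (PrimeSpectrum (MonoidAlgebra ℤ C)) := by
  rw [preconnectedSpace_iff_clopen]
  intro s hs
  obtain ⟨e, he, rfl⟩ := PrimeSpectrum.exists_idempotent_basicOpen_eq_of_isClopen hs
  rcases isIdempotentElem_groupRing he with rfl | rfl
  · left; simp
  · right; simp

end Abelian

/-! ### Counting homomorphisms from a projective module to a finite module. -/

section HomCounting

/-- `|Hom(P, -)|` is multiplicative in short exact sequences if `P` is projective. -/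
theorem card_hom_eq_mul {R P S : Type*} [Ring R] [AddCommGroup P] [Module R P]
    [Module.Projective R P] [AddCommGroup S] [Module R S] (S' : Submodule R S) :
    Nat.card (P →ₗ[R] S) = Nat.card (P →ₗ[R] S') * Nat.card (P →ₗ[R] S ⧸ S') := by
  let φ : (P →ₗ[R] S) →+ (P →ₗ[R] S ⧸ S') :=
    { toFun := fun f => S'.mkQ ∘ₗ f
      map_zero' := LinearMap.comp_zero _
      map_add' := fun f g => LinearMap.comp_add f g _ }
  have hφ : Function.Surjective φ := fun g =>
    Module.projective_lifting_property S'.mkQ g S'.mkQ_surjective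
  let e : (P →ₗ[R] S') ≃ φ.ker :=
    { toFun := fun f => ⟨S'.subtype ∘ₗ f, by
        refine LinearMap.ext fun x => ?_
        exact (Submodule.Quotient.mk_eq_zero S').mpr (f x).2⟩
      invFun := fun f => f.1.codRestrict S' fun x =>
        (Submodule.Quotient.mk_eq_zero S').mp (LinearMap.congr_fun f.2 x)
      left_inv := fun _ => rfl
      right_inv := fun _ => rfl }
  rw [AddSubgroup.card_eq_card_quotient_mul_card_addSubgroup φ.ker, ← Nat.card_congr e,
    Nat.card_congr (QuotientAddGroup.quotientKerEquivOfSurjective φ hφ).toEquiv, mul_comm]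

theorem card_hom_congr {R P S S' : Type*} [Ring R] [AddCommGroup P] [Module R P]
    [AddCommGroup S] [Module R S] [AddCommGroup S'] [Module R S'] (e : S ≃ₗ[R] S') :
    Nat.card (P →ₗ[R] S) = Nat.card (P →ₗ[R] S') :=
  Nat.card_congr
    { toFun := fun f => e.toLinearMap ∘ₗ f
      invFun := fun f => e.symm.toLinearMap ∘ₗ f
      left_inv := fun _ => LinearMap.ext fun _ => e.symm_apply_apply _
      right_inv := fun _ => LinearMap.ext fun _ => e.apply_symm_apply _ }

/-- Over a commutative ring, a finite projective module of constant rank `n` has `|S|^n`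
homomorphisms to each finite module `S`. -/
theorem card_hom_eq_pow {R : Type*} [CommRing R] {P : Type*} [AddCommGroup P] [Module R P]
    [Module.Finite R P] [Module.Projective R P] {n : ℕ} (hn : ∀ p, Module.rankAtStalk (R := R) P p = n)
    (S : Type*) [AddCommGroup S] [Module R S] [Finite S] :
    Nat.card (P →ₗ[R] S) = Nat.card S ^ n := by
  induction hc : Nat.card S using Nat.strong_induction_on generalizing S with
  | _ c ih =>
  subst hc
  rcases subsingleton_or_nontrivial S with hS | hS
  · rw [Nat.card_of_subsingleton (0 : S), one_pow, Nat.card_of_subsingleton (0 : P →ₗ[R] S)]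
  -- For S = R/I the homomorphisms form the dual of the fibre at I, of dimension `n`. Otherwise a
  -- proper nonzero submodule gives multiplicativity on both sides.
  by_cases hsimple : IsSimpleModule R S
  · obtain ⟨I, hI, ⟨e⟩⟩ := isSimpleModule_iff_quot_maximal.mp hsimple
    let _ := Ideal.Quotient.field I
    have : Finite (R ⧸ I) := Finite.of_equiv S e.toEquiv
    rw [card_hom_congr e, Nat.card_congr e.toEquiv]
    rw [Nat.card_congr (LinearMap.liftBaseChangeEquiv (R := R) (M := P) (N := R ⧸ I)
      (R ⧸ I)).toEquiv]
    have h1 : Module.finrank (R ⧸ I) ((R ⧸ I) ⊗[R] P) = n := by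
      have h2 := Module.rankAtStalk_baseChange (R := R) (M := P) (S := R ⧸ I) ⊥
      rw [hn, Module.rankAtStalk_eq_finrank_of_free] at h2
      simpa using h2
    have : Finite (Module.Dual (R ⧸ I) ((R ⧸ I) ⊗[R] P)) := Module.finite_of_finite (R ⧸ I)
    have : Fintype (Module.Dual (R ⧸ I) ((R ⧸ I) ⊗[R] P)) := Fintype.ofFinite _
    have : Fintype (R ⧸ I) := Fintype.ofFinite _
    have h3 := Module.card_eq_pow_finrank (K := R ⧸ I) (V := Module.Dual (R ⧸ I) ((R ⧸ I) ⊗[R] P))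
    rw [Subspace.dual_finrank_eq, h1] at h3
    rw [Nat.card_eq_fintype_card (α := R ⧸ I), ← h3, ← Nat.card_eq_fintype_card]
  · obtain ⟨S', hbot, htop⟩ : ∃ S' : Submodule R S, S' ≠ ⊥ ∧ S' ≠ ⊤ := by
      by_contra! h
      exact hsimple ((isSimpleModule_iff ..).mpr ⟨fun S' => or_iff_not_imp_left.mpr (h S')⟩)
    have hmul := Submodule.card_eq_card_quotient_mul_card S'
    have : Finite (S ⧸ S') := Finite.of_surjective _ S'.mkQ_surjective
    have : Nontrivial S' := (Submodule.nontrivial_iff_ne_bot).mpr hbot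
    have : Nontrivial (S ⧸ S') := Submodule.Quotient.nontrivial_iff.mpr htop
    have h1 : 1 < Nat.card S' := Finite.one_lt_card
    have h2 : 1 < Nat.card (S ⧸ S') := Finite.one_lt_card
    rw [card_hom_eq_mul S', ih _ (by nlinarith) S' rfl, ih _ (by nlinarith) (S ⧸ S') rfl,
      ← mul_pow, hmul]

end HomCounting

/-! ### The count for abelian groups. -/

section AbelianCount

variable {C : Type*} [CommGroup C] [Fintype C] {P : Type*} [AddCommGroup P]
  [Module (MonoidAlgebra ℤ C) P]

/-- The averaged section splits the multiplication map from ℤC ⊗ P, which is projective as P is free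
over ℤ. This is how projectivity passes to cyclic subgroups. -/
theorem projective_of_relative_section [Module.Free ℤ P] (t : P →ₗ[ℤ] P)
    (ht : ∀ x, ∑ g : C, gp g • t (gp g⁻¹ • x) = x) : Module.Projective (MonoidAlgebra ℤ C) P := by
  let i : P →ₗ[MonoidAlgebra ℤ C] (MonoidAlgebra ℤ C ⊗[ℤ] P) := linearOfGroup
    { toFun := fun x => ∑ g : C, gp g ⊗ₜ[ℤ] t (gp g⁻¹ • x)
      map_zero' := by simp
      map_add' := fun x y => by
        simp only [smul_add, map_add, TensorProduct.tmul_add, Finset.sum_add_distrib] } (by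
    intro h x
    change ∑ g : C, gp g ⊗ₜ[ℤ] t (gp g⁻¹ • gp h • x) = gp h • ∑ g : C, gp g ⊗ₜ[ℤ] t (gp g⁻¹ • x)
    rw [Finset.smul_sum]
    refine Fintype.sum_equiv (Equiv.mulLeft h⁻¹) _ _ fun g => ?_
    rw [TensorProduct.smul_tmul', smul_eq_mul, ← gp_mul, ← mul_smul, ← gp_mul, Equiv.coe_mulLeft,
      mul_inv_cancel_left, _root_.mul_inv_rev, inv_inv])
  let s : (MonoidAlgebra ℤ C ⊗[ℤ] P) →ₗ[MonoidAlgebra ℤ C] P :=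
    LinearMap.liftBaseChange (MonoidAlgebra ℤ C) LinearMap.id
  refine Module.Projective.of_split i s (LinearMap.ext fun x => ?_)
  change s (∑ g : C, gp g ⊗ₜ[ℤ] t (gp g⁻¹ • x)) = x
  rw [map_sum]
  exact (Finset.sum_congr rfl fun g _ => LinearMap.liftBaseChange_tmul _ _ _ _).trans (ht x)

/-- `𝔽_p C` as a module over `ℤC`. -/
@[reducible] def modGroupRingModule (G : Type*) [Group G] (p : ℕ) :
    Module (MonoidAlgebra ℤ G) (MonoidAlgebra (ZMod p) G) :=
  Module.compHom _ (MonoidAlgebra.mapRingHom G (Int.castRingHom (ZMod p)))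

attribute [local instance] modGroupRingModule

theorem coeff_gp_smul {G : Type*} [Group G] {p : ℕ} (g h : G) (a : MonoidAlgebra (ZMod p) G) :
    (gp g • a).coeff h = a.coeff (g⁻¹ * h) := by
  change (MonoidAlgebra.mapRingHom G (Int.castRingHom (ZMod p)) (gp g) * a).coeff h = _
  rw [show gp g = MonoidAlgebra.single g 1 from rfl, MonoidAlgebra.mapRingHom_single, map_one,
    MonoidAlgebra.coeff_single_mul_apply, one_mul]

/-- Frobenius reciprocity for the coinduced module `𝔽_p C`. -/
theorem card_hom_modGroupRing (p : ℕ) [Fact p.Prime] [Module.Finite ℤ P] [Module.Free ℤ P] :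
    Nat.card (P →ₗ[MonoidAlgebra ℤ C] MonoidAlgebra (ZMod p) C) = p ^ Module.finrank ℤ P := by
  let e : (P →ₗ[MonoidAlgebra ℤ C] MonoidAlgebra (ZMod p) C) ≃ (P →ₗ[ℤ] ZMod p) :=
    { toFun := fun φ =>
        { toFun := fun x => (φ x).coeff 1
          map_add' := fun x y => by rw [map_add]; rfl
          map_smul' := fun c x => by rw [map_zsmul]; rfl }
      invFun := fun ψ => linearOfGroup
        { toFun := fun x => MonoidAlgebra.ofCoeff
            (Finsupp.equivFunOnFinite.symm fun g => ψ (gp g⁻¹ • x))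
          map_zero' := by ext; simp
          map_add' := fun x y => by ext; simp } (by
        intro h x
        ext g
        rw [coeff_gp_smul]
        change ψ (gp g⁻¹ • gp h • x) = ψ (gp (h⁻¹ * g)⁻¹ • x)
        rw [← mul_smul, ← gp_mul, mul_inv_rev, inv_inv])
      left_inv := fun φ => by
        refine LinearMap.ext fun x => ?_
        ext g
        change (φ (gp g⁻¹ • x)).coeff 1 = _
        rw [map_smul, coeff_gp_smul, inv_inv, mul_one]
      right_inv := fun ψ => by
        refine LinearMap.ext fun x => ?_
        change ψ (gp (1 : C)⁻¹ • x) = ψ x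
        rw [inv_one, gp_one, one_smul] }
  let b := Module.finBasis ℤ P
  rw [Nat.card_congr e, ← Nat.card_congr (b.constr ℤ (M' := ZMod p)).toEquiv]
  simp

/-- For a finite projective module over an abelian group ring, `|Hom(P, S)|^|C| = |S|^(rank P)`. -/
theorem card_hom_pow_of_comm (p : ℕ) [Fact p.Prime] [Module.Finite ℤ P] [Module.Free ℤ P]
    (t : P →ₗ[ℤ] P) (ht : ∀ x, ∑ g : C, gp g • t (gp g⁻¹ • x) = x)
    (S : Type*) [AddCommGroup S] [Module (MonoidAlgebra ℤ C) S] [Finite S] :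
    Nat.card (P →ₗ[MonoidAlgebra ℤ C] S) ^ Nat.card C = Nat.card S ^ Module.finrank ℤ P := by
  have := projective_of_relative_section t ht
  have : Module.Finite (MonoidAlgebra ℤ C) P := Module.Finite.of_restrictScalars_finite ℤ _ _
  have : Module.FinitePresentation (MonoidAlgebra ℤ C) P := Module.finitePresentation_of_projective _ _
  have : NeZero p := ⟨(Fact.out : p.Prime).ne_zero⟩
  have hconst := Module.isLocallyConstant_rankAtStalk (R := MonoidAlgebra ℤ C) (M := P)
  let x₀ : PrimeSpectrum (MonoidAlgebra ℤ C) := Classical.arbitrary _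
  obtain ⟨n, hn⟩ : ∃ n, ∀ q, Module.rankAtStalk (R := MonoidAlgebra ℤ C) P q = n :=
    ⟨_, fun q => hconst.apply_eq_of_preconnectedSpace q x₀⟩
  have : Finite (MonoidAlgebra (ZMod p) C) :=
    Finite.of_equiv (C → ZMod p) (MonoidAlgebra.coeffEquiv.trans Finsupp.equivFunOnFinite).symm
  -- Testing on 𝔽_p C identifies the constant rank: `n` times |C| is the rank of `P` over ℤ.
  have h1 := card_hom_eq_pow hn (MonoidAlgebra (ZMod p) C)
  rw [card_hom_modGroupRing, Nat.card_congr (MonoidAlgebra.coeffEquiv.trans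
    Finsupp.equivFunOnFinite)] at h1
  simp only [Nat.card_pi, Nat.card_zmod, Finset.prod_const, Finset.card_univ, ← pow_mul] at h1
  rw [card_hom_eq_pow hn S, ← pow_mul, Nat.pow_right_injective (Fact.out : p.Prime).two_le h1,
    Nat.card_eq_fintype_card (α := C), mul_comm]

end AbelianCount

/-! ### The count for arbitrary finite groups, by reduction to cyclic subgroups. -/

section HomRepresentation

variable {G : Type*} [Group G] {P S : Type*} [AddCommGroup P] [Module (MonoidAlgebra ℤ G) P]
  [AddCommGroup S] [Module (MonoidAlgebra ℤ G) S]

/-- A relative section for a group gives one for each subgroup. -/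
theorem exists_relative_section_subgroup [Fintype G] (C : Subgroup G) [Fintype C] (t : P →ₗ[ℤ] P)
    (ht : ∀ x, ∑ g : G, gp g • t (gp g⁻¹ • x) = x) :
    ∃ t' : P →ₗ[ℤ] P, ∀ x, ∑ c : C, gp (c : G) • t' (gp (c : G)⁻¹ • x) = x := by
  classical
  obtain ⟨R, hR, -⟩ := C.exists_isComplement_right 1
  replace hR : ∀ g, ∃! s : C, (s : G)⁻¹ * g ∈ R :=
    Subgroup.isComplement_iff_existsUnique_inv_mul_mem.mp hR
  let ρ := toRepresentation G P
  -- The conjugates of `t` are summed over a right transversal `R` of `C`. Since every element is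
  -- uniquely a product of one in `C` and one in `R`, summing over `C` restores the sum over `G`.
  refine ⟨∑ g : G, if g ∈ R then ρ g ∘ₗ t ∘ₗ ρ g⁻¹ else 0, fun x => ?_⟩
  have h1 : ∀ c : C, gp (c : G) • (∑ g : G, if g ∈ R then ρ g ∘ₗ t ∘ₗ ρ g⁻¹ else 0 : P →ₗ[ℤ] P)
      (gp (c : G)⁻¹ • x) = ∑ g : G, if (c : G)⁻¹ * g ∈ R then gp g • t (gp g⁻¹ • x) else 0 := by
    intro c
    rw [LinearMap.sum_apply, Finset.smul_sum]
    refine Fintype.sum_equiv (Equiv.mulLeft (c : G)) _ _ fun g => ?_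
    rw [Equiv.coe_mulLeft, inv_mul_cancel_left]
    split_ifs
    · change gp (c : G) • gp g • t (gp g⁻¹ • gp (c : G)⁻¹ • x) = _
      rw [← mul_smul, ← mul_smul, ← gp_mul, ← gp_mul, mul_inv_rev]
    · rw [LinearMap.zero_apply, smul_zero]
  rw [Finset.sum_congr rfl fun c _ => h1 c, Finset.sum_comm]
  conv_rhs => rw [← ht x]
  refine Finset.sum_congr rfl fun g _ => ?_
  obtain ⟨c, hc, hc'⟩ := hR g
  rw [Finset.sum_eq_single c, if_pos hc]
  · exact fun b _ hb => if_neg fun h => hb (hc' b h)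
  · exact fun h => (h (Finset.mem_univ c)).elim

variable (P S) in
/-- The conjugation action on additive maps from `P` to a module `S` over `𝔽_p`. -/
def homRepresentation (p : ℕ) [Module (ZMod p) S] : Representation (ZMod p) G (P →ₗ[ℤ] S) where
  toFun g := AddMonoidHom.toZModLinearMap p
    { toFun := fun φ => toRepresentation G S g ∘ₗ φ ∘ₗ toRepresentation G P g⁻¹
      map_zero' := by rw [LinearMap.zero_comp, LinearMap.comp_zero]
      map_add' := fun φ ψ => by rw [LinearMap.add_comp, LinearMap.comp_add] }
  map_one' := by
    refine LinearMap.ext fun φ => LinearMap.ext fun x => ?_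
    change gp (1 : G) • φ (gp (1 : G)⁻¹ • x) = φ x
    rw [inv_one, gp_one, one_smul, one_smul]
  map_mul' g h := by
    refine LinearMap.ext fun φ => LinearMap.ext fun x => ?_
    change gp (g * h) • φ (gp (g * h)⁻¹ • x) = gp g • gp h • φ (gp h⁻¹ • gp g⁻¹ • x)
    rw [← mul_smul, ← mul_smul, ← gp_mul, ← gp_mul, mul_inv_rev]

theorem homRepresentation_apply (p : ℕ) [Module (ZMod p) S] (g : G) (φ : P →ₗ[ℤ] S) (x : P) :
    homRepresentation P S p g φ x = gp g • φ (gp g⁻¹ • x) := rfl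

/-- The invariants of the conjugation action are the equivariant maps. -/
theorem card_fixedBy_homRepresentation (p : ℕ) [Module (ZMod p) S] {Γ : Type*} [Group Γ]
    [Module (MonoidAlgebra ℤ Γ) P] [Module (MonoidAlgebra ℤ Γ) S] (C : Subgroup G) (j : Γ →* G)
    (hj : j.range = C) (hP : ∀ (γ : Γ) (x : P), gp γ • x = gp (j γ) • x)
    (hS : ∀ (γ : Γ) (x : S), gp γ • x = gp (j γ) • x) :
    Nat.card (fixedBy (homRepresentation P S p) C) = Nat.card (P →ₗ[MonoidAlgebra ℤ Γ] S) :=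
  Nat.card_congr
    { toFun := fun φ => linearOfGroup φ.1.toAddMonoidHom fun γ x => by
        have := LinearMap.congr_fun (φ.2 (j γ) (hj ▸ ⟨γ, rfl⟩)) (gp (j γ) • x)
        rw [homRepresentation_apply, gp_inv_smul_gp_smul] at this
        rw [hP, hS]
        exact this.symm
      invFun := fun φ => ⟨φ.toAddMonoidHom.toIntLinearMap, by
        rintro c hc
        rw [← hj] at hc
        obtain ⟨γ, rfl⟩ := hc
        refine LinearMap.ext fun x => ?_
        rw [homRepresentation_apply]
        change gp (j γ) • φ (gp (j γ)⁻¹ • x) = φ x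
        rw [← hS, ← map_smul, hP, gp_smul_gp_inv_smul]⟩
      left_inv := fun _ => rfl
      right_inv := fun _ => rfl }

/-- Swan's rank formula: if `P` is finite projective over `ℤG` and `S` is a finite module over `𝔽_p G`,
then `|Hom(P, S)|^|G| = |S|^(rank P)`. -/
theorem card_hom_pow [Finite G] [Module.Finite (MonoidAlgebra ℤ G) P]
    [Module.Projective (MonoidAlgebra ℤ G) P] (p : ℕ) [Fact p.Prime] [Module (ZMod p) S]
    [Finite S] :
    Nat.card (P →ₗ[MonoidAlgebra ℤ G] S) ^ Nat.card G = Nat.card S ^ Module.finrank ℤ P := by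
  classical
  have : Fintype G := Fintype.ofFinite G
  have : NeZero p := ⟨(Fact.out : p.Prime).ne_zero⟩
  have := finite_int (G := G) (M := P)
  have := free_int (G := G) (M := P)
  let b := Module.finBasis ℤ P
  let e := b.constr ℤ (M' := S)
  have : Finite (P →ₗ[ℤ] S) := Finite.of_equiv _ e.toEquiv
  have hW : Nat.card (P →ₗ[ℤ] S) = Nat.card S ^ Module.finrank ℤ P := by
    rw [← Nat.card_congr e.toEquiv, Nat.card_fun, Nat.card_fin]
  have hcard : ∀ (V : Type _) [AddCommGroup V] [Module (ZMod p) V] [Finite V],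
      Nat.card V = p ^ Module.finrank (ZMod p) V := by
    intro V _ _ _
    have := Fintype.ofFinite V
    rw [Nat.card_eq_fintype_card, Module.card_eq_pow_finrank (K := ZMod p), ZMod.card]
  have : Module.Finite (ZMod p) (P →ₗ[ℤ] S) := Module.Finite.of_finite
  obtain ⟨t, ht⟩ := exists_relative_section (G := G) (M := P)
  -- The invariants of a subgroup are its equivariant maps. Precomposition with `t` shows that this
  -- representation is relatively projective, so the abelian count for all cyclic subgroups
  -- determines the count for `G`.
  let ρ := homRepresentation (G := G) P S p
  let tW : (P →ₗ[ℤ] S) →ₗ[ZMod p] (P →ₗ[ℤ] S) :=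
    { toFun := fun φ => φ ∘ₗ t
      map_add' := fun _ _ => rfl
      map_smul' := fun _ _ => rfl }
  have htW : ∀ φ, ∑ g, ρ g (tW (ρ g⁻¹ φ)) = φ := by
    intro φ
    refine LinearMap.ext fun x => ?_
    rw [LinearMap.sum_apply]
    conv_rhs => rw [← ht x, map_sum]
    refine Finset.sum_congr rfl fun g _ => ?_
    change gp g • gp g⁻¹ • φ (gp g⁻¹⁻¹ • t (gp g⁻¹ • x)) = _
    rw [gp_smul_gp_inv_smul, inv_inv]
  have hinj := Nat.pow_right_injective (Fact.out : p.Prime).two_le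
  have key := card_mul_finrank_fixedBy ρ tW htW fun g => by
    let _ : Module (MonoidAlgebra ℤ (Subgroup.zpowers g)) P :=
      Module.compHom _ (MonoidAlgebra.mapDomainRingHom ℤ (Subgroup.zpowers g).subtype)
    let _ : Module (MonoidAlgebra ℤ (Subgroup.zpowers g)) S :=
      Module.compHom _ (MonoidAlgebra.mapDomainRingHom ℤ (Subgroup.zpowers g).subtype)
    have hP : ∀ (γ : Subgroup.zpowers g) (x : P),
        gp γ • x = gp ((Subgroup.zpowers g).subtype γ) • x := fun γ x => by
      change (MonoidAlgebra.mapDomainRingHom ℤ (Subgroup.zpowers g).subtype (gp γ)) • x = _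
      simp
    have hS : ∀ (γ : Subgroup.zpowers g) (x : S),
        gp γ • x = gp ((Subgroup.zpowers g).subtype γ) • x := fun γ x => by
      change (MonoidAlgebra.mapDomainRingHom ℤ (Subgroup.zpowers g).subtype (gp γ)) • x = _
      simp
    let _ : CommGroup (Subgroup.zpowers g) := IsMulCommutative.instCommGroup
    obtain ⟨t', ht'⟩ := exists_relative_section_subgroup (Subgroup.zpowers g) t ht
    have h1 := card_hom_pow_of_comm (C := Subgroup.zpowers g) p t' (fun x => by
      conv_rhs => rw [← ht' x]
      refine Finset.sum_congr rfl fun c _ => ?_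
      rw [hP, hP]
      rfl) S
    have h2 := card_fixedBy_homRepresentation (P := P) (S := S) p (Subgroup.zpowers g)
      (Subgroup.zpowers g).subtype (Subgroup.range_subtype _) hP hS
    rw [← h2, hcard, ← hW, hcard, ← pow_mul] at h1
    rw [mul_comm]
    exact hinj h1
  have h2 := card_fixedBy_homRepresentation (P := P) (S := S) p ⊤ (MonoidHom.id G)
    (MonoidHom.range_eq_top.mpr Function.surjective_id) (fun _ _ => rfl) (fun _ _ => rfl)
  rw [← h2, hcard, ← hW, hcard, ← pow_mul, mul_comm]
  exact congrArg _ key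

end HomRepresentation

/-! ### Surjections between finite semisimple modules. -/

section Semisimple

variable {R : Type u} [Ring R]

theorem card_hom_prod (X X' S : Type u) [AddCommGroup X] [Module R X] [AddCommGroup X']
    [Module R X'] [AddCommGroup S] [Module R S] :
    Nat.card (X × X' →ₗ[R] S) = Nat.card (X →ₗ[R] S) * Nat.card (X' →ₗ[R] S) := by
  rw [← Nat.card_prod]
  exact (Nat.card_congr (LinearMap.coprodEquiv ℤ).toEquiv).symm

theorem card_hom_congr_left {X X' S : Type u} [AddCommGroup X] [Module R X] [AddCommGroup X']
    [Module R X'] [AddCommGroup S] [Module R S] (e : X ≃ₗ[R] X') :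
    Nat.card (X →ₗ[R] S) = Nat.card (X' →ₗ[R] S) :=
  Nat.card_congr
    { toFun := fun f => f ∘ₗ e.symm.toLinearMap
      invFun := fun f => f ∘ₗ e.toLinearMap
      left_inv := fun f => LinearMap.ext fun x => congrArg f (e.symm_apply_apply x)
      right_inv := fun f => LinearMap.ext fun x => congrArg f (e.apply_symm_apply x) }

theorem finite_hom (X S : Type u) [AddCommGroup X] [Module R X] [Finite X] [AddCommGroup S]
    [Module R S] [Finite S] : Finite (X →ₗ[R] S) :=
  Finite.of_injective (fun f : X →ₗ[R] S => (f : X → S)) DFunLike.coe_injective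

/-- A finite semisimple module with enough maps to simple modules surjects onto another. -/
theorem exists_surjective_of_card_hom_le (X Y : Type u) [AddCommGroup X] [Module R X] [Finite X]
    [IsSemisimpleModule R X] [AddCommGroup Y] [Module R Y] [Finite Y] [IsSemisimpleModule R Y]
    (h : ∀ (S : Type u) [AddCommGroup S] [Module R S] [Finite S] [IsSimpleModule R S],
      Nat.card (Y →ₗ[R] S) ≤ Nat.card (X →ₗ[R] S)) :
    ∃ f : X →ₗ[R] Y, Function.Surjective f := by
  induction hc : Nat.card Y using Nat.strong_induction_on generalizing X Y with
  | _ c ih =>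
  subst hc
  rcases subsingleton_or_nontrivial Y with hY | hY
  · exact ⟨0, fun y => ⟨0, Subsingleton.elim _ _⟩⟩
  obtain ⟨S, hS⟩ := IsSemisimpleModule.exists_simple_submodule R Y
  obtain ⟨Y₁, hY₁⟩ := exists_isCompl S
  let eY := Submodule.prodEquivOfIsCompl S Y₁ hY₁
  have hSnt : Nontrivial S := IsSimpleModule.nontrivial R S
  -- The count at `S` itself forces a nonzero map from `X`. Then `S` splits off from both modules
  -- and its contribution to the counts cancels.
  obtain ⟨g, hg⟩ : ∃ g : X →ₗ[R] S, g ≠ 0 := by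
    by_contra! hzero
    have h1 : Nat.card (X →ₗ[R] S) = 1 :=
      Nat.card_eq_one_iff_unique.mpr ⟨⟨fun a b => (hzero a).trans (hzero b).symm⟩, ⟨0⟩⟩
    have : Finite (Y →ₗ[R] S) := finite_hom Y S
    have h2 : 1 < Nat.card (Y →ₗ[R] S) := by
      refine Finite.one_lt_card_iff_nontrivial.mpr ⟨LinearMap.fst R S Y₁ ∘ₗ eY.symm.toLinearMap,
        0, fun h0 => ?_⟩
      obtain ⟨s, hs⟩ := exists_ne (0 : S)
      refine hs ?_
      have := LinearMap.congr_fun h0 (eY (s, 0))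
      simpa using this
    have := h S
    omega
  have hgs : Function.Surjective g := (LinearMap.surjective_or_eq_zero g).resolve_right hg
  obtain ⟨Xc, hXc⟩ := exists_isCompl (LinearMap.ker g)
  let eXc : Xc ≃ₗ[R] S := (Submodule.quotientEquivOfIsCompl _ _ hXc).symm.trans
    (g.quotKerEquivOfSurjective hgs)
  let eX : (S × LinearMap.ker g) ≃ₗ[R] X := (eXc.symm.prodCongr (LinearEquiv.refl R _)).trans
    (Submodule.prodEquivOfIsCompl _ _ hXc.symm)
  have hlt : Nat.card Y₁ < Nat.card Y := by
    have h1 := Nat.card_congr eY.toEquiv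
    rw [Nat.card_prod] at h1
    have h2 : 1 < Nat.card S := Finite.one_lt_card
    have h3 : 0 < Nat.card Y₁ := Nat.card_pos
    nlinarith
  obtain ⟨f, hf⟩ := ih _ hlt (LinearMap.ker g) Y₁ (fun T _ _ _ _ => by
    have h1 := h T
    rw [← card_hom_congr_left eY, ← card_hom_congr_left eX, card_hom_prod, card_hom_prod] at h1
    have : Finite (S →ₗ[R] T) := finite_hom S T
    exact Nat.le_of_mul_le_mul_left h1 Nat.card_pos) rfl
  refine ⟨eY.toLinearMap ∘ₗ (LinearMap.id.prodMap f) ∘ₗ eX.symm.toLinearMap, ?_⟩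
  rw [LinearMap.coe_comp, LinearMap.coe_comp]
  exact eY.surjective.comp ((Function.surjective_id.prodMap hf).comp eX.symm.surjective)

end Semisimple

/-! ### The radical modulo d and stable range one. -/

section RadicalModulo

variable {R : Type u} [Ring R] {M M' : Type u} [AddCommGroup M] [Module R M]
  [AddCommGroup M'] [Module R M']

variable (R M) in
/-- The submodule `dM`. -/
def mulInt (d : ℤ) : Submodule R M := LinearMap.range (d • (LinearMap.id : M →ₗ[R] M))

theorem mem_mulInt {d : ℤ} {x : M} : x ∈ mulInt R M d ↔ ∃ y, d • y = x := Iff.rfl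

theorem map_mulInt_le (d : ℤ) (f : M →ₗ[R] M') : mulInt R M d ≤ (mulInt R M' d).comap f := by
  rintro _ ⟨y, rfl⟩
  exact ⟨f y, (map_zsmul f d y).symm⟩

theorem finite_quotient_mulInt [Module.Finite ℤ M] {d : ℤ} (hd : d ≠ 0) :
    Finite (M ⧸ mulInt R M d) := by
  have : Module.Finite ℤ (M ⧸ mulInt R M d) :=
    Module.Finite.of_surjective ((mulInt R M d).mkQ.restrictScalars ℤ)
      (Submodule.mkQ_surjective (mulInt R M d))
  refine Module.finite_of_fg_torsion _ fun x => ⟨⟨d, mem_nonZeroDivisors_of_ne_zero hd⟩, ?_⟩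
  obtain ⟨x, rfl⟩ := Submodule.mkQ_surjective _ x
  rw [Submonoid.mk_smul, ← map_zsmul, Submodule.mkQ_apply, Submodule.Quotient.mk_eq_zero,
    mem_mulInt]
  exact ⟨x, rfl⟩

variable (R M) in
/-- The radical of `M` modulo `d`. -/
def radMod (d : ℤ) : Submodule R M := sInf {m | IsCoatom m ∧ mulInt R M d ≤ m}

theorem mulInt_le_radMod (d : ℤ) : mulInt R M d ≤ radMod R M d := le_sInf fun _ h => h.2

theorem finite_quotient_radMod [Module.Finite ℤ M] {d : ℤ} (hd : d ≠ 0) :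
    Finite (M ⧸ radMod R M d) := by
  have := finite_quotient_mulInt (R := R) (M := M) hd
  exact Finite.of_surjective _ (Submodule.factor_surjective (mulInt_le_radMod d))

theorem isSemisimple_quotient_radMod [Module.Finite ℤ M] {d : ℤ} (hd : d ≠ 0) :
    IsSemisimpleModule R (M ⧸ radMod R M d) := by
  have := finite_quotient_radMod (R := R) (M := M) hd
  rw [IsArtinian.isSemisimpleModule_iff_jacobson, eq_bot_iff]
  intro x hx
  obtain ⟨x, rfl⟩ := Submodule.mkQ_surjective _ x
  refine (Submodule.Quotient.mk_eq_zero _).mpr (Submodule.mem_sInf.mpr fun m hm => ?_)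
  have : IsSimpleModule R (M ⧸ m) := isSimpleModule_iff_isCoatom.mpr hm.1
  have h1 := IsSemisimpleModule.jacobson_le_ker R R _ _
    (Submodule.factor (show radMod R M d ≤ m from sInf_le hm)) hx
  exact (Submodule.Quotient.mk_eq_zero m).mp h1

/-- A form of Nakayama's lemma: if N + dM were proper, a maximal submodule above it would also
contain the radical modulo `d`. -/
theorem sup_mulInt_eq_top [Module.Finite R M] {d : ℤ} {N : Submodule R M}
    (h : N ⊔ radMod R M d = ⊤) : N ⊔ mulInt R M d = ⊤ := by
  by_contra hne
  obtain ⟨m, hm, hle⟩ := (eq_top_or_exists_le_coatom _).resolve_left hne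
  refine hm.1 (eq_top_iff.mpr (h ▸ sup_le (le_sup_left.trans hle) (sInf_le ⟨hm, ?_⟩)))
  exact le_sup_right.trans hle

theorem map_radMod_le (d : ℤ) (f : M →ₗ[R] M') : radMod R M d ≤ (radMod R M' d).comap f := by
  intro x hx
  refine Submodule.mem_sInf.mpr fun m hm => ?_
  rcases Submodule.isCoatom_comap_or_eq_top f hm.1 with h | h
  · exact Submodule.mem_sInf.mp hx _ ⟨h, (map_mulInt_le d f).trans (Submodule.comap_mono hm.2)⟩
  · have : x ∈ m.comap f := h ▸ Submodule.mem_top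
    exact this

theorem radMod_le_ker {S : Type u} [AddCommGroup S] [Module R S] [IsSimpleModule R S] {d : ℤ}
    (hS : ∀ s : S, d • s = 0) (f : M →ₗ[R] S) : radMod R M d ≤ LinearMap.ker f := by
  rcases Submodule.isCoatom_comap_or_eq_top f (isCoatom_bot (α := Submodule R S)) with h | h
  · refine sInf_le ⟨h, ?_⟩
    rintro _ ⟨y, rfl⟩
    change f (d • y) = 0
    rw [map_zsmul, hS]
  · exact le_top.trans h.ge

/-- Stable range one modulo `d`: if `b` and the left ideal `L` generate `R` modulo `d`, then so does
some `b + t` with `t` in `L`. -/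
theorem exists_add_span_eq_top [Module.Finite ℤ R] {d : ℤ} (hd : d ≠ 0) (b : R)
    (L : Submodule R R) (h : Submodule.span R {b} ⊔ L ⊔ mulInt R R d = ⊤) :
    ∃ t ∈ L, Submodule.span R {b + t} ⊔ mulInt R R d = ⊤ := by
  have := finite_quotient_radMod (R := R) (M := R) hd
  have := isSemisimple_quotient_radMod (R := R) (M := R) hd
  let V := R ⧸ radMod R R d
  let π : R →ₗ[R] V := (radMod R R d).mkQ
  have hπ : Function.Surjective π := Submodule.mkQ_surjective _
  -- Right multiplication by `b` on the semisimple quotient. Its image has a complement inside `L'`,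
  -- and counting maps to simple modules shows that its kernel surjects onto this complement. Adding
  -- that surjection makes the endomorphism onto; by linearity the added map is right multiplication
  -- by its value at 1, which lies in `L'`.
  let rb : V →ₗ[R] V := Submodule.mapQ _ _ (LinearMap.toSpanSingleton R R b) (map_radMod_le d _)
  have hrb : ∀ x, rb (π x) = π (x * b) := fun x => rfl
  let L' := L.map π
  have htop : LinearMap.range rb ⊔ L' = ⊤ := by
    rw [eq_top_iff]
    rintro v -
    obtain ⟨x, rfl⟩ := hπ v
    have hx : x ∈ Submodule.span R {b} ⊔ L ⊔ mulInt R R d := h ▸ Submodule.mem_top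
    obtain ⟨w, hw, z, hz, rfl⟩ := Submodule.mem_sup.mp hx
    obtain ⟨y, hy, l, hl, rfl⟩ := Submodule.mem_sup.mp hw
    obtain ⟨a, rfl⟩ := Submodule.mem_span_singleton.mp hy
    have hz0 : π z = 0 := by
      rw [Submodule.mkQ_apply, Submodule.Quotient.mk_eq_zero]
      exact mulInt_le_radMod d hz
    rw [map_add, map_add, hz0, add_zero]
    refine Submodule.add_mem_sup ?_ ?_
    · exact ⟨π a, hrb a⟩
    · exact Submodule.mem_map_of_mem hl
  obtain ⟨Q, hQ⟩ := exists_isCompl (LinearMap.range rb ⊓ L')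
  have hcompl : IsCompl (LinearMap.range rb) (Q ⊓ L') := by
    constructor
    · rw [disjoint_iff, ← le_bot_iff, ← hQ.inf_eq_bot]
      exact le_inf (le_inf inf_le_left (inf_le_right.trans inf_le_right))
        (inf_le_right.trans inf_le_left)
    · rw [codisjoint_iff, ← htop]
      refine le_antisymm (sup_le le_sup_left (inf_le_right.trans le_sup_right))
        (sup_le le_sup_left ?_)
      intro l hl
      obtain ⟨r, hr, q, hq, hrq⟩ := Submodule.mem_sup.mp
        (show l ∈ LinearMap.range rb ⊓ L' ⊔ Q from hQ.sup_eq_top ▸ Submodule.mem_top)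
      rw [← hrq]
      refine Submodule.add_mem_sup hr.1 ⟨hq, ?_⟩
      have : q = l - r := by rw [← hrq]; abel
      rw [this]
      exact L'.sub_mem hl hr.2
  obtain ⟨Kc, hKc⟩ := exists_isCompl (LinearMap.ker rb)
  let e₁ := Submodule.prodEquivOfIsCompl _ _ hKc
  let e₂ := Submodule.prodEquivOfIsCompl _ _ hcompl
  let e₃ : Kc ≃ₗ[R] LinearMap.range rb :=
    (Submodule.quotientEquivOfIsCompl _ _ hKc).symm.trans rb.quotKerEquivRange
  obtain ⟨φ, hφ⟩ := exists_surjective_of_card_hom_le (R := R) (LinearMap.ker rb)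
    (Q ⊓ L' : Submodule R V) (fun S _ _ _ _ => by
      have h1 := (card_hom_congr_left (S := S) e₁).trans (card_hom_congr_left (S := S) e₂).symm
      rw [card_hom_prod, card_hom_prod, card_hom_congr_left e₃, mul_comm] at h1
      have : Finite (LinearMap.range rb →ₗ[R] S) := finite_hom _ S
      exact (Nat.eq_of_mul_eq_mul_left Nat.card_pos h1).ge)
  let hmap : V →ₗ[R] V := (Q ⊓ L').subtype ∘ₗ φ ∘ₗ LinearMap.fst R _ _ ∘ₗ e₁.symm.toLinearMap
  have hsurj : Function.Surjective (rb + hmap) := by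
    intro v
    obtain ⟨⟨r, q⟩, rfl⟩ := e₂.surjective v
    obtain ⟨k, hk⟩ := e₃.surjective r
    obtain ⟨c, hc⟩ := hφ q
    refine ⟨e₁ (c, k), ?_⟩
    have h1 : e₁.symm (e₁ (c, k)) = (c, k) := e₁.symm_apply_apply _
    have h2 : hmap (e₁ (c, k)) = q := by
      change ((φ (e₁.symm (e₁ (c, k))).1 : (Q ⊓ L' : Submodule R V)) : V) = q
      rw [h1, hc]
    have h3 : e₁ (c, k) = (c : V) + k := Submodule.coe_prodEquivOfIsCompl' _ _ hKc _
    have h4 : rb k = r := congrArg Subtype.val hk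
    rw [LinearMap.add_apply, h2, h3, map_add, LinearMap.mem_ker.mp c.2, zero_add, h4]
    exact (Submodule.coe_prodEquivOfIsCompl' _ _ hcompl (r, q)).symm
  obtain ⟨t, ht, ht'⟩ : hmap (π 1) ∈ L' :=
    (φ (e₁.symm (π 1)).1).2.2
  refine ⟨t, ht, sup_mulInt_eq_top (eq_top_iff.mpr ?_)⟩
  rintro x -
  obtain ⟨v, hv⟩ := hsurj (π x)
  obtain ⟨y, rfl⟩ := hπ v
  have h1 : π (y * (b + t)) = π x := by
    rw [← hv, mul_add, map_add, LinearMap.add_apply, hrb, add_right_inj]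
    calc π (y * t) = y • π t := map_smul π y t
      _ = hmap (π (y * 1)) := by rw [ht', ← map_smul, ← map_smul, smul_eq_mul]
      _ = hmap (π y) := by rw [mul_one]
  rw [← add_sub_cancel (y * (b + t)) x]
  refine Submodule.add_mem_sup (Submodule.mem_span_singleton.mpr ⟨y, rfl⟩) ?_
  exact (Submodule.Quotient.mk_eq_zero _).mp ((map_sub π _ _).trans (sub_eq_zero.mpr h1.symm))

end RadicalModulo

/-! ### From surjectivity modulo d to an integer annihilating the cokernel. -/

section Nakayama

/-- Nakayama's lemma for M/N, in the form that yields an annihilator congruent to 1. No prime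
divisor of `d` divides `e`, so the cokernel is controlled at those primes. -/
theorem exists_smul_mem_of_sup {M : Type*} [AddCommGroup M] [Module.Finite ℤ M] (d : ℤ)
    (N : Submodule ℤ M) (h : ∀ x, ∃ n ∈ N, ∃ y, x = n + d • y) :
    ∃ e : ℤ, d ∣ e - 1 ∧ ∀ x : M, e • x ∈ N := by
  obtain ⟨e, he, he'⟩ := Submodule.exists_sub_one_mem_and_smul_eq_zero_of_fg_of_le_smul
    (Ideal.span {d}) (⊤ : Submodule ℤ (M ⧸ N)) Module.Finite.fg_top (by
      rintro x -
      obtain ⟨x, rfl⟩ := N.mkQ_surjective x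
      obtain ⟨n, hn, y, rfl⟩ := h x
      rw [map_add, Submodule.mkQ_apply, (Submodule.Quotient.mk_eq_zero N).mpr hn, zero_add,
        map_smul]
      exact Submodule.smul_mem_smul (Ideal.mem_span_singleton_self d) trivial)
  refine ⟨e, Ideal.mem_span_singleton.mp he, fun x => ?_⟩
  rw [← Submodule.Quotient.mk_eq_zero, Submodule.Quotient.mk_smul]
  exact he' _ trivial

theorem exists_smul_mem_of_sup_mulInt {R M : Type u} [Ring R] [AddCommGroup M] [Module R M]
    [Module.Finite ℤ M] (d : ℤ) (N : Submodule R M) (h : N ⊔ mulInt R M d = ⊤) :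
    ∃ e : ℤ, d ∣ e - 1 ∧ ∀ x : M, e • x ∈ N :=
  exists_smul_mem_of_sup d (N.restrictScalars ℤ) fun x => by
    obtain ⟨n, hn, z, ⟨y, rfl⟩, hx⟩ :=
      Submodule.mem_sup.mp (show x ∈ N ⊔ mulInt R M d from h ▸ Submodule.mem_top)
    exact ⟨n, hn, y, hx.symm⟩

end Nakayama

/-! ### Correcting a functional modulo d. -/

section StableRange

variable {R P : Type u} [Ring R] [AddCommGroup P] [Module R P]

/-- The map `v ↦ μ(v) a`. -/
def mulRight (μ : P →ₗ[R] R) (a : R) : P →ₗ[R] R := LinearMap.toSpanSingleton R R a ∘ₗ μ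

theorem mulRight_apply (μ : P →ₗ[R] R) (a : R) (v : P) : mulRight μ a v = μ v * a := rfl

theorem exists_mulRight_range_sup_eq_top [Module.Finite ℤ R] {d : ℤ} (hd : d ≠ 0)
    (α μ : P →ₗ[R] R) (y : P) (hy : ∃ c, μ y = 1 + d • c) (I : Submodule R R)
    (h : LinearMap.range α ⊔ I = ⊤) :
    ∃ i ∈ I, LinearMap.range (α + mulRight μ i) ⊔ mulInt R R d = ⊤ := by
  obtain ⟨c, hc⟩ := hy
  -- The vectors v - μ(v) y are killed by `μ` modulo `d`. So α(y) can be corrected by elements of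
  -- `L` while the vector keeps `μ` congruent to 1, and there adding μ(·) i amounts to adding `i`.
  let L := LinearMap.range (α ∘ₗ (LinearMap.id - LinearMap.toSpanSingleton R P y ∘ₗ μ)) ⊔ I
  have hL : ∀ v, α v - μ v * α y ∈ L := fun v => Submodule.mem_sup_left ⟨v, by simp⟩
  obtain ⟨t, ht, htop⟩ := exists_add_span_eq_top hd (α y) L (by
    rw [eq_top_iff, ← h]
    refine le_trans (sup_le ?_ ?_) le_sup_left
    · rintro _ ⟨v, rfl⟩
      rw [← add_sub_cancel (μ v * α y) (α v)]
      exact Submodule.add_mem_sup (Submodule.mem_span_singleton.mpr ⟨μ v, rfl⟩) (hL v)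
    · exact le_sup_right.trans le_sup_right)
  obtain ⟨_, ⟨z, rfl⟩, i, hi, rfl⟩ := Submodule.mem_sup.mp ht
  refine ⟨i, hi, eq_top_iff.mpr (htop ▸ sup_le ?_ le_sup_right)⟩
  rw [Submodule.span_singleton_le_iff_mem]
  refine Submodule.mem_sup.mpr ⟨(α + mulRight μ i) (y + (z - μ z • y)), ⟨_, rfl⟩,
    d • -(c * i - μ z * c * i), ⟨_, rfl⟩, ?_⟩
  simp only [LinearMap.add_apply, mulRight_apply, map_add, map_sub, map_smul, smul_eq_mul, hc,
    LinearMap.comp_apply, LinearMap.sub_apply, LinearMap.id_apply,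
    LinearMap.toSpanSingleton_apply, zsmul_eq_mul]
  have hcomm : μ z * (d : R) = d * μ z := ((Int.cast_commute d (μ z)).eq).symm
  simp only [mul_add, add_mul, mul_sub, one_mul, mul_neg, ← mul_assoc, hcomm]
  abel

/-- A left ideal containing multiples of `R` by integers without common divisor is everything. -/
theorem eq_top_of_smul_mem {J : Submodule R R} (s : Set ℤ) (hs : ∀ n ∈ s, ∀ x : R, n • x ∈ J)
    (h : ∀ q : ℕ, q.Prime → ∃ n ∈ s, ¬ (q : ℤ) ∣ n) : J = ⊤ := by
  let A : Ideal ℤ := (J.restrictScalars ℤ).comap (LinearMap.toSpanSingleton ℤ R 1)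
  obtain ⟨a, ha⟩ := IsPrincipalIdealRing.principal A
  have hmem : ∀ n ∈ s, a ∣ n := fun n hn => by
    have h1 : n ∈ A := hs n hn 1
    rw [ha] at h1
    exact Ideal.mem_span_singleton.mp h1
  have h1 : a.natAbs = 1 := by
    by_contra hne
    obtain ⟨q, hq, hqa⟩ := Nat.exists_prime_and_dvd hne
    obtain ⟨n, hn, hn'⟩ := h q hq
    exact hn' ((Int.natCast_dvd.mpr hqa).trans (hmem n hn))
  have h2 : (1 : ℤ) ∈ A := by
    rw [ha]
    exact Ideal.mem_span_singleton.mpr (Int.isUnit_iff_natAbs_eq.mpr h1).dvd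
  have h3 : (1 : R) ∈ J := by
    have : (1 : ℤ) • (1 : R) ∈ J := h2
    rwa [one_smul] at this
  exact (Ideal.eq_top_iff_one J).mpr h3

end StableRange

/-! ### A Chinese remainder choice of multiplier. -/

section Arithmetic

/-- An integer congruent to one modulo `d` and divisible by an `e₁` that collects the primes of `e`
prime to `d`. -/
theorem exists_int_mod {d e : ℤ} (he : e ≠ 0) :
    ∃ e₁ m : ℤ, IsCoprime d e₁ ∧ e₁ ∣ m ∧ d ∣ m - 1 ∧
      ∀ q : ℕ, q.Prime → (q : ℤ) ∣ e → ¬ (q : ℤ) ∣ d → (q : ℤ) ∣ e₁ := by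
  classical
  let s := e.natAbs.primeFactors.filter fun q : ℕ => ¬ (q : ℤ) ∣ d
  have hcop : IsCoprime d (∏ q ∈ s, ((q : ℕ) : ℤ)) := by
    refine IsCoprime.prod_right fun q hq => ?_
    obtain ⟨h1, h2⟩ := Finset.mem_filter.mp hq
    exact ((Nat.prime_iff_prime_int.mp (Nat.prime_of_mem_primeFactors h1)).coprime_iff_not_dvd.mpr
      h2).symm
  obtain ⟨a, b, hab⟩ := hcop
  refine ⟨_, b * ∏ q ∈ s, ((q : ℕ) : ℤ), ⟨a, b, hab⟩, dvd_mul_left _ _, ⟨-a, by linarith⟩,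
    fun q hq hqe hqd => Finset.dvd_prod_of_mem (fun q : ℕ => (q : ℤ)) (Finset.mem_filter.mpr
      ⟨Nat.mem_primeFactors.mpr ⟨hq, Int.natCast_dvd.mp hqe, Int.natAbs_ne_zero.mpr he⟩, hqd⟩)⟩

end Arithmetic

/-! ### Rank at least two gives a surjection onto ℤG² modulo d. -/

section LocallyFree

variable {G : Type u} [Group G]

/-- By Cauchy's theorem, multiplication by a prime divisor of |S| is not injective, so by Schur's
lemma it is zero. Thus `card_hom_pow` applies to every finite simple module. -/
theorem exists_prime_smul_eq_zero {R S : Type*} [Ring R] [AddCommGroup S] [Module R S] [Finite S]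
    [IsSimpleModule R S] : ∃ p : ℕ, p.Prime ∧ ∀ s : S, p • s = 0 := by
  have : Nontrivial S := IsSimpleModule.nontrivial R S
  obtain ⟨p, hp, hdvd⟩ := Nat.exists_prime_and_dvd (Finite.one_lt_card (α := S)).ne'
  have : Fact p.Prime := ⟨hp⟩
  obtain ⟨x, hx⟩ := exists_prime_addOrderOf_dvd_card' p hdvd
  refine ⟨p, hp, fun s => ?_⟩
  have h0 : p • (LinearMap.id : S →ₗ[R] S) = 0 := by
    refine (LinearMap.injective_or_eq_zero _).resolve_left fun hinj => ?_
    have h1 : x = 0 := hinj (by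
      change p • x = p • 0
      rw [smul_zero, ← hx, addOrderOf_nsmul_eq_zero])
    rw [h1, addOrderOf_zero] at hx
    exact hp.one_lt.ne hx
  exact LinearMap.congr_fun h0 s

variable {P : Type u} [AddCommGroup P] [Module (MonoidAlgebra ℤ G) P]

theorem card_sq_le_card_hom [Finite G] [Module.Finite (MonoidAlgebra ℤ G) P]
    [Module.Projective (MonoidAlgebra ℤ G) P] (h : 2 * Nat.card G ≤ Module.finrank ℤ P)
    (S : Type u) [AddCommGroup S] [Module (MonoidAlgebra ℤ G) S] [Finite S]
    [IsSimpleModule (MonoidAlgebra ℤ G) S] :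
    Nat.card S * Nat.card S ≤ Nat.card (P →ₗ[MonoidAlgebra ℤ G] S) := by
  obtain ⟨p, hp, hpS⟩ := exists_prime_smul_eq_zero (R := MonoidAlgebra ℤ G) (S := S)
  have : Fact p.Prime := ⟨hp⟩
  let _ : Module (ZMod p) S := AddCommGroup.zmodModule hpS
  have h1 := card_hom_pow (G := G) (P := P) (S := S) p
  rw [← pow_two, ← Nat.pow_le_pow_iff_left (Nat.card_pos (α := G)).ne', h1, ← pow_mul]
  exact Nat.pow_le_pow_right Nat.card_pos h

/-- A projective module of rank at least two surjects onto a free module of rank two modulo `d`. -/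
theorem exists_range_sup_eq_top [Finite G] [Module.Finite (MonoidAlgebra ℤ G) P]
    [Module.Projective (MonoidAlgebra ℤ G) P] (h : 2 * Nat.card G ≤ Module.finrank ℤ P) {d : ℤ}
    (hd : d ≠ 0) :
    ∃ θ : P →ₗ[MonoidAlgebra ℤ G] MonoidAlgebra ℤ G × MonoidAlgebra ℤ G,
      LinearMap.range θ ⊔ mulInt (MonoidAlgebra ℤ G) _ d = ⊤ := by
  let R := MonoidAlgebra ℤ G
  have : Module.Finite ℤ P := finite_int (G := G)
  have : Module.Finite ℤ R := finite_int (G := G) (M := R)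
  have := finite_quotient_radMod (R := R) (M := P) hd
  have := finite_quotient_radMod (R := R) (M := R × R) hd
  have := isSemisimple_quotient_radMod (R := R) (M := P) hd
  have := isSemisimple_quotient_radMod (R := R) (M := R × R) hd
  -- A simple module killed by `d` sees all maps from `P` through the radical quotient, and there
  -- are at least |S|² of them. A simple module not killed by `d` receives only zero from the
  -- quotient of R².
  have hle : ∀ (S : Type u) [AddCommGroup S] [Module R S] [Finite S] [IsSimpleModule R S],
      Nat.card ((R × R) ⧸ radMod R (R × R) d →ₗ[R] S) ≤
        Nat.card (P ⧸ radMod R P d →ₗ[R] S) := by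
    intro S _ _ _ _
    by_cases hS : ∀ s : S, d • s = 0
    · have : Finite (R →ₗ[R] S) := Finite.of_equiv S (LinearMap.ringLmapEquivSelf R ℤ S).symm.toEquiv
      have : Finite (R × R →ₗ[R] S) :=
        Finite.of_equiv _ (LinearMap.coprodEquiv (M := R) (M₂ := R) (M₃ := S) (R := R) ℤ).toEquiv
      calc Nat.card ((R × R) ⧸ radMod R (R × R) d →ₗ[R] S)
          ≤ Nat.card (R × R →ₗ[R] S) := Nat.card_le_card_of_injective
            (fun f => f ∘ₗ (radMod R (R × R) d).mkQ) fun f g hfg =>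
              LinearMap.cancel_right (Submodule.mkQ_surjective _) |>.mp hfg
        _ = Nat.card S * Nat.card S := by
            rw [card_hom_prod, Nat.card_congr (LinearMap.ringLmapEquivSelf R ℤ S).toEquiv]
        _ ≤ Nat.card (P →ₗ[R] S) := card_sq_le_card_hom h S
        _ ≤ Nat.card (P ⧸ radMod R P d →ₗ[R] S) := by
            have := finite_hom (R := R) (P ⧸ radMod R P d) S
            refine Nat.card_le_card_of_injective
              (fun f => (radMod R P d).liftQ f (radMod_le_ker hS f)) fun f g hfg => ?_
            refine LinearMap.ext fun x => ?_
            exact LinearMap.congr_fun hfg ((radMod R P d).mkQ x)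
    · have hzero : ∀ f : (R × R) ⧸ radMod R (R × R) d →ₗ[R] S, f = 0 := by
        intro f
        refine (LinearMap.surjective_or_eq_zero f).resolve_left fun hf => hS fun s => ?_
        obtain ⟨v, rfl⟩ := hf s
        obtain ⟨v, rfl⟩ := Submodule.mkQ_surjective _ v
        have h0 : (radMod R (R × R) d).mkQ (d • v) = 0 :=
          (Submodule.Quotient.mk_eq_zero _).mpr (mulInt_le_radMod d ⟨v, rfl⟩)
        rw [← map_zsmul, ← map_zsmul, h0, map_zero]
      have := finite_hom (R := R) (P ⧸ radMod R P d) S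
      rw [Nat.card_eq_one_iff_unique.mpr
        ⟨⟨fun a b => (hzero a).trans (hzero b).symm⟩, ⟨0⟩⟩]
      exact Nat.card_pos
  obtain ⟨f, hf⟩ := exists_surjective_of_card_hom_le (R := R) _ _ hle
  obtain ⟨θ, hθ⟩ := Module.projective_lifting_property (radMod R (R × R) d).mkQ
    (f ∘ₗ (radMod R P d).mkQ) (Submodule.mkQ_surjective _)
  refine ⟨θ, sup_mulInt_eq_top (eq_top_iff.mpr ?_)⟩
  rintro v -
  obtain ⟨w, hw⟩ := hf ((radMod R (R × R) d).mkQ v)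
  obtain ⟨w, rfl⟩ := Submodule.mkQ_surjective _ w
  have h1 : (radMod R (R × R) d).mkQ (v - θ w) = 0 := by
    rw [map_sub, sub_eq_zero, ← hw]
    exact (LinearMap.congr_fun hθ w).symm
  rw [← add_sub_cancel (θ w) v]
  exact Submodule.add_mem_sup ⟨w, rfl⟩ ((Submodule.Quotient.mk_eq_zero _).mp h1)

/-- Elements `x, y` and functionals `l, μ` that are dual modulo `d`. -/
theorem exists_dual [Finite G] [Module.Finite (MonoidAlgebra ℤ G) P]
    [Module.Projective (MonoidAlgebra ℤ G) P] (h : 2 * Nat.card G ≤ Module.finrank ℤ P) {d : ℤ}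
    (hd : d ≠ 0) :
    ∃ (x y : P) (l μ : P →ₗ[MonoidAlgebra ℤ G] MonoidAlgebra ℤ G),
      (∃ c, l x = 1 + d • c) ∧ (∃ c, μ x = d • c) ∧ ∃ c, μ y = 1 + d • c := by
  obtain ⟨θ, hθ⟩ := exists_range_sup_eq_top h hd
  have key : ∀ v, ∃ w c, θ w = v + d • c := fun v => by
    obtain ⟨_, ⟨w, rfl⟩, _, ⟨c, rfl⟩, hv⟩ := Submodule.mem_sup.mp
      (show v ∈ LinearMap.range θ ⊔ mulInt (MonoidAlgebra ℤ G) _ d from hθ ▸ Submodule.mem_top)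
    refine ⟨w, -c, ?_⟩
    rw [← hv]
    change θ w = θ w + d • c + d • -c
    rw [smul_neg, add_neg_cancel_right]
  obtain ⟨x, c, hx⟩ := key (1, 0)
  obtain ⟨y, c', hy⟩ := key (0, 1)
  refine ⟨x, y, LinearMap.fst _ _ _ ∘ₗ θ, LinearMap.snd _ _ _ ∘ₗ θ, ⟨c.1, ?_⟩, ⟨c.2, ?_⟩, c'.2, ?_⟩
  · exact congrArg Prod.fst hx
  · exact (congrArg Prod.snd hx).trans (zero_add _)
  · exact congrArg Prod.snd hy

end LocallyFree

/-! ### Making a functional surjective by a correction with values in I. -/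

section UnimodularElements

variable {G : Type u} [Group G] {P : Type u} [AddCommGroup P] [Module (MonoidAlgebra ℤ G) P]

/-- A functional vanishing at `x` that is congruent to `v ↦ μ(v) i` modulo `d`. -/
theorem exists_vanishing {R : Type u} [Ring R] [Module.Finite ℤ R] [Module R P] {d : ℤ} {x : P}
    {l μ : P →ₗ[R] R} (hl : ∃ c, l x = 1 + d • c) (hμ : ∃ c, μ x = d • c) (I : Submodule R R)
    {i : R} (hi : i ∈ I) :
    ∃ β : P →ₗ[R] R, (∀ v, β v ∈ I) ∧ β x = 0 ∧ ∀ v, ∃ c, β v = μ v * i + d • c := by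
  obtain ⟨b, hb⟩ := hl
  obtain ⟨m, hm⟩ := hμ
  obtain ⟨e, ⟨k, hk⟩, he⟩ := exists_smul_mem_of_sup d
    (LinearMap.range (LinearMap.mulLeft ℤ (l x))) fun z => by
      refine ⟨l x * z, ⟨z, rfl⟩, -(b * z), ?_⟩
      rw [hb, add_mul, one_mul, smul_mul_assoc, smul_neg, add_neg_cancel_right]
  obtain ⟨w, hw⟩ : ∃ w, l x * w = (e : R) := by
    obtain ⟨w, hw⟩ := he 1
    exact ⟨w, hw.trans (by rw [zsmul_one])⟩
  -- Since l(x) w = e and μ(x) = d m, the two terms agree at `x`. The subtracted term is divisible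
  -- by `d`, and `e` is 1 modulo `d`.
  refine ⟨e • mulRight μ i - mulRight l (w * (d • (m * i))), fun v => ?_, ?_, fun v => ?_⟩
  · refine I.sub_mem (zsmul_mem (I.smul_mem (μ v) hi) e) ?_
    have : l v * (w * d • (m * i)) = (l v * w * d * m) • i := by
      simp only [zsmul_eq_mul, smul_eq_mul, mul_assoc]
    rw [mulRight_apply, this]
    exact I.smul_mem _ hi
  · rw [LinearMap.sub_apply, LinearMap.smul_apply, mulRight_apply, mulRight_apply, ← mul_assoc, hw,
      hm, smul_mul_assoc, zsmul_eq_mul, sub_self]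
  · refine ⟨k • (μ v * i) - l v * (w * (m * i)), ?_⟩
    have he' : e = 1 + d * k := by linarith
    rw [LinearMap.sub_apply, LinearMap.smul_apply, mulRight_apply, mulRight_apply, he', add_smul,
      one_smul, mul_smul, smul_sub, mul_smul_comm, mul_smul_comm, add_sub_assoc]

/-- A map `α` that is onto modulo `2` and modulo `I` can be changed by a map into `I` so as to
become onto. -/
theorem exists_surjective_add_of_odd [Finite G] [Module.Finite (MonoidAlgebra ℤ G) P]
    [Module.Projective (MonoidAlgebra ℤ G) P] (h : 2 * Nat.card G ≤ Module.finrank ℤ P)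
    (α : P →ₗ[MonoidAlgebra ℤ G] MonoidAlgebra ℤ G)
    (I : Submodule (MonoidAlgebra ℤ G) (MonoidAlgebra ℤ G)) (hα : LinearMap.range α ⊔ I = ⊤)
    (hα₂ : LinearMap.range α ⊔ mulInt (MonoidAlgebra ℤ G) _ 2 = ⊤) :
    ∃ β : P →ₗ[MonoidAlgebra ℤ G] MonoidAlgebra ℤ G, (∀ v, β v ∈ I) ∧
      Function.Surjective (α + β) := by
  have : Module.Finite ℤ (MonoidAlgebra ℤ G) := finite_int (G := G) (M := MonoidAlgebra ℤ G)
  -- Working modulo 2 makes `d`, and later `e`, odd and hence nonzero.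
  obtain ⟨d, ⟨d', hd'⟩, hdα⟩ := exists_smul_mem_of_sup_mulInt 2 _ hα₂
  have hd0 : d ≠ 0 := by omega
  obtain ⟨x₀, y, l, μ, ⟨cx, hlx⟩, ⟨cμ, hμx⟩, hμy⟩ := exists_dual h hd0
  obtain ⟨_, ⟨z, rfl⟩, _, ⟨a, rfl⟩, hza⟩ := Submodule.mem_sup.mp
    (show (1 : MonoidAlgebra ℤ G) ∈ LinearMap.range α ⊔ mulInt _ _ 2 from hα₂ ▸ Submodule.mem_top)
  change α z + (2 : ℤ) • a = 1 at hza
  -- Chinese remainder: x is `x₀` modulo `d`, which keeps it dual to `l` and `μ`, and `z` modulo 2,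
  -- which makes α(x) congruent to 1.
  let x := x₀ + d • (z - x₀)
  have hlx' : ∃ c, l x = 1 + d • c := ⟨cx + (l z - l x₀), by
    rw [map_add, hlx, map_zsmul, map_sub, hlx, smul_add, add_assoc]⟩
  have hμx' : ∃ c, μ x = d • c := ⟨cμ + (μ z - μ x₀), by
    rw [map_add, hμx, map_zsmul, map_sub, hμx, smul_add]⟩
  have hdd : d = 1 + 2 * d' := by linarith
  have hαx : α x = 1 + (2 : ℤ) • (d' • (α z - α x₀) - a) := by
    rw [map_add, map_zsmul, map_sub, ← hza, hdd, add_smul, one_smul, mul_smul, smul_sub]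
    abel
  obtain ⟨e, ⟨e', he'⟩, heα⟩ := exists_smul_mem_of_sup_mulInt (R := MonoidAlgebra ℤ G) 2
    (Submodule.span (MonoidAlgebra ℤ G) {α x}) (by
      refine (Ideal.eq_top_iff_one _).mpr (Submodule.mem_sup.mpr ⟨α x,
        Submodule.mem_span_singleton_self _, _, ⟨-(d' • (α z - α x₀) - a), rfl⟩, ?_⟩)
      change α x + (2 : ℤ) • -(d' • (α z - α x₀) - a) = 1
      rw [hαx, smul_neg, add_neg_cancel_right])
  have he0 : e ≠ 0 := by omega
  obtain ⟨i, hi, htop⟩ := exists_mulRight_range_sup_eq_top hd0 α μ y hμy I hα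
  obtain ⟨β, hβI, hβx, hβ⟩ := exists_vanishing hlx' hμx' I hi
  obtain ⟨e₁, m, hcop, ⟨m₁, hm₁⟩, ⟨m₂, hm₂⟩, hq⟩ := exists_int_mod (d := d) he0
  have hm : m = 1 + d * m₂ := by linarith
  -- As `β` vanishes at `x`, the image contains α(x), hence e ℤG, for any multiple of `β`. Modulo
  -- `d` the factor `m` is 1 and the correction by `i` takes effect. Modulo `e₁` it is 0, and `α` is
  -- onto there because its image contains d ℤG with `d` prime to `e₁`. Each prime divisor of `e`
  -- divides `d` or `e₁`, so no prime divides all of `e`, `n₁`, `n₂`.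
  refine ⟨m • β, fun v => zsmul_mem (hβI v) m, LinearMap.range_eq_top.mp ?_⟩
  let J := LinearMap.range (α + m • β)
  change J = ⊤
  have hJ : ∀ v, α v + m • β v ∈ J := fun v => ⟨v, rfl⟩
  have hJe : ∀ v, e • v ∈ J := fun v => by
    refine (Submodule.span_singleton_le_iff_mem _ _).mpr ?_ (heα v)
    have := hJ x
    rwa [hβx, smul_zero, add_zero] at this
  obtain ⟨n₁, ⟨k₁, hn₁⟩, hJ₁⟩ := exists_smul_mem_of_sup_mulInt (R := MonoidAlgebra ℤ G) d J (by
    rw [eq_top_iff, ← htop]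
    refine sup_le ?_ le_sup_right
    rintro _ ⟨v, rfl⟩
    obtain ⟨c, hc⟩ := hβ v
    refine Submodule.mem_sup.mpr ⟨_, hJ v, _, ⟨-(c + m₂ • β v), rfl⟩, ?_⟩
    change α v + m • β v + d • -(c + m₂ • β v) = α v + μ v * i
    rw [hm, add_smul, one_smul, mul_smul, smul_neg, smul_add]
    nth_rw 1 [hc]
    abel)
  obtain ⟨n₂, ⟨k₂, hn₂⟩, hJ₂⟩ := exists_smul_mem_of_sup_mulInt (R := MonoidAlgebra ℤ G) e₁ J (by
    obtain ⟨s, t, hst⟩ := hcop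
    rw [eq_top_iff]
    rintro v -
    obtain ⟨w, hw⟩ := hdα (s • v)
    refine Submodule.mem_sup.mpr ⟨_, hJ w, _, ⟨t • v - m₁ • β w, rfl⟩, ?_⟩
    change α w + m • β w + e₁ • (t • v - m₁ • β w) = v
    rw [hw, hm₁, smul_sub, smul_smul, smul_smul, smul_smul, add_add_sub_cancel, ← add_smul,
      mul_comm d, mul_comm e₁, hst, one_smul])
  refine eq_top_of_smul_mem {e, n₁, n₂} ?_ fun q hqp => ?_
  · rintro n (rfl | rfl | rfl)
    exacts [hJe, hJ₁, hJ₂]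
  · by_contra! hall
    have h1 : (q : ℤ) ∣ e := hall e (by simp)
    have h2 : (q : ℤ) ∣ n₁ := hall n₁ (by simp)
    have h3 : (q : ℤ) ∣ n₂ := hall n₂ (by simp)
    have hq1 : ¬ (q : ℤ) ∣ 1 := (Nat.prime_iff_prime_int.mp hqp).not_dvd_one
    by_cases hqd : (q : ℤ) ∣ d
    · refine hq1 ?_
      have : (1 : ℤ) = n₁ - d * k₁ := by linarith
      exact this ▸ dvd_sub h2 (hqd.mul_right _)
    · refine hq1 ?_
      have : (1 : ℤ) = n₂ - e₁ * k₂ := by linarith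
      exact this ▸ dvd_sub h3 ((hq q hqp h1 hqd).mul_right _)

/-- A map `α` from a projective module of rank at least two that is onto modulo `I` can be changed
by a map into `I` so as to become onto. -/
theorem exists_surjective_add [Finite G] [Module.Finite (MonoidAlgebra ℤ G) P]
    [Module.Projective (MonoidAlgebra ℤ G) P] (h : 2 * Nat.card G ≤ Module.finrank ℤ P)
    (α : P →ₗ[MonoidAlgebra ℤ G] MonoidAlgebra ℤ G)
    (I : Submodule (MonoidAlgebra ℤ G) (MonoidAlgebra ℤ G)) (hα : LinearMap.range α ⊔ I = ⊤) :
    ∃ β : P →ₗ[MonoidAlgebra ℤ G] MonoidAlgebra ℤ G, (∀ v, β v ∈ I) ∧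
      Function.Surjective (α + β) := by
  have : Module.Finite ℤ (MonoidAlgebra ℤ G) := finite_int (G := G) (M := MonoidAlgebra ℤ G)
  obtain ⟨-, y, -, μ, -, -, hμy⟩ := exists_dual h two_ne_zero
  obtain ⟨i, hi, h₂⟩ := exists_mulRight_range_sup_eq_top two_ne_zero α μ y hμy I hα
  have hmem : ∀ v, mulRight μ i v ∈ I := fun v => I.smul_mem (μ v) hi
  obtain ⟨β, hβ, hs⟩ := exists_surjective_add_of_odd h (α + mulRight μ i) I (by
    rw [eq_top_iff, ← hα]
    refine sup_le ?_ le_sup_right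
    rintro _ ⟨v, rfl⟩
    exact Submodule.mem_sup.mpr ⟨_, ⟨v, rfl⟩, _, I.neg_mem (hmem v), add_neg_cancel_right _ _⟩) h₂
  exact ⟨mulRight μ i + β, fun v => I.add_mem (hmem v) (hβ v), by rwa [← add_assoc]⟩

end UnimodularElements

/-! ### Extension of scalars along a surjection, as a quotient. -/

section BaseChange

variable {R R' : Type*} [Ring R] [Ring R'] (φ : R →+* R')
variable {M M' N N' : Type*} [AddCommGroup M] [Module R M] [AddCommGroup M'] [Module R M']
  [AddCommGroup N] [Module R' N] [AddCommGroup N'] [Module R' N']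

variable (M) in
/-- The submodule `ker φ • M`. -/
def kerSMul : Submodule R M := Submodule.span R {x | ∃ (a : R) (m : M), φ a = 0 ∧ x = a • m}

variable {φ}

theorem smul_mem_kerSMul {a : R} (ha : φ a = 0) (m : M) : a • m ∈ kerSMul φ M :=
  Submodule.subset_span ⟨a, m, ha, rfl⟩

theorem map_kerSMul (g : M →ₗ[R] M') {m : M} (hm : m ∈ kerSMul φ M) : g m ∈ kerSMul φ M' := by
  refine (Submodule.span_le (p := (kerSMul φ M').comap g)).mpr ?_ hm
  rintro _ ⟨a, m, ha, rfl⟩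
  change g (a • m) ∈ kerSMul φ M'
  rw [map_smul]
  exact smul_mem_kerSMul ha _

theorem apply_eq_zero_of_mem_kerSMul (η : M →ₛₗ[φ] N) {m : M} (hm : m ∈ kerSMul φ M) : η m = 0 := by
  induction hm using Submodule.span_induction with
  | mem x h =>
    obtain ⟨a, m, ha, rfl⟩ := h
    rw [map_smulₛₗ, ha, zero_smul]
  | zero => exact map_zero η
  | add x y _ _ hx hy => rw [map_add, hx, hy, add_zero]
  | smul a x _ hx => rw [map_smulₛₗ, hx, smul_zero]

theorem smul_eq_smul_of_map_eq {a b : R} (h : φ a = φ b) (t : M ⧸ kerSMul φ M) : a • t = b • t := by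
  obtain ⟨m, rfl⟩ := Submodule.mkQ_surjective _ t
  rw [← sub_eq_zero, ← sub_smul, ← map_smul]
  exact (Submodule.Quotient.mk_eq_zero _).mpr
    (smul_mem_kerSMul (by rw [map_sub, h, sub_self]) m)

variable (M) in
/-- The action of `R'` on `M / (ker φ) M`. -/
abbrev quotientKerSMulModule (hφ : Function.Surjective φ) : Module R' (M ⧸ kerSMul φ M) where
  smul r t := Function.surjInv hφ r • t
  one_smul t := (smul_eq_smul_of_map_eq (φ := φ) (by simp [Function.surjInv_eq]) t).trans
    (one_smul R t)
  mul_smul r s t := (smul_eq_smul_of_map_eq (φ := φ) (by simp [Function.surjInv_eq]) t).trans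
    (mul_smul _ _ t)
  smul_zero r := smul_zero (Function.surjInv hφ r)
  smul_add r x y := smul_add (Function.surjInv hφ r) x y
  add_smul r s t := (smul_eq_smul_of_map_eq (φ := φ) (by simp [Function.surjInv_eq]) t).trans
    (add_smul _ _ t)
  zero_smul t := (smul_eq_smul_of_map_eq (φ := φ) (by simp [Function.surjInv_eq]) t).trans
    (zero_smul R t)

theorem quotientKerSMul_smul (hφ : Function.Surjective φ) (a : R) (t : M ⧸ kerSMul φ M) :
    (quotientKerSMulModule M hφ).smul (φ a) t = a • t :=
  smul_eq_smul_of_map_eq (φ := φ) (Function.surjInv_eq hφ (φ a)) t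

/-- A semilinear map `M → N` that identifies `N` with `M / (ker φ) M`. -/
structure IsBaseChangeMap (η : M →ₛₗ[φ] N) : Prop where
  surjective : Function.Surjective η
  mem_kerSMul : ∀ m, η m = 0 → m ∈ kerSMul φ M

namespace IsBaseChangeMap

theorem apply_eq_of_eq {η : M →ₛₗ[φ] N} (h : IsBaseChangeMap η) (ζ : M →ₛₗ[φ] N') {m m' : M}
    (hm : η m = η m') : ζ m = ζ m' := by
  rw [← sub_eq_zero, ← map_sub]
  exact apply_eq_zero_of_mem_kerSMul ζ (h.mem_kerSMul _ (by rw [map_sub, hm, sub_self]))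

/-- The linear map induced by a semilinear map. -/
def lift {η : M →ₛₗ[φ] N} (h : IsBaseChangeMap η) (hφ : Function.Surjective φ)
    (ζ : M →ₛₗ[φ] N') : N →ₗ[R'] N' where
  toFun n := ζ (Function.surjInv h.surjective n)
  map_add' x y := by
    rw [← map_add]
    exact h.apply_eq_of_eq ζ (by simp only [map_add, Function.surjInv_eq])
  map_smul' r x := by
    obtain ⟨a, rfl⟩ := hφ r
    rw [RingHom.id_apply, ← map_smulₛₗ]
    exact h.apply_eq_of_eq ζ (by simp only [map_smulₛₗ, Function.surjInv_eq])

theorem lift_apply {η : M →ₛₗ[φ] N} (h : IsBaseChangeMap η) (hφ : Function.Surjective φ)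
    (ζ : M →ₛₗ[φ] N') (m : M) : h.lift hφ ζ (η m) = ζ m :=
  h.apply_eq_of_eq ζ (Function.surjInv_eq _ _)

theorem exists_equiv {η : M →ₛₗ[φ] N} {η' : M' →ₛₗ[φ] N'} (h : IsBaseChangeMap η)
    (h' : IsBaseChangeMap η') (hφ : Function.Surjective φ) (e : M ≃ₗ[R] M') :
    Nonempty (N ≃ₗ[R'] N') := by
  refine ⟨LinearEquiv.ofLinearMap (h.lift hφ (η'.comp e.toLinearMap))
    (h'.lift hφ (η.comp e.symm.toLinearMap)) (LinearMap.ext fun n => ?_)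
    (LinearMap.ext fun n => ?_)⟩
  · obtain ⟨m, rfl⟩ := h'.surjective n
    rw [LinearMap.comp_apply, lift_apply, LinearMap.comp_apply, lift_apply]
    simp
  · obtain ⟨m, rfl⟩ := h.surjective n
    rw [LinearMap.comp_apply, lift_apply, LinearMap.comp_apply, lift_apply]
    simp

theorem comp_equiv {η : M →ₛₗ[φ] N} (h : IsBaseChangeMap η) (e : N ≃ₗ[R'] N') :
    IsBaseChangeMap (e.toLinearMap.comp η) :=
  ⟨e.surjective.comp h.surjective, fun m hm => h.mem_kerSMul m (e.map_eq_zero_iff.mp hm)⟩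

/-- The product of two semilinear maps. -/
def prodMap (η : M →ₛₗ[φ] N) (η' : M' →ₛₗ[φ] N') : (M × M') →ₛₗ[φ] (N × N') where
  toFun x := (η x.1, η' x.2)
  map_add' x y := by simp
  map_smul' a x := by simp

theorem prod {η : M →ₛₗ[φ] N} {η' : M' →ₛₗ[φ] N'} (h : IsBaseChangeMap η)
    (h' : IsBaseChangeMap η') : IsBaseChangeMap (prodMap η η') := by
  refine ⟨fun ⟨n, n'⟩ => ?_, fun ⟨m, m'⟩ hm => ?_⟩
  · obtain ⟨m, rfl⟩ := h.surjective n
    obtain ⟨m', rfl⟩ := h'.surjective n'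
    exact ⟨(m, m'), rfl⟩
  · have h1 := map_kerSMul (LinearMap.inl R M M') (h.mem_kerSMul m (congrArg Prod.fst hm))
    have h2 := map_kerSMul (LinearMap.inr R M M') (h'.mem_kerSMul m' (congrArg Prod.snd hm))
    have h3 := Submodule.add_mem _ h1 h2
    simpa using h3

/-- The semilinear map `R ^ ι → R' ^ ι`. -/
def piMap (φ : R →+* R') (ι : Type*) : (ι → R) →ₛₗ[φ] (ι → R') where
  toFun x := fun j => φ (x j)
  map_add' x y := by ext; simp
  map_smul' a x := by ext; simp

theorem pi (hφ : Function.Surjective φ) (ι : Type*) [Fintype ι] : IsBaseChangeMap (piMap φ ι) := by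
  classical
  refine ⟨fun y => ⟨fun j => Function.surjInv hφ (y j), funext fun j => Function.surjInv_eq _ _⟩,
    fun x hx => ?_⟩
  rw [pi_eq_sum_univ' x]
  exact Submodule.sum_mem _ fun j _ => smul_mem_kerSMul (congrFun hx j) _

theorem finite [Module.Finite R M] {η : M →ₛₗ[φ] N} (h : IsBaseChangeMap η)
    (hφ : Function.Surjective φ) : Module.Finite R' N :=
  have : RingHomSurjective φ := ⟨hφ⟩
  Module.Finite.of_surjective η h.surjective

/-- Semilinear maps out of a projective module lift along surjections. -/
theorem exists_semilinear_lift [Module.Projective R M] (g : N →ₗ[R'] N')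
    (hg : Function.Surjective g) (ζ : M →ₛₗ[φ] N') : ∃ ξ : M →ₛₗ[φ] N, ∀ m, g (ξ m) = ζ m := by
  let _ : Module R N := Module.compHom N φ
  let _ : Module R N' := Module.compHom N' φ
  let g₀ : N →ₗ[R] N' := { toFun := g, map_add' := map_add g, map_smul' := fun a => map_smul g (φ a) }
  let ζ₀ : M →ₗ[R] N' := { toFun := ζ, map_add' := map_add ζ, map_smul' := fun a => map_smulₛₗ ζ a }
  obtain ⟨ξ, hξ⟩ := Module.projective_lifting_property g₀ ζ₀ hg
  exact ⟨{ toFun := ξ, map_add' := map_add ξ, map_smul' := fun a => map_smul ξ a },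
    fun m => LinearMap.congr_fun hξ m⟩

theorem projective [Module.Projective R M] {η : M →ₛₗ[φ] N} (h : IsBaseChangeMap η)
    (hφ : Function.Surjective φ) : Module.Projective R' N := by
  obtain ⟨ξ, hξ⟩ := exists_semilinear_lift (φ := φ) (Finsupp.linearCombination R' (id : N → N))
    (Finsupp.linearCombination_id_surjective R' N) η
  refine ⟨⟨h.lift hφ ξ, fun n => ?_⟩⟩
  obtain ⟨m, rfl⟩ := h.surjective n
  rw [lift_apply, hξ]

/-- Linear maps out of a base change are semilinear maps. -/
theorem card_hom_eq {S : Type*} [AddCommGroup S] [Module R S] [Module R' S]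
    (hS : ∀ (a : R) (s : S), φ a • s = a • s) {η : M →ₛₗ[φ] N} (h : IsBaseChangeMap η)
    (hφ : Function.Surjective φ) : Nat.card (N →ₗ[R'] S) = Nat.card (M →ₗ[R] S) :=
  Nat.card_congr
    { toFun := fun g => { toFun := g ∘ η, map_add' := by simp, map_smul' := by simp [hS] }
      invFun := fun g => h.lift hφ { toFun := g, map_add' := map_add g, map_smul' := by simp [hS] }
      left_inv := fun g => LinearMap.ext fun n => by
        obtain ⟨m, rfl⟩ := h.surjective n
        rw [lift_apply]
        rfl
      right_inv := fun g => LinearMap.ext fun m => h.lift_apply hφ (φ := φ)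
        { toFun := g, map_add' := map_add g, map_smul' := by simp [hS] } m }

end IsBaseChangeMap

end BaseChange

/-! ### Base change of (ideal) ⊗ (module). -/

section IdealTensor

variable {R : Type u} [Ring R]

/-- The relations of the tensor product of an ideal with a module. -/
def idealTensorRel (U : Ideal R) (M : Type u) [AddCommGroup M] [Module R M] :
    Submodule R (U ⊗[ℤ] M) :=
  Submodule.span R {t : U ⊗[ℤ] M | ∃ (x y : U) (a : R) (m : M),
    (y : R) = (x : R) * a ∧ t = y ⊗ₜ[ℤ] m - x ⊗ₜ[ℤ] (a • m)}

/-- The tensor product of an ideal with a module. -/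
abbrev idealTensor (U : Ideal R) (M : Type u) [AddCommGroup M] [Module R M] : Type u :=
  (U ⊗[ℤ] M) ⧸ idealTensorRel U M

section

variable (U : Ideal R) (M : Type u) [AddCommGroup M] [Module R M]

/-- The class of `x ⊗ m`. -/
def idealTmul (x : U) (m : M) : idealTensor U M := (idealTensorRel U M).mkQ (x ⊗ₜ m)

variable {U M}

theorem idealTmul_add (x : U) (m n : M) :
    idealTmul U M x (m + n) = idealTmul U M x m + idealTmul U M x n := by
  rw [idealTmul, TensorProduct.tmul_add, map_add]; rfl

theorem add_idealTmul (x y : U) (m : M) :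
    idealTmul U M (x + y) m = idealTmul U M x m + idealTmul U M y m := by
  rw [idealTmul, TensorProduct.add_tmul, map_add]; rfl

theorem smul_idealTmul (a : R) (x : U) (m : M) :
    idealTmul U M (a • x) m = a • idealTmul U M x m := by
  rw [idealTmul, ← TensorProduct.smul_tmul', map_smul]; rfl

theorem idealTmul_smul (x y : U) (a : R) (m : M) (h : (y : R) = x * a) :
    idealTmul U M x (a • m) = idealTmul U M y m := by
  refine (sub_eq_zero.mp ?_).symm
  rw [idealTmul, idealTmul, ← map_sub]
  exact (Submodule.Quotient.mk_eq_zero _).mpr (Submodule.subset_span ⟨x, y, a, m, h, rfl⟩)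

theorem idealTensor_induction {p : idealTensor U M → Prop} (t : idealTensor U M)
    (h0 : p 0) (h1 : ∀ x m, p (idealTmul U M x m)) (h2 : ∀ s t, p s → p t → p (s + t)) : p t := by
  obtain ⟨t, rfl⟩ := Submodule.mkQ_surjective _ t
  induction t with
  | zero => rwa [map_zero]
  | tmul x m => exact h1 x m
  | add s t hs ht => rw [map_add]; exact h2 _ _ hs ht

/-- A biadditive map compatible with the actions gives a semilinear map on the tensor product. -/
theorem exists_idealTensor_lift {R' : Type*} [Ring R'] {φ : R →+* R'} {T : Type*} [AddCommGroup T]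
    [Module R' T] (b : U → M → T) (h1 : ∀ x y m, b (x + y) m = b x m + b y m)
    (h2 : ∀ x m n, b x (m + n) = b x m + b x n) (h3 : ∀ (a : R) x m, b (a • x) m = φ a • b x m)
    (h4 : ∀ (x y : U) (a : R) (m : M), (y : R) = x * a → b x (a • m) = b y m) :
    ∃ ζ : idealTensor U M →ₛₗ[φ] T, ∀ x m, ζ (idealTmul U M x m) = b x m := by
  let b₀ : U →+ M →+ T := AddMonoidHom.mk'
    (fun x => AddMonoidHom.mk' (b x) (h2 x)) fun x y => AddMonoidHom.ext fun m => h1 x y m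
  let ζ₀ : U ⊗[ℤ] M →+ T := TensorProduct.liftAddHom b₀ fun r x m => by
    rw [map_zsmul, map_zsmul, AddMonoidHom.smul_apply]
  have hζ₀ : ∀ x m, ζ₀ (x ⊗ₜ m) = b x m := fun x m => rfl
  let ζ₁ : U ⊗[ℤ] M →ₛₗ[φ] T :=
    { toFun := ζ₀
      map_add' := map_add ζ₀
      map_smul' := fun a t => by
        induction t with
        | zero => rw [smul_zero, map_zero, smul_zero]
        | tmul x m => rw [TensorProduct.smul_tmul', hζ₀, hζ₀, h3]
        | add s t hs ht => rw [smul_add, map_add, hs, ht, map_add, smul_add] }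
  refine ⟨(idealTensorRel U M).liftQ ζ₁ (Submodule.span_le.mpr ?_), fun x m => rfl⟩
  rintro _ ⟨x, y, a, m, h, rfl⟩
  change ζ₀ (y ⊗ₜ[ℤ] m - x ⊗ₜ[ℤ] (a • m)) = 0
  rw [map_sub, hζ₀, hζ₀, h4 x y a m h, sub_self]

end

/-- The tensor product of base changes is a base change. -/
theorem exists_isBaseChangeMap_idealTensor {R' : Type u} [Ring R'] {φ : R →+* R'}
    (hφ : Function.Surjective φ) {U : Ideal R} (hU : ∀ x ∈ U, ∀ a, x * a ∈ U) {V : Ideal R'}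
    {τ : U →ₛₗ[φ] V} (hτ : IsBaseChangeMap τ)
    (hτ' : ∀ (x y : U) (a : R), (y : R) = x * a → (τ y : R') = τ x * φ a)
    {M N : Type u} [AddCommGroup M] [Module R M] [AddCommGroup N] [Module R' N] {η : M →ₛₗ[φ] N}
    (hη : IsBaseChangeMap η) :
    ∃ ζ : idealTensor U M →ₛₗ[φ] idealTensor V N, IsBaseChangeMap ζ := by
  obtain ⟨ζ, hζ⟩ := exists_idealTensor_lift (φ := φ) (fun (x : U) (m : M) =>
      idealTmul V N (τ x) (η m))
    (fun x y m => by rw [map_add, add_idealTmul]) (fun x m n => by rw [map_add, idealTmul_add])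
    (fun a x m => by rw [map_smulₛₗ, smul_idealTmul])
    (fun x y a m h => by rw [map_smulₛₗ, idealTmul_smul _ (τ y) _ _ (hτ' x y a h)])
  refine ⟨ζ, fun t => ?_, fun t ht => ?_⟩
  · induction t using idealTensor_induction with
    | h0 => exact ⟨0, map_zero ζ⟩
    | h1 y n =>
      obtain ⟨x, rfl⟩ := hτ.surjective y
      obtain ⟨m, rfl⟩ := hη.surjective n
      exact ⟨_, hζ x m⟩
    | h2 s t hs ht =>
      obtain ⟨s, rfl⟩ := hs
      obtain ⟨t, rfl⟩ := ht
      exact ⟨s + t, map_add ζ s t⟩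
  -- An inverse modulo `K` is defined by choosing preimages in both factors. In the second factor
  -- the choice is harmless because a scalar from ker φ moves across the tensor sign into the
  -- two-sided ideal `U`, where the argument for the first factor applies.
  let K := kerSMul φ (idealTensor U M)
  let c : U → M → idealTensor U M ⧸ K := fun x m => K.mkQ (idealTmul U M x m)
  have hc1 : ∀ x y m, c (x + y) m = c x m + c y m := fun x y m => by
    simp only [c, add_idealTmul, map_add]
  have hc2 : ∀ x m n, c x (m + n) = c x m + c x n := fun x m n => by
    simp only [c, idealTmul_add, map_add]
  have hc3 : ∀ (a : R) x m, c (a • x) m = a • c x m := fun a x m => by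
    simp only [c, smul_idealTmul, map_smul]
  have hc4 : ∀ (x y : U) (a : R) (m : M), (y : R) = x * a → c x (a • m) = c y m :=
    fun x y a m h => by simp only [c, idealTmul_smul x y a m h]
  have hK : ∀ a t, φ a = 0 → a • K.mkQ t = 0 := fun a t ha => by
    rw [← map_smul]
    exact (Submodule.Quotient.mk_eq_zero _).mpr (smul_mem_kerSMul ha t)
  have hx : ∀ x m, τ x = 0 → c x m = 0 := fun x m h => by
    let cm : U →ₗ[R] idealTensor U M ⧸ K :=
      { toFun := fun x => c x m, map_add' := fun x y => hc1 x y m, map_smul' := fun a x => hc3 a x m }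
    refine (Submodule.span_le (p := LinearMap.ker cm)).mpr ?_ (hτ.mem_kerSMul x h)
    rintro _ ⟨a, x, ha, rfl⟩
    exact (hc3 a x m).trans (hK a _ ha)
  have hm : ∀ x m, η m = 0 → c x m = 0 := fun x m h => by
    have hmem := hη.mem_kerSMul m h
    clear h
    induction hmem using Submodule.span_induction generalizing x with
    | mem m h =>
      obtain ⟨a, m, ha, rfl⟩ := h
      rw [hc4 x ⟨x * a, hU x x.2 a⟩ a m rfl]
      refine hx _ m (Subtype.ext ?_)
      rw [hτ' x ⟨x * a, hU x x.2 a⟩ a rfl, ha, mul_zero]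
      rfl
    | zero => simpa using hc2 x 0 0
    | add m n _ _ hm hn => rw [hc2, hm, hn, add_zero]
    | smul a m _ hm =>
      rw [hc4 x ⟨x * a, hU x x.2 a⟩ a m rfl]
      exact hm _
  let s := Function.surjInv hτ.surjective
  let s' := Function.surjInv hη.surjective
  have hs : ∀ y, τ (s y) = y := Function.surjInv_eq hτ.surjective
  have hs' : ∀ n, η (s' n) = n := Function.surjInv_eq hη.surjective
  have hcx : ∀ x x' m, τ x = τ x' → c x m = c x' m := fun x x' m h => by
    have := hx (x - x') m (by rw [map_sub, h, sub_self])
    have h2 := hc1 (x - x') x' m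
    rwa [this, sub_add_cancel, zero_add] at h2
  have hcm : ∀ x m m', η m = η m' → c x m = c x m' := fun x m m' h => by
    have := hm x (m - m') (by rw [map_sub, h, sub_self])
    have h2 := hc2 x (m - m') m'
    rwa [this, sub_add_cancel, zero_add] at h2
  let _ : Module R' (idealTensor U M ⧸ K) := quotientKerSMulModule _ hφ
  have hsmul : ∀ a (t : idealTensor U M ⧸ K), φ a • t = a • t := quotientKerSMul_smul hφ
  obtain ⟨B, hB⟩ := exists_idealTensor_lift (U := V) (M := N) (φ := RingHom.id R')
    (fun y n => c (s y) (s' n))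
    (fun x y m => by
      rw [← hc1]
      exact hcx _ _ _ (by simp only [map_add, hs]))
    (fun x m n => by
      rw [← hc2]
      exact hcm _ _ _ (by simp only [map_add, hs']))
    (fun r x m => by
      obtain ⟨a, rfl⟩ := hφ r
      rw [RingHom.id_apply, hsmul, ← hc3]
      exact hcx _ _ _ (by simp only [map_smulₛₗ, hs]))
    (fun x y r m h => by
      obtain ⟨a, rfl⟩ := hφ r
      rw [hcm _ (s' (φ a • m)) (a • s' m) (by simp only [map_smulₛₗ, hs']),
        hc4 (s x) ⟨s x * a, hU _ (s x).2 a⟩ a _ rfl]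
      refine hcx _ _ _ (Subtype.ext ?_)
      rw [hτ' (s x) ⟨s x * a, hU _ (s x).2 a⟩ a rfl, hs, hs, h])
  have hBζ : ∀ w, B (ζ w) = K.mkQ w := fun w => by
    induction w using idealTensor_induction with
    | h0 => simp
    | h1 x m =>
      rw [hζ, hB]
      exact (hcx _ _ _ (hs _)).trans (hcm _ _ _ (hs' _))
    | h2 s t hs ht => rw [map_add, map_add, hs, ht, map_add]
  refine (Submodule.Quotient.mk_eq_zero K).mp ?_
  rw [← Submodule.mkQ_apply, ← hBζ, ht, map_zero]

end IdealTensor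

/-! ### The ideals (I, r) under ℤG → ℤH. -/

section Augmentation

variable {G H : Type u} [Group G] [Group H]

theorem augmentation_gp (g : G) : augmentation G (gp g) = 1 := by
  change MonoidAlgebra.lift ℤ ℤ G (1 : G →* ℤ) (MonoidAlgebra.of ℤ G g) = 1
  rw [MonoidAlgebra.lift_of]
  rfl

theorem ringMap_gp (f : G →* H) (g : G) : ringMap f (gp g) = gp (f g) := by
  simp [gp, ringMap]

theorem groupRing_induction {p : GroupRing G → Prop} (x : GroupRing G) (h1 : ∀ g, p (gp g))
    (h2 : ∀ x y, p x → p y → p (x + y)) (h3 : ∀ (n : ℤ) x, p x → p (n • x)) : p x := by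
  induction x using MonoidAlgebra.induction_on with
  | of g => exact h1 g
  | add x y hx hy => exact h2 x y hx hy
  | smul n x hx => exact h3 n x hx

theorem ringMap_surjective {f : G →* H} (hf : Function.Surjective f) :
    Function.Surjective (ringMap f) := fun y => by
  induction y using groupRing_induction with
  | h1 h =>
    obtain ⟨g, rfl⟩ := hf h
    exact ⟨gp g, ringMap_gp f g⟩
  | h2 x y hx hy =>
    obtain ⟨x, rfl⟩ := hx
    obtain ⟨y, rfl⟩ := hy
    exact ⟨x + y, map_add _ x y⟩
  | h3 n x hx =>
    obtain ⟨x, rfl⟩ := hx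
    exact ⟨n • x, map_zsmul _ n x⟩

theorem augmentation_ringMap (f : G →* H) (x : GroupRing G) :
    augmentation H (ringMap f x) = augmentation G x := by
  induction x using groupRing_induction with
  | h1 g => rw [ringMap_gp, augmentation_gp, augmentation_gp]
  | h2 x y hx hy => rw [map_add, map_add, map_add, hx, hy]
  | h3 n x hx => rw [map_zsmul, map_zsmul, map_zsmul, hx]

theorem mem_swanIdeal_iff {r : ℤ} {x : GroupRing G} :
    x ∈ swanIdeal G r ↔ r ∣ augmentation G x := by
  constructor
  · intro h
    obtain ⟨y, hy, z, hz, rfl⟩ := Submodule.mem_sup.mp h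
    obtain ⟨a, rfl⟩ := Submodule.mem_span_singleton.mp hz
    rw [map_add, RingHom.mem_ker.mp hy, zero_add, smul_eq_mul, map_mul, map_intCast]
    exact dvd_mul_left r _
  · rintro ⟨c, hc⟩
    rw [← sub_add_cancel x ((c : GroupRing G) • (r : GroupRing G))]
    refine Submodule.add_mem_sup ?_ (Submodule.smul_mem _ _ (Submodule.mem_span_singleton_self _))
    rw [RingHom.mem_ker, map_sub, smul_eq_mul, map_mul, map_intCast, map_intCast, hc]
    simp only [Int.cast_id]
    ring

theorem mul_mem_swanIdeal {r : ℤ} {x : GroupRing G} (hx : x ∈ swanIdeal G r) (a : GroupRing G) :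
    x * a ∈ swanIdeal G r := by
  rw [mem_swanIdeal_iff, map_mul]
  exact (mem_swanIdeal_iff.mp hx).mul_right _

variable (G) in
/-- The norm element. -/
def normElement [Fintype G] : GroupRing G := ∑ g, gp g

theorem mul_normElement [Fintype G] (x : GroupRing G) :
    x * normElement G = augmentation G x • normElement G := by
  induction x using groupRing_induction with
  | h1 g =>
    rw [augmentation_gp, one_smul, normElement, Finset.mul_sum]
    exact Fintype.sum_equiv (Equiv.mulLeft g) _ _ fun h => (gp_mul g h).symm
  | h2 x y hx hy => rw [add_mul, hx, hy, map_add, add_smul]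
  | h3 n x hx => rw [smul_mul_assoc, hx, map_zsmul, smul_assoc]

theorem normElement_mul [Fintype G] (x : GroupRing G) :
    normElement G * x = augmentation G x • normElement G := by
  induction x using groupRing_induction with
  | h1 g =>
    rw [augmentation_gp, one_smul, normElement, Finset.sum_mul]
    exact Fintype.sum_equiv (Equiv.mulRight g) _ _ fun h => (gp_mul h g).symm
  | h2 x y hx hy => rw [mul_add, hx, hy, map_add, add_smul]
  | h3 n x hx => rw [mul_smul_comm, hx, map_zsmul, smul_assoc]

theorem augmentation_normElement [Fintype G] :
    augmentation G (normElement G) = Nat.card G := by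
  rw [normElement, map_sum, Finset.sum_congr rfl fun g _ => augmentation_gp g]
  simp

/-- Elements of the kernel of `ℤG → ℤH` are killed by the norm of the kernel of `G → H`. -/
theorem sum_ker_mul_eq_zero {f : G →* H} (hf : Function.Surjective f) [Fintype f.ker]
    {x : GroupRing G} (hx : ringMap f x = 0) : ∑ k : f.ker, gp (k : G) * x = 0 := by
  let s := Function.surjInv hf
  -- The sum depends only on the image of `x`, because `g` and the chosen lift of f(g) lie in the
  -- same coset of the kernel.
  have key : ∀ x : GroupRing G, ∑ k : f.ker, gp (k : G) * x =
      ∑ k : f.ker, gp (k : G) * MonoidAlgebra.mapDomain s (ringMap f x) := by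
    intro x
    induction x using groupRing_induction with
    | h1 g =>
      have h1 : MonoidAlgebra.mapDomain s (ringMap f (gp g)) = gp (s (f g)) := by
        rw [ringMap_gp]
        simp [gp]
      have h2 : f (s (f g)) = f g := Function.surjInv_eq hf _
      rw [h1]
      refine (Fintype.sum_equiv (Equiv.mulRight (⟨g * (s (f g))⁻¹, by
        rw [MonoidHom.mem_ker, map_mul, map_inv, h2, mul_inv_cancel]⟩ : f.ker)) _ _
        fun k => ?_)
      rw [← gp_mul, ← gp_mul]
      simp [mul_assoc]
    | h2 x y hx hy =>
      simp only [mul_add, Finset.sum_add_distrib, map_add, MonoidAlgebra.mapDomain_add, hx, hy]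
    | h3 n x hx =>
      have h1 : MonoidAlgebra.mapDomain s (n • ringMap f x) =
        n • MonoidAlgebra.mapDomain s (ringMap f x) :=
          map_zsmul (AddMonoidHom.mk' (MonoidAlgebra.mapDomain s)
            fun a b => MonoidAlgebra.mapDomain_add ..) n (ringMap f x)
      rw [map_zsmul, h1]
      simp only [mul_smul_comm, ← Finset.smul_sum, hx]
  rw [key, hx]
  simp

/-- Both r x and |ker f| x lie in the submodule: the first is x acting on the element r of (I, r),
the second is ∑ (1 - k) x over the kernel of `f`. Coprimality then gives x itself. -/
theorem mem_kerSMul_swanIdeal {f : G →* H} [Finite f.ker] (hf : Function.Surjective f) {r : ℤ}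
    (hr : IsCoprime r (Nat.card f.ker)) (x : swanIdeal G r) (hx : ringMap f x = 0) :
    x ∈ kerSMul (ringMap f) (swanIdeal G r) := by
  have := Fintype.ofFinite f.ker
  obtain ⟨a, b, hab⟩ := hr
  have h1 : r • x ∈ kerSMul (ringMap f) (swanIdeal G r) := by
    have : r • x = (x : GroupRing G) •
        (⟨(r : GroupRing G), Ideal.mem_sup_right (Ideal.subset_span rfl)⟩ : swanIdeal G r) := by
      refine Subtype.ext ?_
      change r • (x : GroupRing G) = (x : GroupRing G) * r
      rw [zsmul_eq_mul, (Int.cast_commute r (x : GroupRing G)).eq]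
    rw [this]
    exact smul_mem_kerSMul hx _
  have h2 : (Nat.card f.ker : ℤ) • x ∈ kerSMul (ringMap f) (swanIdeal G r) := by
    have : (Nat.card f.ker : ℤ) • x = ∑ k : f.ker, (1 - gp (k : G)) • x := by
      refine Subtype.ext ?_
      rw [AddSubmonoidClass.coe_finsetSum]
      change (Nat.card f.ker : ℤ) • (x : GroupRing G) =
        ∑ k : f.ker, (1 - gp (k : G)) * (x : GroupRing G)
      simp only [sub_mul, one_mul, Finset.sum_sub_distrib, sum_ker_mul_eq_zero hf hx, sub_zero,
        Finset.sum_const, Finset.card_univ, Nat.card_eq_fintype_card, natCast_zsmul]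
    rw [this]
    refine Submodule.sum_mem _ fun k _ => smul_mem_kerSMul ?_ x
    rw [map_sub, map_one, ringMap_gp, MonoidHom.mem_ker.mp k.2, gp_one, sub_self]
  have h3 : x = a • r • x + b • (Nat.card f.ker : ℤ) • x := by
    rw [smul_smul, smul_smul, ← add_smul, hab, one_smul]
  rw [h3]
  exact Submodule.add_mem _ (zsmul_mem h1 a) (zsmul_mem h2 b)

/-- `(I_G, r) → (I_H, r')` is a base change when `r` and `r'` agree modulo `|H|`. -/
theorem exists_isBaseChangeMap_swanIdeal [Finite G] {f : G →* H} (hf : Function.Surjective f)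
    {r r' : ℤ} (hr0 : r ≠ 0) (hr0' : r' ≠ 0) (hr : IsCoprime r (Nat.card f.ker))
    (hrr : (Nat.card H : ℤ) ∣ r' - r) :
    ∃ τ : swanIdeal G r →ₛₗ[ringMap f] swanIdeal H r', IsBaseChangeMap τ ∧
      ∀ (x y : swanIdeal G r) (a : GroupRing G), (y : GroupRing G) = x * a →
        (τ y : GroupRing H) = τ x * ringMap f a := by
  have := Finite.of_surjective f hf
  have := Fintype.ofFinite H
  obtain ⟨k, hk⟩ := hrr
  let c : swanIdeal G r → ℤ := fun x => augmentation G x / r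
  have hc : ∀ x : swanIdeal G r, augmentation G x = r * c x := fun x =>
    (Int.mul_ediv_cancel' (mem_swanIdeal_iff.mp x.2)).symm
  have hc_eq : ∀ (x : swanIdeal G r) (n : ℤ), augmentation G x = r * n → c x = n := fun x n h =>
    mul_left_cancel₀ hr0 ((hc x).symm.trans h)
  -- The map of group rings lands in (I, r), while the target is (I, r') with r' = r + k|H|. The
  -- multiple of the norm raises the augmentation from r c to r' c. Since the norm absorbs scalars
  -- through the augmentation, the map stays compatible with both multiplications.
  let τ₀ : swanIdeal G r → GroupRing H := fun x => ringMap f x + (k * c x) • normElement H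
  have haug : ∀ x, augmentation H (τ₀ x) = r' * c x := fun x => by
    rw [map_add, augmentation_ringMap, map_zsmul, augmentation_normElement, hc, smul_eq_mul,
      show r' = r + Nat.card H * k by linarith]
    ring
  let τ : swanIdeal G r →ₛₗ[ringMap f] swanIdeal H r' :=
    { toFun := fun x => ⟨τ₀ x, mem_swanIdeal_iff.mpr (haug x ▸ dvd_mul_right _ _)⟩
      map_add' := fun x y => Subtype.ext (by
        have : c (x + y) = c x + c y := hc_eq _ _ (by
          change augmentation G ((x : GroupRing G) + y) = _
          rw [map_add, hc, hc, mul_add])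
        change ringMap f ((x : GroupRing G) + y) + (k * c (x + y)) • normElement H = τ₀ x + τ₀ y
        rw [this, map_add, mul_add, add_smul, add_add_add_comm])
      map_smul' := fun a x => Subtype.ext (by
        have : c (a • x) = augmentation G a * c x := hc_eq _ _ (by
          change augmentation G (a * (x : GroupRing G)) = _
          rw [map_mul, hc, mul_left_comm])
        change ringMap f (a * (x : GroupRing G)) + (k * c (a • x)) • normElement H =
          ringMap f a * τ₀ x
        rw [this, map_mul, mul_add, mul_smul_comm, mul_normElement, augmentation_ringMap,
          smul_smul, mul_left_comm, mul_comm (augmentation G a), mul_assoc]) }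
  refine ⟨τ, ⟨fun y => ?_, fun x hx => ?_⟩, fun x y a h => ?_⟩
  · obtain ⟨n, hn⟩ := mem_swanIdeal_iff.mp y.2
    obtain ⟨x, hx⟩ := ringMap_surjective hf (y - (k * n) • normElement H)
    have hx' : augmentation G x = r * n := by
      rw [← augmentation_ringMap f, hx, map_sub, map_zsmul, augmentation_normElement, hn,
        smul_eq_mul, show r' = r + Nat.card H * k by linarith]
      ring
    let x' : swanIdeal G r := ⟨x, mem_swanIdeal_iff.mpr ⟨n, hx'⟩⟩
    refine ⟨x', Subtype.ext ?_⟩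
    change ringMap f x + (k * c x') • normElement H = y
    rw [hx, hc_eq x' n hx', sub_add_cancel]
  · have h0 : τ₀ x = 0 := congrArg Subtype.val hx
    have h1 : c x = 0 := by
      have h2 := haug x
      rw [h0, map_zero] at h2
      exact (mul_eq_zero.mp h2.symm).resolve_left hr0'
    refine mem_kerSMul_swanIdeal hf hr x ?_
    have h3 : ringMap f x + (k * c x) • normElement H = 0 := h0
    rwa [h1, mul_zero, zero_smul, add_zero] at h3
  · have hcy : c y = c x * augmentation G a := hc_eq _ _ (by rw [h, map_mul, hc, mul_assoc])
    change ringMap f y + (k * c y) • normElement H = τ₀ x * ringMap f a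
    rw [hcy, h, map_mul, add_mul, smul_mul_assoc, normElement_mul, augmentation_ringMap, smul_smul,
      mul_assoc]

end Augmentation

/-! ### Integer representatives of units modulo n. -/

section Residues

theorem cast_posRep {n : ℕ} (hn : n ≠ 0) (r : (ZMod n)ˣ) : ((posRep r : ℤ) : ZMod n) = r := by
  have : NeZero n := ⟨hn⟩
  rw [posRep]
  rcases Nat.eq_zero_or_pos (r : ZMod n).val with h | h
  · have h0 : (r : ZMod n) = 0 := (ZMod.val_eq_zero _).mp h
    have : Subsingleton (ZMod n) := subsingleton_of_zero_eq_one (by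
      rw [← r.mul_inv, h0, zero_mul])
    exact Subsingleton.elim _ _
  · rw [max_eq_right h, Int.cast_natCast, ZMod.natCast_zmod_val]

theorem isCoprime_posRep {n : ℕ} (hn : n ≠ 0) (r : (ZMod n)ˣ) : IsCoprime (posRep r) (n : ℤ) := by
  have h := r.isUnit
  rw [← cast_posRep hn r] at h
  exact ((ZMod.coe_int_isUnit_iff_isCoprime _ _).mp h).symm

end Residues

/-! ### Extension of scalars of ℤG-modules and its compatibilities. -/

section ScalarExtension

variable {G H : Type u} [Group G] [Group H] {f : G →* H}

/-- `N` is the extension of scalars of `M` along `f`. -/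
def IsExtension (f : G →* H) (M : ModuleCat.{u} (GroupRing G)) (N : ModuleCat.{u} (GroupRing H)) :
    Prop :=
  ∃ η : M →ₛₗ[ringMap f] N, IsBaseChangeMap η

theorem isExtension_extendScalars (hf : Function.Surjective f) (M : ModuleCat.{u} (GroupRing G)) :
    IsExtension f M (extendScalars f M) := by
  let rel : Submodule (GroupRing H) (GroupRing H ⊗[ℤ] M) := Submodule.span (GroupRing H)
      {t : GroupRing H ⊗[ℤ] M | ∃ (x : GroupRing H) (a : GroupRing G) (m : M),
        t = (x * ringMap f a) ⊗ₜ[ℤ] m - x ⊗ₜ[ℤ] (a • m)}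
  have hrel : ∀ (x : GroupRing H) (a : GroupRing G) (m : M),
      rel.mkQ ((x * ringMap f a) ⊗ₜ[ℤ] m) = rel.mkQ (x ⊗ₜ[ℤ] (a • m)) := fun x a m => by
    rw [← sub_eq_zero, ← map_sub]
    exact (Submodule.Quotient.mk_eq_zero _).mpr (Submodule.subset_span ⟨x, a, m, rfl⟩)
  let η : M →ₛₗ[ringMap f] (GroupRing H ⊗[ℤ] M) ⧸ rel :=
    { toFun := fun m => rel.mkQ (1 ⊗ₜ m)
      map_add' := fun m n => by rw [TensorProduct.tmul_add, map_add]
      map_smul' := fun a m => by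
        rw [← hrel, one_mul, ← map_smul, TensorProduct.smul_tmul', smul_eq_mul, mul_one] }
  suffices hη : IsBaseChangeMap η from ⟨η, hη⟩
  refine ⟨fun t => ?_, fun m hm => ?_⟩
  · obtain ⟨t, rfl⟩ := rel.mkQ_surjective t
    induction t with
    | zero => exact ⟨0, by rw [map_zero, map_zero]⟩
    | tmul x m =>
      obtain ⟨a, rfl⟩ := ringMap_surjective hf x
      refine ⟨a • m, ?_⟩
      change rel.mkQ (1 ⊗ₜ (a • m)) = _
      rw [← hrel, one_mul]
    | add s t hs ht =>
      obtain ⟨m, hm⟩ := hs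
      obtain ⟨n, hn⟩ := ht
      exact ⟨m + n, by rw [map_add, map_add, hm, hn]⟩
  let K := kerSMul (ringMap f) M
  let _ : Module (GroupRing H) (M ⧸ K) := quotientKerSMulModule M (ringMap_surjective hf)
  have hsmul : ∀ a (t : M ⧸ K), ringMap f a • t = a • t :=
    quotientKerSMul_smul (ringMap_surjective hf)
  let B₀ : GroupRing H ⊗[ℤ] M →+ M ⧸ K := TensorProduct.liftAddHom
    (AddMonoidHom.mk' (fun x => AddMonoidHom.mk' (fun m => x • K.mkQ m)
      fun m n => by rw [map_add, smul_add]) fun x y => AddMonoidHom.ext fun m => add_smul x y _)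
    fun r x m => by
      change (r • x) • K.mkQ m = x • K.mkQ (r • m)
      rw [map_zsmul, smul_assoc, smul_comm]
  have hB₀ : ∀ x m, B₀ (x ⊗ₜ m) = x • K.mkQ m := fun x m => rfl
  let B₁ : GroupRing H ⊗[ℤ] M →ₗ[GroupRing H] M ⧸ K :=
    { toFun := B₀
      map_add' := map_add B₀
      map_smul' := fun a t => by
        rw [RingHom.id_apply]
        induction t with
        | zero => rw [smul_zero, map_zero, smul_zero]
        | tmul x m => rw [TensorProduct.smul_tmul', hB₀, hB₀, smul_eq_mul, mul_smul]
        | add s t hs ht => rw [smul_add, map_add, hs, ht, map_add, smul_add] }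
  have hle : rel ≤ LinearMap.ker B₁ := by
    refine Submodule.span_le.mpr ?_
    rintro _ ⟨x, a, m, rfl⟩
    change B₀ ((x * ringMap f a) ⊗ₜ[ℤ] m - x ⊗ₜ[ℤ] (a • m)) = 0
    rw [map_sub, hB₀, hB₀, mul_smul, hsmul, ← map_smul, sub_self]
  have h1 : rel.liftQ B₁ hle (η m) = K.mkQ m := one_smul (GroupRing H) (K.mkQ m)
  rw [hm, map_zero] at h1
  exact (Submodule.Quotient.mk_eq_zero K).mp h1.symm

namespace IsExtension

variable {M M' : ModuleCat.{u} (GroupRing G)} {N N' : ModuleCat.{u} (GroupRing H)}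

theorem iso (h : IsExtension f M N) (h' : IsExtension f M' N') (hf : Function.Surjective f)
    (e : Iso M M') : Iso N N' := by
  obtain ⟨η, hη⟩ := h
  obtain ⟨η', hη'⟩ := h'
  obtain ⟨e⟩ := e
  exact hη.exists_equiv hη' (ringMap_surjective hf) e

theorem addFree (h : IsExtension f M N) (hf : Function.Surjective f) (i : ℕ) :
    IsExtension f (addFree M i) (addFree N i) := by
  obtain ⟨η, hη⟩ := h
  exact ⟨_, hη.prod (IsBaseChangeMap.pi (ringMap_surjective hf) (Fin i))⟩

theorem sum (h : IsExtension f M N) (h' : IsExtension f M' N') :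
    IsExtension f (sum M M') (sum N N') := by
  obtain ⟨η, hη⟩ := h
  obtain ⟨η', hη'⟩ := h'
  exact ⟨_, hη.prod hη'⟩

theorem ringMap_twist {θ : MulAut G} {θ' : MulAut H} (hθ : ∀ g, θ' (f g) = f (θ g))
    (a : GroupRing G) :
    ringMap f (ringMap θ.toMonoidHom a) = ringMap θ'.toMonoidHom (ringMap f a) := by
  induction a using groupRing_induction with
  | h1 g =>
    rw [ringMap_gp, ringMap_gp, ringMap_gp, ringMap_gp]
    exact congrArg _ (hθ g).symm
  | h2 x y hx hy => simp only [map_add, hx, hy]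
  | h3 n x hx => simp only [map_zsmul, hx]

theorem ringMap_inv (θ : MulAut G) (a : GroupRing G) :
    ringMap θ.toMonoidHom (ringMap (θ⁻¹ : MulAut G).toMonoidHom a) = a := by
  induction a using groupRing_induction with
  | h1 g =>
    rw [ringMap_gp, ringMap_gp]
    exact congrArg _ (MulAut.apply_inv_self G θ g)
  | h2 x y hx hy => simp only [map_add, hx, hy]
  | h3 n x hx => simp only [map_zsmul, hx]

/-- The identity map `M → M_θ`. -/
def toTwist (θ : MulAut G) (M : ModuleCat.{u} (GroupRing G)) : M ≃+ StableTree.twist θ M :=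
  AddEquiv.refl M

theorem toTwist_smul (θ : MulAut G) (a : GroupRing G) (m : M) :
    toTwist θ M (ringMap θ.toMonoidHom a • m) = a • toTwist θ M m := rfl

theorem smul_toTwist (θ : MulAut G) (a : GroupRing G) (m : M) :
    toTwist θ M (a • m) = ringMap (θ⁻¹ : MulAut G).toMonoidHom a • toTwist θ M m := by
  rw [← toTwist_smul, ringMap_inv]

theorem twist (h : IsExtension f M N) {θ : MulAut G} {θ' : MulAut H}
    (hθ : ∀ g, θ' (f g) = f (θ g)) : IsExtension f (twist θ M) (twist θ' N) := by
  obtain ⟨η, hη⟩ := h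
  let η' : StableTree.twist θ M →ₛₗ[ringMap f] StableTree.twist θ' N :=
    { toFun := fun m => toTwist θ' N (η ((toTwist θ M).symm m))
      map_add' := fun m n => by rw [map_add, map_add, map_add]
      map_smul' := fun a m => by
        obtain ⟨m, rfl⟩ := (toTwist θ M).surjective m
        rw [← toTwist_smul, AddEquiv.symm_apply_apply, AddEquiv.symm_apply_apply, map_smulₛₗ,
          ringMap_twist hθ, toTwist_smul] }
  have hθ' : ∀ g, θ'⁻¹ (f g) = f (θ⁻¹ g) := fun g => by
    rw [MulAut.inv_apply, MulEquiv.symm_apply_eq, hθ, MulAut.apply_inv_self]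
  -- Since θ⁻¹ is also compatible with an automorphism of `H`, it preserves the kernel of ℤG → ℤH.
  have key : ∀ m ∈ kerSMul (ringMap f) M,
      toTwist θ M m ∈ kerSMul (ringMap f) (StableTree.twist θ M) := fun m hm => by
    induction hm using Submodule.span_induction with
    | mem x hx =>
      obtain ⟨a, m, ha, rfl⟩ := hx
      rw [smul_toTwist]
      exact smul_mem_kerSMul (by rw [ringMap_twist hθ', ha, map_zero]) _
    | zero => exact Submodule.zero_mem _
    | add x y _ _ hx hy => exact Submodule.add_mem _ hx hy
    | smul a x _ hx =>
      rw [smul_toTwist]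
      exact Submodule.smul_mem _ _ hx
  exact ⟨η', hη.surjective, fun m hm => key m (hη.mem_kerSMul m hm)⟩

theorem finite (h : IsExtension f M N) (hf : Function.Surjective f)
    (hM : Module.Finite (GroupRing G) M) : Module.Finite (GroupRing H) N := by
  obtain ⟨η, hη⟩ := h
  exact hη.finite (ringMap_surjective hf)

theorem projective (h : IsExtension f M N) (hf : Function.Surjective f)
    (hM : Module.Projective (GroupRing G) M) : Module.Projective (GroupRing H) N := by
  obtain ⟨η, hη⟩ := h
  exact hη.projective (ringMap_surjective hf)

/-- The chosen representative of r modulo |G| and that of its reduction modulo |H| agree only modulo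
|H|. Hence the need for a base change between ideals with different integers. -/
theorem swan_data [Finite G] (hf : Function.Surjective f) (r : (ZMod (Nat.card G))ˣ) :
    ∃ τ : swanIdeal G (posRep r) →ₛₗ[ringMap f] swanIdeal H (posRep (reduceUnits f hf r)),
      IsBaseChangeMap τ ∧ ∀ (x y : swanIdeal G (posRep r)) (a : GroupRing G),
        (y : GroupRing G) = x * a → (τ y : GroupRing H) = τ x * ringMap f a := by
  have := Finite.of_surjective f hf
  refine exists_isBaseChangeMap_swanIdeal hf (posRep_ne_zero _) (posRep_ne_zero _) ?_ ?_
  · refine (isCoprime_posRep Nat.card_pos.ne' r).of_isCoprime_of_dvd_right ?_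
    exact_mod_cast Subgroup.card_subgroup_dvd_card f.ker
  · rw [← ZMod.intCast_zmod_eq_zero_iff_dvd, Int.cast_sub, cast_posRep Nat.card_pos.ne',
      sub_eq_zero]
    have h1 := congrArg (ZMod.castHom (Subgroup.card_dvd_of_surjective f hf)
      (ZMod (Nat.card H))) (cast_posRep (Nat.card_pos (α := G)).ne' r)
    rw [map_intCast] at h1
    exact h1.symm

theorem swanIdeal [Finite G] (hf : Function.Surjective f) (r : (ZMod (Nat.card G))ˣ) :
    IsExtension f (ModuleCat.of (GroupRing G) (swanIdeal G (posRep r)))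
      (ModuleCat.of (GroupRing H) (swanIdeal H (posRep (reduceUnits f hf r)))) := by
  obtain ⟨τ, hτ, -⟩ := swan_data hf r
  exact ⟨τ, hτ⟩

theorem swanTensor [Finite G] (h : IsExtension f M N) (hf : Function.Surjective f)
    (r : (ZMod (Nat.card G))ˣ) :
    IsExtension f (swanTensor (posRep r) M) (swanTensor (posRep (reduceUnits f hf r)) N) := by
  obtain ⟨η, hη⟩ := h
  obtain ⟨τ, hτ, hτ'⟩ := swan_data hf r
  exact exists_isBaseChangeMap_idealTensor (ringMap_surjective hf)
    (fun x hx a => mul_mem_swanIdeal hx a) hτ hτ' hη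

end IsExtension

variable (G) in
/-- The trivial module `𝔽₂`. -/
abbrev trivialModule : Module (GroupRing G) (ZMod 2) :=
  Module.compHom (ZMod 2) (augmentation G)

/-- The trivial module over ℤG is the restriction of the one over ℤH, so a single test module
compares the ranks of a module and of its extension. -/
theorem card_hom_trivial_pow [Finite G] (M : Type u) [AddCommGroup M] [Module (GroupRing G) M]
    [Module.Finite (GroupRing G) M] [Module.Projective (GroupRing G) M] :
    letI := trivialModule G
    Nat.card (M →ₗ[GroupRing G] ZMod 2) ^ Nat.card G = 2 ^ Module.finrank ℤ M := by
  let _ := trivialModule G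
  have : Fact (Nat.Prime 2) := ⟨Nat.prime_two⟩
  have h := card_hom_pow (G := G) (P := M) (S := ZMod 2) 2
  rwa [Nat.card_zmod] at h

/-- The rank of a projective module over the group ring is divisible by the order of the group. -/
theorem card_dvd_finrank [Finite G] (M : Type u) [AddCommGroup M] [Module (GroupRing G) M]
    [Module.Finite (GroupRing G) M] [Module.Projective (GroupRing G) M] :
    Nat.card G ∣ Module.finrank ℤ M := by
  let _ := trivialModule G
  have h := card_hom_trivial_pow (G := G) M
  obtain ⟨k, -, hk⟩ := (Nat.dvd_prime_pow Nat.prime_two).mp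
    (h ▸ dvd_pow_self _ (Nat.card_pos (α := G)).ne')
  rw [hk, ← pow_mul] at h
  exact ⟨k, (mul_comm _ _).trans (Nat.pow_right_injective le_rfl h) |>.symm⟩

theorem IsExtension.finrank_mul_card [Finite G] {M : ModuleCat.{u} (GroupRing G)}
    {N : ModuleCat.{u} (GroupRing H)} (h : IsExtension f M N) (hf : Function.Surjective f)
    (hM : Module.Finite (GroupRing G) M) (hM' : Module.Projective (GroupRing G) M) :
    Module.finrank ℤ N * Nat.card G = Module.finrank ℤ M * Nat.card H := by
  have := Finite.of_surjective f hf
  have := h.finite hf hM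
  have := h.projective hf hM'
  obtain ⟨η, hη⟩ := h
  let _ := trivialModule G
  let _ := trivialModule H
  have h1 := card_hom_trivial_pow (G := G) M
  have h2 := card_hom_trivial_pow (G := H) N
  have hS : ∀ (a : GroupRing G) (s : ZMod 2), ringMap f a • s = a • s := fun a s => by
    change augmentation H (ringMap f a) • s = augmentation G a • s
    rw [augmentation_ringMap]
  rw [hη.card_hom_eq hS (ringMap_surjective hf)] at h2
  refine Nat.pow_right_injective (le_refl 2) ?_
  change 2 ^ (Module.finrank ℤ N * Nat.card G) = 2 ^ (Module.finrank ℤ M * Nat.card H)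
  rw [pow_mul, pow_mul, ← h1, ← h2, ← pow_mul, ← pow_mul, mul_comm]

end ScalarExtension

/-! ### Bookkeeping for free summands. -/

section IsoLemmas

variable {R : Type u} [Ring R] {M N L : ModuleCat.{u} R}

theorem Iso.rfl : Iso M M := ⟨LinearEquiv.refl R M⟩

theorem Iso.symm (h : Iso M N) : Iso N M := by
  obtain ⟨e⟩ := h
  exact ⟨e.symm⟩

theorem Iso.trans (h : Iso M N) (h' : Iso N L) : Iso M L := by
  obtain ⟨e⟩ := h
  obtain ⟨e'⟩ := h'
  exact ⟨e.trans e'⟩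

theorem Iso.addFree_congr (h : Iso M N) (i : ℕ) : Iso (addFree M i) (addFree N i) := by
  obtain ⟨e⟩ := h
  exact ⟨e.prodCongr (LinearEquiv.refl R (Fin i → R))⟩

theorem addFree_zero_iso (M : ModuleCat.{u} R) : Iso (addFree M 0) M :=
  ⟨(LinearEquiv.prodUnique : (M × (Fin 0 → R)) ≃ₗ[R] M)⟩

theorem addFree_addFree_iso (M : ModuleCat.{u} R) (i j : ℕ) :
    Iso (addFree (addFree M i) j) (addFree M (i + j)) := by
  let a : ((Fin i → R) × (Fin j → R)) ≃ₗ[R] (Fin (i + j) → R) :=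
    (LinearEquiv.sumArrowLequivProdArrow (Fin i) (Fin j) R R).symm.trans
      (LinearEquiv.funCongrLeft R R finSumFinEquiv.symm)
  exact ⟨(LinearEquiv.prodAssoc R M (Fin i → R) (Fin j → R)).trans
    ((LinearEquiv.refl R M).prodCongr a)⟩

theorem addFree_one_iso (M : ModuleCat.{u} R) : Iso (addFree M 1) (ModuleCat.of R (M × R)) :=
  ⟨(LinearEquiv.refl R M).prodCongr (LinearEquiv.funUnique (Fin 1) R R)⟩

end IsoLemmas

/-! ### Ranks under free summands and extension of scalars. -/

section Ranks

variable {G H : Type u} [Group G] [Group H] {f : G →* H}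

theorem finrank_addFree [Finite G] (M : ModuleCat.{u} (GroupRing G))
    (hM : Module.Finite (GroupRing G) M) (hM' : Module.Projective (GroupRing G) M) (i : ℕ) :
    Module.finrank ℤ (addFree M i) = Module.finrank ℤ M + i * Nat.card G := by
  have := Fintype.ofFinite G
  have : Module.Finite ℤ M := finite_int (G := G)
  have : Module.Free ℤ M := free_int (G := G)
  have : Module.Finite ℤ (GroupRing G) := finite_int (G := G)
  have : Module.Free ℤ (GroupRing G) := free_int (G := G)
  have h1 : Module.finrank ℤ (GroupRing G) = Nat.card G := by
    exact Module.finrank_eq_nat_card_basis (MonoidAlgebra.basis G ℤ)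
  change Module.finrank ℤ (M × (Fin i → GroupRing G)) = _
  rw [Module.finrank_prod, Module.finrank_pi_fintype, h1]
  simp

theorem finite_addFree {R : Type u} [Ring R] (M : ModuleCat.{u} R) (hM : Module.Finite R M)
    (i : ℕ) : Module.Finite R (addFree M i) :=
  inferInstanceAs (Module.Finite R (M × (Fin i → R)))

theorem projective_addFree {R : Type u} [Ring R] (M : ModuleCat.{u} R)
    (hM : Module.Projective R M) (i : ℕ) : Module.Projective R (addFree M i) :=
  inferInstanceAs (Module.Projective R (M × (Fin i → R)))

theorem rank_addFree [Finite G] (M : ModuleCat.{u} (GroupRing G))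
    (hM : Module.Finite (GroupRing G) M) (hM' : Module.Projective (GroupRing G) M) (i : ℕ) :
    rank (addFree M i) = rank M + i := by
  rw [rank, rank, finrank_addFree M hM hM', Nat.add_mul_div_right _ _ Nat.card_pos]

theorem finrank_pos_of_nontrivial [Finite G] (M : ModuleCat.{u} (GroupRing G))
    (hM : Module.Finite (GroupRing G) M) (hM' : Module.Projective (GroupRing G) M) [Nontrivial M] :
    0 < Module.finrank ℤ M := by
  have : Module.Finite ℤ M := finite_int (G := G)
  have : Module.Free ℤ M := free_int (G := G)
  exact Module.finrank_pos

theorem IsExtension.rank_eq [Finite G] {M : ModuleCat.{u} (GroupRing G)}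
    {N : ModuleCat.{u} (GroupRing H)} (h : IsExtension f M N) (hf : Function.Surjective f)
    (hM : Module.Finite (GroupRing G) M) (hM' : Module.Projective (GroupRing G) M) :
    rank N = rank M := by
  have := Finite.of_surjective f hf
  have h1 := h.finrank_mul_card hf hM hM'
  rw [rank, rank, ← Nat.mul_div_mul_right _ _ (Nat.card_pos (α := G)), h1, mul_comm (Nat.card H),
    Nat.mul_div_mul_right _ _ Nat.card_pos]

theorem IsExtension.nontrivial [Finite G] {M : ModuleCat.{u} (GroupRing G)}
    {N : ModuleCat.{u} (GroupRing H)} (h : IsExtension f M N) (hf : Function.Surjective f)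
    (hM : Module.Finite (GroupRing G) M) (hM' : Module.Projective (GroupRing G) M)
    [Nontrivial M] : Nontrivial N := by
  have := Finite.of_surjective f hf
  have h1 := h.finrank_mul_card hf hM hM'
  have h2 := finrank_pos_of_nontrivial M hM hM'
  by_contra hN
  rw [not_nontrivial_iff_subsingleton] at hN
  rw [Module.finrank_zero_of_subsingleton, zero_mul] at h1
  exact (Nat.mul_pos h2 Nat.card_pos).ne h1

end Ranks

/-! ### Lifting free summands from ℤH to ℤG. -/

section Lifting

variable {G H : Type u} [Group G] [Group H] {f : G →* H}

theorem IsExtension.congr {M : ModuleCat.{u} (GroupRing G)} {N N' : ModuleCat.{u} (GroupRing H)}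
    (h : IsExtension f M N) (e : Iso N N') : IsExtension f M N' := by
  obtain ⟨η, hη⟩ := h
  obtain ⟨e⟩ := e
  exact ⟨_, hη.comp_equiv e⟩

/-- A semilinear map from a projective module to `R'` lifts to a functional. -/
theorem exists_functional_lift {R R' M : Type*} [Ring R] [Ring R'] {φ : R →+* R'}
    (hφ : Function.Surjective φ) [AddCommGroup M] [Module R M] [Module.Projective R M]
    (p : M →ₛₗ[φ] R') : ∃ α : M →ₗ[R] R, ∀ m, φ (α m) = p m := by
  let _ : Module R R' := Module.compHom R' φ
  let g₀ : R →ₗ[R] R' := { toFun := φ, map_add' := map_add φ, map_smul' := fun a x => map_mul φ a x }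
  let p₀ : M →ₗ[R] R' := { toFun := p, map_add' := map_add p, map_smul' := fun a => map_smulₛₗ p a }
  obtain ⟨α, hα⟩ := Module.projective_lifting_property g₀ p₀ hφ
  exact ⟨α, fun m => LinearMap.congr_fun hα m⟩

/-- A free summand of an extension of scalars lifts to a free summand. -/
theorem exists_lift_free_summand [Finite G] (hf : Function.Surjective f)
    {M : ModuleCat.{u} (GroupRing G)} (hM : Module.Finite (GroupRing G) M)
    (hM' : Module.Projective (GroupRing G) M) (hrank : 2 * Nat.card G ≤ Module.finrank ℤ M)
    {N : ModuleCat.{u} (GroupRing H)} (h : IsExtension f M (addFree N 1)) :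
    ∃ M' : ModuleCat.{u} (GroupRing G), Module.Finite (GroupRing G) M' ∧
      Module.Projective (GroupRing G) M' ∧ Iso M (addFree M' 1) ∧ IsExtension f M' N := by
  obtain ⟨η, hη⟩ := h.congr (addFree_one_iso N)
  change M →ₛₗ[ringMap f] (N × GroupRing H) at η
  replace hη : IsBaseChangeMap η := hη
  have hφ := ringMap_surjective hf
  let p : M →ₛₗ[ringMap f] GroupRing H := (LinearMap.snd (GroupRing H) N (GroupRing H)).comp η
  -- The lifted coordinate is onto modulo the kernel of ℤG → ℤH. The correction has values in that
  -- kernel, so it makes the functional onto without changing its reduction.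
  obtain ⟨α, hα⟩ := exists_functional_lift hφ p
  obtain ⟨β, hβ, hs⟩ := exists_surjective_add hrank α (RingHom.ker (ringMap f)) (by
    rw [eq_top_iff]
    rintro a -
    obtain ⟨m, hm⟩ := hη.surjective (0, ringMap f a)
    rw [← add_sub_cancel (α m) a]
    refine Submodule.add_mem_sup ⟨m, rfl⟩ ?_
    rw [RingHom.mem_ker, map_sub, hα, sub_eq_zero]
    exact (congrArg Prod.snd hm).symm)
  let γ := α + β
  have hγ : ∀ m, ringMap f (γ m) = p m := fun m => by
    change ringMap f (α m + β m) = p m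
    rw [map_add, hα, RingHom.mem_ker.mp (hβ m), add_zero]
  obtain ⟨s, hs1⟩ : ∃ s, γ s = 1 := hs 1
  have hπ : ∀ m, γ (m - γ m • s) = 0 := fun m => by
    rw [map_sub, map_smul, hs1, smul_eq_mul, mul_one, sub_self]
  let π : M →ₗ[GroupRing G] LinearMap.ker γ :=
    LinearMap.codRestrict _ (LinearMap.id - LinearMap.toSpanSingleton _ M s ∘ₗ γ) hπ
  have hπ' : ∀ m, (π m : M) = m - γ m • s := fun m => rfl
  have hπk : ∀ k : LinearMap.ker γ, π k = k := fun k => Subtype.ext (by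
    rw [hπ', LinearMap.mem_ker.mp k.2, zero_smul, sub_zero])
  have hsurjπ : Function.Surjective π := fun k => ⟨k, hπk k⟩
  let e : M ≃ₗ[GroupRing G] (LinearMap.ker γ × GroupRing G) :=
    LinearEquiv.ofLinearMap (π.prod γ)
      ((LinearMap.ker γ).subtype.coprod (LinearMap.toSpanSingleton _ M s))
      (LinearMap.ext fun x => by
        have h1 : γ (x.1 + x.2 • s) = x.2 := by
          rw [map_add, LinearMap.mem_ker.mp x.1.2, zero_add, map_smul, hs1, smul_eq_mul, mul_one]
        refine Prod.ext (Subtype.ext ?_) h1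
        change (x.1 + x.2 • s : M) - γ (x.1 + x.2 • s) • s = x.1
        rw [h1, add_sub_cancel_right])
      (LinearMap.ext fun m => sub_add_cancel m (γ m • s))
  refine ⟨ModuleCat.of _ (LinearMap.ker γ), Module.Finite.of_surjective π hsurjπ,
    Module.Projective.of_split (LinearMap.ker γ).subtype π (LinearMap.ext hπk),
    Iso.trans (N := ModuleCat.of _ (LinearMap.ker γ × GroupRing G)) ⟨e⟩
      (addFree_one_iso (ModuleCat.of _ (LinearMap.ker γ))).symm, ?_⟩
  let η' : LinearMap.ker γ →ₛₗ[ringMap f] N :=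
    (LinearMap.fst (GroupRing H) N (GroupRing H)).comp (η.comp (LinearMap.ker γ).subtype)
  suffices hη' : IsBaseChangeMap η' from ⟨η', hη'⟩
  refine ⟨fun n => ?_, fun k hk => ?_⟩
  · obtain ⟨m, hm⟩ := hη.surjective (n, 0)
    have h1 : ringMap f (γ m) = 0 := (hγ m).trans (congrArg Prod.snd hm)
    refine ⟨π m, ?_⟩
    change (η (m - γ m • s)).1 = n
    rw [map_sub, map_smulₛₗ, h1, zero_smul, sub_zero, hm]
  · have h1 : η k = 0 := by
      refine Prod.ext hk ?_
      have h2 := hγ k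
      rw [LinearMap.mem_ker.mp k.2, map_zero] at h2
      exact h2.symm
    -- A priori `k` is a combination of kernel multiples of vectors of `M`; the retraction `π` moves
    -- these vectors into ker γ.
    have h3 := map_kerSMul π (hη.mem_kerSMul _ h1)
    rwa [hπk] at h3

/-- Modules in the stable class of an extension of scalars lift. -/
theorem exists_lift_of_iso_addFree [Finite G] (hf : Function.Surjective f)
    {N : ModuleCat.{u} (GroupRing H)} (hN : Module.Finite (GroupRing H) N)
    (hN' : Module.Projective (GroupRing H) N) [Nontrivial N] (i : ℕ)
    {M : ModuleCat.{u} (GroupRing G)} (hM : Module.Finite (GroupRing G) M)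
    (hM' : Module.Projective (GroupRing G) M) (h : IsExtension f M (addFree N i)) :
    ∃ Q : ModuleCat.{u} (GroupRing G), Module.Finite (GroupRing G) Q ∧
      Module.Projective (GroupRing G) Q ∧ Iso M (addFree Q i) ∧ IsExtension f Q N := by
  have := Finite.of_surjective f hf
  induction i generalizing M with
  | zero => exact ⟨M, hM, hM', (addFree_zero_iso M).symm, h.congr (addFree_zero_iso N)⟩
  | succ i ih =>
    -- Here N ≠ 0 matters: its ℤ-rank is a positive multiple of |H|, and at least one more summand
    -- ℤH is present.
    have hrank : 2 * Nat.card G ≤ Module.finrank ℤ M := by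
      have h1 := h.finrank_mul_card hf hM hM'
      rw [finrank_addFree N hN hN'] at h1
      have h2 := Nat.le_of_dvd (finrank_pos_of_nontrivial N hN hN')
        (card_dvd_finrank (G := H) N)
      refine Nat.le_of_mul_le_mul_right ?_ (Nat.card_pos (α := H))
      rw [← h1, mul_right_comm]
      refine Nat.mul_le_mul_right _ ?_
      rw [two_mul, add_mul, one_mul, add_comm (i * _), ← add_assoc]
      exact (Nat.add_le_add_right h2 _).trans (Nat.le_add_right _ _)
    obtain ⟨M', hM1, hM2, e, h'⟩ := exists_lift_free_summand hf hM hM' hrank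
      (h.congr (addFree_addFree_iso N i 1).symm)
    obtain ⟨Q, hQ, hQ', e', h''⟩ := ih hM1 hM2 h'
    exact ⟨Q, hQ, hQ', e.trans ((e'.addFree_congr 1).trans (addFree_addFree_iso Q i 1)), h''⟩

end Lifting

/-! ### Orbits of a stable class form a graded tree. -/

section Trees

/-- A graph whose edges join each vertex to its successor, of the next grade, is a graded tree if
any two vertices have a common iterated successor. -/
theorem GradedGraph.isGradedTree_of_up (T : GradedGraph.{u}) (up : T.V → T.V) [Nonempty T.V]
    (hgrade : ∀ x, T.grade (up x) = T.grade x + 1)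
    (hadj : ∀ x y, T.graph.Adj x y ↔ y = up x ∨ x = up y)
    (hconn : ∀ x y, ∃ i j : ℕ, up^[i] x = up^[j] y) : T.IsGradedTree := by
  have hgrade_iter : ∀ n x, T.grade (up^[n] x) = T.grade x + n := fun n x => by
    induction n generalizing x with
    | zero => rfl
    | succ n ih => rw [Function.iterate_succ_apply, ih, hgrade]; omega
  have hreach : ∀ n x, T.graph.Reachable x (up^[n] x) := fun n x => by
    induction n generalizing x with
    | zero => exact SimpleGraph.Reachable.refl _
    | succ n ih =>
      rw [Function.iterate_succ_apply]
      exact (SimpleGraph.Adj.reachable ((hadj _ _).mpr (Or.inl rfl))).trans (ih _)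
  refine ⟨⟨⟨fun x y => ?_⟩, ?_⟩, fun x y h => ?_, fun x => ⟨up x, ⟨(hadj _ _).mpr (Or.inl rfl),
    hgrade x⟩, fun y ⟨h, hy⟩ => ?_⟩⟩
  · obtain ⟨i, j, h⟩ := hconn x y
    exact (hreach i x).trans (h ▸ (hreach j y).symm)
  · have hbridge : ∀ x, T.graph.IsBridge s(x, up x) := fun x => by
      rw [SimpleGraph.isBridge_iff]
      rintro ⟨w⟩
      have key : ∀ {a b : T.V}, (T.graph \ SimpleGraph.fromEdgeSet {s(x, up x)}).Walk a b →
          (∃ n, up^[n] a = x) → ∃ n, up^[n] b = x := by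
        intro a b w
        induction w with
        | nil => exact id
        | @cons a c b h _ ih =>
          refine fun ⟨n, hn⟩ => ih ?_
          obtain ⟨h1, h2⟩ := h
          rcases (hadj _ _).mp h1 with rfl | rfl
          · cases n with
            | zero =>
              obtain rfl : a = x := hn
              exact (h2 ((SimpleGraph.fromEdgeSet_adj _).mpr ⟨rfl, h1.ne⟩)).elim
            | succ n => exact ⟨n, hn⟩
          · exact ⟨n + 1, hn⟩
      obtain ⟨n, hn⟩ := key w ⟨0, rfl⟩
      have := congrArg T.grade hn
      rw [hgrade_iter, hgrade] at this
      omega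
    rw [SimpleGraph.isAcyclic_iff_forall_adj_isBridge]
    intro x y h
    rcases (hadj _ _).mp h with rfl | rfl
    · exact hbridge x
    · rw [Sym2.eq_swap]
      exact hbridge y
  · rcases (hadj _ _).mp h with rfl | rfl
    · exact Or.inl (hgrade x)
    · exact Or.inr (hgrade y)
  · rcases (hadj _ _).mp h with rfl | rfl
    · rfl
    · rw [hgrade] at hy
      omega

variable {G : Type u} [Group G] {Γ : Type u} [Group Γ] {P : ModuleCat.{u} (GroupRing G)}
  (ρ : Γ →* MulAut G) (χ : Γ →* (ZMod (Nat.card G))ˣ)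

theorem Sends.addFree {θ : MulAut G} {r : (ZMod (Nat.card G))ˣ} {Q Q' : ModuleCat.{u} (GroupRing G)}
    (h : Sends θ r Q Q') (j : ℕ) : Sends θ r (addFree Q j) (addFree Q' j) := by
  obtain ⟨P₁, i, h1, h2, h3, h4, h5⟩ := h
  exact ⟨P₁, i + j, h1, h2, h3, (h4.addFree_congr j).trans (addFree_addFree_iso _ _ _),
    (h5.addFree_congr j).trans (addFree_addFree_iso _ _ _)⟩

theorem Member.cls_eq {Q Q' : Member P} (h : Iso Q.1 Q'.1) : Q.cls = Q'.cls := Quotient.sound h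

/-- Adding a free summand, on isomorphism classes. -/
def StableClass.up (x : StableClass P) : StableClass P :=
  Quotient.map (sa := memberSetoid P) (sb := memberSetoid P) Member.up
    (fun _ _ h => Iso.addFree_congr h 1) x

/-- Adding a free summand, on orbits. -/
def orbitUp : (orbitTree P ρ χ).V → (orbitTree P ρ χ).V :=
  Quot.map StableClass.up (by
    rintro _ _ ⟨γ, Q, Q', rfl, rfl, h⟩
    exact ⟨γ, Q.up, Q'.up, rfl, rfl, h.addFree 1⟩)

theorem orbitUp_orbit (Q : Member P) : orbitUp ρ χ (orbit ρ χ Q) = orbit ρ χ Q.up := rfl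

theorem exists_orbit_eq (x : (orbitTree P ρ χ).V) : ∃ Q : Member P, orbit ρ χ Q = x := by
  obtain ⟨c, rfl⟩ := Quot.exists_rep x
  obtain ⟨Q, rfl⟩ := Quotient.exists_rep c
  exact ⟨Q, rfl⟩

theorem orbit_eq {Q Q' : Member P} (h : Iso Q.1 Q'.1) : orbit ρ χ Q = orbit ρ χ Q' :=
  congrArg (Quot.mk _) (Member.cls_eq h)

theorem grade_orbit (Q : Member P) : (orbitTree P ρ χ).grade (orbit ρ χ Q) = rank Q.1 := rfl

theorem exists_iterate_orbitUp (Q : Member P) (n : ℕ) :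
    ∃ Q' : Member P, Iso Q'.1 (addFree Q.1 n) ∧ (orbitUp ρ χ)^[n] (orbit ρ χ Q) = orbit ρ χ Q' := by
  induction n with
  | zero => exact ⟨Q, (addFree_zero_iso _).symm, rfl⟩
  | succ n ih =>
    obtain ⟨Q', h1, h2⟩ := ih
    refine ⟨Q'.up, (h1.addFree_congr 1).trans (addFree_addFree_iso _ _ _), ?_⟩
    rw [Function.iterate_succ_apply', h2, orbitUp_orbit]

variable [Finite G]

theorem grade_orbitUp (x : (orbitTree P ρ χ).V) :
    (orbitTree P ρ χ).grade (orbitUp ρ χ x) = (orbitTree P ρ χ).grade x + 1 := by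
  obtain ⟨Q, rfl⟩ := exists_orbit_eq ρ χ x
  rw [orbitUp_orbit, grade_orbit, grade_orbit]
  exact rank_addFree Q.1 Q.2.finite Q.2.projective 1

theorem orbitTree_adj_iff (x y : (orbitTree P ρ χ).V) :
    (orbitTree P ρ χ).graph.Adj x y ↔ y = orbitUp ρ χ x ∨ x = orbitUp ρ χ y := by
  have h1 : ∀ x y : (orbitTree P ρ χ).V,
      (∃ Q : Member P, x = Quot.mk _ Q.cls ∧ y = Quot.mk _ Q.up.cls) ↔ y = orbitUp ρ χ x := by
    intro x y
    constructor
    · rintro ⟨Q, rfl, rfl⟩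
      rfl
    · rintro rfl
      obtain ⟨Q, rfl⟩ := exists_orbit_eq ρ χ x
      exact ⟨Q, rfl, rfl⟩
  have h2 : (orbitTree P ρ χ).graph.Adj x y ↔ x ≠ y ∧
      ((∃ Q : Member P, x = Quot.mk _ Q.cls ∧ y = Quot.mk _ Q.up.cls) ∨
        ∃ Q : Member P, y = Quot.mk _ Q.cls ∧ x = Quot.mk _ Q.up.cls) :=
    SimpleGraph.fromRel_adj _ x y
  rw [h2, h1, h1, and_iff_right_iff_imp]
  rintro (h | h) rfl
  · have := grade_orbitUp ρ χ x
    rw [← h] at this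
    omega
  · have := grade_orbitUp ρ χ x
    rw [← h] at this
    omega

theorem StablyEquiv.trans {R : Type u} [Ring R] {L M N : ModuleCat.{u} R} (h : StablyEquiv L M)
    (h' : StablyEquiv M N) : StablyEquiv L N := by
  obtain ⟨i, j, h⟩ := h
  obtain ⟨k, l, h'⟩ := h'
  refine ⟨i + k, l + j, (addFree_addFree_iso _ _ _).symm.trans ((h.addFree_congr k).trans
    ((addFree_addFree_iso _ _ _).trans ?_))⟩
  rw [add_comm j k]
  exact (addFree_addFree_iso _ _ _).symm.trans ((h'.addFree_congr j).trans
    (addFree_addFree_iso _ _ _))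

theorem StablyEquiv.symm {R : Type u} [Ring R] {M N : ModuleCat.{u} R} (h : StablyEquiv M N) :
    StablyEquiv N M := by
  obtain ⟨i, j, h⟩ := h
  exact ⟨j, i, h.symm⟩

/-- The orbits of a stable class of projective modules form a graded tree. -/
theorem orbitTree_isGradedTree (hP : Module.Finite (GroupRing G) P)
    (hP' : Module.Projective (GroupRing G) P) : (orbitTree P ρ χ).IsGradedTree := by
  -- `P` itself may be zero, hence no vertex; P ⊕ ℤG always is one.
  have : Nonempty (orbitTree P ρ χ).V := ⟨orbit ρ χ ⟨addFree P 1, finite_addFree P hP 1,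
    projective_addFree P hP' 1, inferInstanceAs (Nontrivial (P × (Fin 1 → GroupRing G))),
    0, 1, addFree_zero_iso _⟩⟩
  refine GradedGraph.isGradedTree_of_up _ (orbitUp ρ χ) (grade_orbitUp ρ χ)
    (orbitTree_adj_iff ρ χ) fun x y => ?_
  obtain ⟨Q, rfl⟩ := exists_orbit_eq ρ χ x
  obtain ⟨Q', rfl⟩ := exists_orbit_eq ρ χ y
  obtain ⟨i, j, h⟩ := Q.2.stablyEquiv.trans Q'.2.stablyEquiv.symm
  obtain ⟨R, h1, h2⟩ := exists_iterate_orbitUp ρ χ Q i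
  obtain ⟨R', h3, h4⟩ := exists_iterate_orbitUp ρ χ Q' j
  exact ⟨i, j, by rw [h2, h4]; exact orbit_eq ρ χ (h1.trans (h.trans h3.symm))⟩

end Trees

/-! ### The induced map of trees and its surjectivity. -/

section InducedMap

variable {G H : Type u} [Group G] [Group H] [Finite G] {f : G →* H} {Γ Δ : Type u} [Group Γ]
  [Group Δ] {P : ModuleCat.{u} (GroupRing G)} {ρ : Γ →* MulAut G} {χ : Γ →* (ZMod (Nat.card G))ˣ}
  {ρ' : Δ →* MulAut H} {χ' : Δ →* (ZMod (Nat.card H))ˣ}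

theorem InStableClass.extendScalars (hf : Function.Surjective f)
    {Q : ModuleCat.{u} (GroupRing G)} (h : InStableClass P Q) :
    InStableClass (extendScalars f P) (extendScalars f Q) := by
  have hP := isExtension_extendScalars hf P
  have hQ := isExtension_extendScalars hf Q
  obtain ⟨h1, h2, h3, i, j, h4⟩ := h
  exact ⟨hQ.finite hf h1, hQ.projective hf h2, hQ.nontrivial hf h1 h2, i, j,
    (hQ.addFree hf i).iso (hP.addFree hf j) hf h4⟩

/-- The map `κ` serves both forms of the action: it is the identity when Aut(G) acts through f_*,
and θ ↦ f_*(θ) when Im(f_*) acts. -/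
theorem ActsOn.extendScalars (hf : Function.Surjective f) (h : ActsOn P ρ χ) (κ : Γ → Δ)
    (hκ : Function.Surjective κ) (hρ : ∀ γ g, ρ' (κ γ) (f g) = f (ρ γ g))
    (hχ : ∀ γ, χ' (κ γ) = reduceUnits f hf (χ γ)) : ActsOn (extendScalars f P) ρ' χ' := by
  intro δ
  obtain ⟨γ, rfl⟩ := hκ δ
  obtain ⟨i, j, e⟩ := h γ
  have hP := isExtension_extendScalars hf P
  rw [hχ]
  exact ⟨i, j, (hP.addFree hf i).iso
    (((hP.twist (hρ γ)).sum (IsExtension.swanIdeal hf (χ γ))).addFree hf j) hf e⟩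

theorem Sends.extendScalars (hf : Function.Surjective f) {θ : MulAut G} {θ' : MulAut H}
    (hθ : ∀ g, θ' (f g) = f (θ g)) {r : (ZMod (Nat.card G))ˣ} {Q Q' : ModuleCat.{u} (GroupRing G)}
    (h : Sends θ r Q Q') :
    Sends θ' (reduceUnits f hf r) (extendScalars f Q) (extendScalars f Q') := by
  obtain ⟨P₁, i, h1, h2, h3, e, e'⟩ := h
  have hP := isExtension_extendScalars hf P₁
  refine ⟨StableTree.extendScalars f P₁, i, hP.finite hf h1, hP.projective hf h2,
    (hP.rank_eq hf h1 h2).trans h3, ?_, ?_⟩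
  · exact (isExtension_extendScalars hf Q).iso (hP.addFree hf i) hf e
  · exact (isExtension_extendScalars hf Q').iso
      (((hP.twist hθ).swanTensor hf r).addFree hf i) hf e'

/-- Extension of scalars induces a surjection of graded trees. -/
theorem inducesSurjection (hf : Function.Surjective f) (hP : Module.Finite (GroupRing G) P)
    (hP' : Module.Projective (GroupRing G) P) (κ : Γ → Δ)
    (hρ : ∀ γ g, ρ' (κ γ) (f g) = f (ρ γ g)) (hχ : ∀ γ, χ' (κ γ) = reduceUnits f hf (χ γ)) :
    InducesSurjection f P ρ χ ρ' χ' := by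
  have := Finite.of_surjective f hf
  have hmem : ∀ Q : Member P, InStableClass (StableTree.extendScalars f P)
      (StableTree.extendScalars f Q.1) := fun Q => Q.2.extendScalars hf
  let ext : Member P → Member (StableTree.extendScalars f P) := fun Q =>
    ⟨StableTree.extendScalars f Q.1, hmem Q⟩
  let F₀ : StableClass P → StableClass (StableTree.extendScalars f P) :=
    Quotient.map (sa := memberSetoid P) (sb := memberSetoid _) ext fun Q Q' e =>
      (isExtension_extendScalars hf Q.1).iso (isExtension_extendScalars hf Q'.1) hf e
  let F : (orbitTree P ρ χ).V → (orbitTree (StableTree.extendScalars f P) ρ' χ').V :=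
    Quot.map F₀ (by
      rintro _ _ ⟨γ, Q, Q', rfl, rfl, h⟩
      exact ⟨κ γ, ext Q, ext Q', rfl, rfl, hχ γ ▸ h.extendScalars hf (hρ γ)⟩)
  have hF : ∀ Q, F (orbit ρ χ Q) = orbit ρ' χ' (ext Q) := fun Q => rfl
  have hFup : ∀ x, F (orbitUp ρ χ x) = orbitUp ρ' χ' (F x) := fun x => by
    obtain ⟨Q, rfl⟩ := exists_orbit_eq ρ χ x
    rw [orbitUp_orbit, hF, hF, orbitUp_orbit]
    exact orbit_eq ρ' χ' ((isExtension_extendScalars hf _).iso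
      ((isExtension_extendScalars hf Q.1).addFree hf 1) hf Iso.rfl)
  refine ⟨hmem, ⟨F, fun x y h => ?_, fun x => ?_⟩, fun y => ?_, hF⟩
  · rw [orbitTree_adj_iff] at h ⊢
    rcases h with rfl | rfl
    · exact Or.inl (hFup x)
    · exact Or.inr (hFup y)
  · obtain ⟨Q, rfl⟩ := exists_orbit_eq ρ χ x
    rw [hF, grade_orbit, grade_orbit]
    exact (isExtension_extendScalars hf Q.1).rank_eq hf Q.2.finite Q.2.projective
  · obtain ⟨N, rfl⟩ := exists_orbit_eq ρ' χ' y
    -- P ⊕ ℤG^j extends to N ⊕ ℤH^i. Splitting off the `i` free summands over ℤG leaves a preimage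
    -- of `N`, which is stably equivalent to `P` by construction.
    obtain ⟨i, j, e⟩ := N.2.stablyEquiv
    have := N.2.nontrivial
    have h1 := ((isExtension_extendScalars hf P).addFree hf j).congr e.symm
    obtain ⟨Q, hQ, hQ', e', h2⟩ := exists_lift_of_iso_addFree hf N.2.finite N.2.projective i
      (finite_addFree P hP j) (projective_addFree P hP' j) h1
    have hnt : Nontrivial Q := by
      obtain ⟨η, hη⟩ := h2
      exact hη.surjective.nontrivial
    let Q₀ : Member P := ⟨Q, hQ, hQ', hnt, i, j, e'.symm⟩
    refine ⟨orbit ρ χ Q₀, ?_⟩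
    change F (orbit ρ χ Q₀) = _
    rw [hF]
    exact orbit_eq ρ' χ' ((isExtension_extendScalars hf Q).iso h2 hf Iso.rfl)

end InducedMap
end StableTree

end

theorem mainTheorem10 {G H : Type u} [Group G] [Group H] [Finite G] (f : G →* H)
    (hf : Function.Surjective f) (hchar : f.ker.Characteristic)
    (P : ModuleCat.{u} (StableTree.GroupRing G))
    (hfin : Module.Finite (StableTree.GroupRing G) P)
    (hproj : Module.Projective (StableTree.GroupRing G) P)
    (ψ : MulAut G →* (ZMod (Nat.card G))ˣ)
    (hψ : StableTree.ActsOn P (MonoidHom.id (MulAut G)) ψ) :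
    -- the quotient `[P]/Aut(G)` is a graded tree
    (StableTree.orbitTree P (MonoidHom.id (MulAut G)) ψ).IsGradedTree ∧
    -- the action induced by `f`: the automorphism `f_*(θ)` of `H` acts with the residue of `ψ(θ)`
    StableTree.ActsOn (StableTree.extendScalars f P) (StableTree.inducedAut f hf hchar)
      ((StableTree.reduceUnits f hf).comp ψ) ∧
    (StableTree.orbitTree (StableTree.extendScalars f P) (StableTree.inducedAut f hf hchar)
      ((StableTree.reduceUnits f hf).comp ψ)).IsGradedTree ∧
    StableTree.InducesSurjection f P (MonoidHom.id (MulAut G)) ψ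
      (StableTree.inducedAut f hf hchar) ((StableTree.reduceUnits f hf).comp ψ) ∧
    -- the same for the subgroup `Im(f_*)` whenever the residue of `ψ(θ)` depends only on `f_*(θ)`
    ∀ φ : (StableTree.inducedAut f hf hchar).range →* (ZMod (Nat.card H))ˣ,
      (∀ θ : MulAut G, φ ((StableTree.inducedAut f hf hchar).rangeRestrict θ) =
        StableTree.reduceUnits f hf (ψ θ)) →
      StableTree.ActsOn (StableTree.extendScalars f P)
        (StableTree.inducedAut f hf hchar).range.subtype φ ∧
      (StableTree.orbitTree (StableTree.extendScalars f P)
        (StableTree.inducedAut f hf hchar).range.subtype φ).IsGradedTree ∧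
      StableTree.InducesSurjection f P (MonoidHom.id (MulAut G)) ψ
        (StableTree.inducedAut f hf hchar).range.subtype φ := by
  have hρ := StableTree.inducedAut_apply f hf hchar
  have hE := StableTree.isExtension_extendScalars hf P
  have := Finite.of_surjective f hf
  refine ⟨StableTree.orbitTree_isGradedTree _ _ hfin hproj,
    hψ.extendScalars hf id Function.surjective_id hρ fun _ => rfl,
    StableTree.orbitTree_isGradedTree _ _ (hE.finite hf hfin) (hE.projective hf hproj),
    StableTree.inducesSurjection hf hfin hproj id hρ fun _ => rfl, fun φ hφ => ⟨?_, ?_, ?_⟩⟩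
  · exact hψ.extendScalars hf _ (StableTree.inducedAut f hf hchar).rangeRestrict_surjective hρ hφ
  · exact StableTree.orbitTree_isGradedTree _ _ (hE.finite hf hfin) (hE.projective hf hproj)
  · exact StableTree.inducesSurjection hf hfin hproj
      (StableTree.inducedAut f hf hchar).rangeRestrict hρ hφ
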